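/- **Conventions.** For a subgroup $C$ and an element $x$ of a group put $C^x=x^{-1}Cx$. Groups with decision problems are finitely generated, and their elements are given as words in a finite generating set. A finitely generated group $G$ has decidable *membership problem* if, given $a\in G$ and a finite $X\subset G$, one can decide whether $a\in\langle X\rangle$; decidable *power coset membership problem* if, given $x,g\in G$ and a finite generating set of a subgroup $H\le G$, one can decide whether $g^m\in xH$ for some integer $m\neq 0$; decidable *power membership problem* if this can be decided for $x=1$. A *graph* has vertices, edges with origin $o(e)$ and terminus $t(e)$, and a fixed-point-free involution $e\mapsto e^{-1}$ with $o(e^{-1})=t(e)$. A *graph of groups* $\mathbb A$ is a graph $A$ with vertex groups $A_v$, edge groups $A_e=A_{e^{-1}}$ and monomorphisms $\alpha_e:A_e\to A_{o(e)}$, $\omega_e=\alpha_{e^{-1}}:A_e\to A_{t(e)}$. An *$\mathbb A$-path* $\langle p_0,e_1,p_1,\dots,e_n,p_n\rangle$ is an edge path $e_1,\dots,e_n$ with elements $p_0\in A_{o(e_1)}$ and $p_i\in A_{t(e_i)}$ (for $n=0$: one element of one vertex group). $\pi_1(\mathbb A,v_0)$ is the group of $\mathbb A$-loops at $v_0$ under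 concatenation, modulo the equivalence generated by replacing a subpath $\langle a,e,\omega_e(c),e^{-1},b\rangle$, $c\in A_e$, by $\langle a\alpha_e(c)b\rangle$. $\mathbb A$ is *benign* if it is a finite connected graph of finitely generated groups such that: (1) for each vertex $v$ and edge $e$ with $o(e)=v$ there is an algorithm that, given a finite $X\subset A_v$ and $a\in A_v$, decides whether $\langle X\rangle\cap a\,\alpha_e(A_e)$ is empty and, if it is not, produces an element of it; (2) every subgroup of every edge group is finitely generated; (3) every edge group has decidable membership problem; (4) for each vertex $v$ and edge $e$ with $o(e)=v$ there is an algorithm that, given a finite $X\subset A_v$, computes a finite generating set of $\langle X\rangle\cap\alpha_e(A_e)$. An *$\mathbb A$-graph* $\mathbb B$ is a graph $B$ with a graph morphism $[\cdot]:B\to A$, a subgroup $B_u\le A_{[u]}$ for each vertex $u$, and elements $f_\alpha\in A_{[o(f)]}$, $f_\omega\in A_{[t(f)]}$ for each edge $f$ with $(f^{-1})_\alpha=(f_\omega)^{-1}$. Here we consider finite $\mathbb A$-graphs with finitely generated vertex groups $B_u$. Put $B_f=\alpha_{[f]}^{-1}(f_\alpha^{-1}B_{o(f)}f_\alpha)\cap\omega_{[f]}^{-1}(f_\omega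 B_{t(f)}f_\omega^{-1})$. $\mathbb B$ is *folded* if (I) there are no edges $f_1,f_2$ with $f_2\ne f_1^{-1}$, $t(f_1)=o(f_2)=u$, $[f_1]=[f_2^{-1}]=e$ and $(f_1)_\omega\, b\,(f_2)_\alpha=\omega_e(c)$ for some $b\in B_u$, $c\in A_e$; and (II) $\alpha_{[f]}^{-1}(f_\alpha^{-1}B_{o(f)}f_\alpha)=\omega_{[f]}^{-1}(f_\omega B_{t(f)}f_\omega^{-1})$ for every edge $f$. **Property 1.** A group $G$ satisfies Property 1 with respect to a subgroup $C$ if for every finitely generated $H\le G$ and all $x,g\in G$ with $gx^{-1}\notin C$ such that $H\cap C$ and $H\cap C^x$ are finite, there are only finitely many pairs $(c,c')\in C\times C^x$ with $cgc'\in H$. It satisfies Property 1 with respect to a pair $(C,C')$ of subgroups if for every finitely generated $H\le G$ and $g\in G$ such that $H\cap C$ and $H\cap C'$ are finite, there are only finitely many pairs $(c,c')\in C\times C'$ with $cgc'\in H$. **Property 2.** For a folded $\mathbb A$-graph $\mathbb B$, the pair $(\mathbb A,\mathbb B)$ satisfies Property 2 if: (i) every vertex group of $\mathbb A$ has decidable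 membership and power membership problem; (ii) there is an algorithm that, given an edge $f$ of $\mathbb B$ and $x\in A_{[o(f)]}$, decides whether $xB_{o(f)}\cap\alpha_{[f]}(A_{[f]})^{f_\alpha^{-1}}$ is empty; (iii) for every edge $f$ of $\mathbb B$, if $B_f$ is infinite then it has finite index in $A_{[f]}$; (iv) for every edge cycle $f_1,\dots,f_m$ ($m\ge1$, $t(f_i)=o(f_{i+1})$, indices modulo $m$) of $\mathbb B$ with all $B_{f_i}$ finite there is an $i$ such that, writing $e_j=[f_j]$: if $e_{i+1}\ne e_i^{-1}$, then $A_{[t(f_i)]}$ satisfies Property 1 with respect to the pair $\bigl(\omega_{e_i}(A_{e_i})^{(f_i)_\omega},\ \alpha_{e_{i+1}}(A_{e_{i+1}})^{(f_{i+1})_\alpha^{-1}}\bigr)$; and if $e_{i+1}=e_i^{-1}$, then $A_{[t(f_i)]}$ satisfies Property 1 with respect to $\omega_{e_i}(A_{e_i})^{(f_i)_\omega}$. **Theorem.** Let $G=\pi_1(\mathbb A,v_0)$ be the fundamental group of a benign graph of groups $\mathbb A$ in which every vertex group has decidable power coset membership problem. Suppose that for every folded $\mathbb A$-graph $\mathbb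 B$ the pair $(\mathbb A,\mathbb B)$ satisfies Property 2. Then the power coset membership problem is decidable in $G$. -/

import Mathlib

universe u v w x

/-! ### Decision problems in finitely generated groups -/

/-- Words in `n` letters and their formal inverses (`true` for a letter, `false` for its inverse). -/
abbrev GroupWord (n : ℕ) : Type := List (Fin n × Bool)

/-- The element of `G` spelled by a word, when the letters stand for `s 0, …, s (n - 1)`. -/
def GroupWord.eval {G : Type*} [Group G] {n : ℕ} (s : Fin n → G) (l : GroupWord n) : G :=
  (l.map fun p => if p.2 then s p.1 else (s p.1)⁻¹).prod

/-- The subgroup generated by the elements spelled by a finite list of words. -/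
def GroupWord.span {G : Type*} [Group G] {n : ℕ} (s : Fin n → G) (X : List (GroupWord n)) :
    Subgroup G :=
  Subgroup.closure {g | ∃ l ∈ X, GroupWord.eval s l = g}

/-- `s` is a finite generating tuple of `G`. -/
def Generates {G : Type*} [Group G] {n : ℕ} (s : Fin n → G) : Prop :=
  Subgroup.closure (Set.range s) = ⊤

/-- The (uniform) membership problem: given `a` and a finite set `X`, decide `a ∈ ⟨X⟩`.
The group is finitely generated and its elements are given as words in a generating tuple (whether
the problem is decidable does not depend on the tuple). -/
def DecidableMembership (G : Type*) [Group G] : Prop :=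
  Group.FG G ∧ ∀ (n : ℕ) (s : Fin n → G), Generates s →
    ComputablePred fun i : GroupWord n × List (GroupWord n) =>
      GroupWord.eval s i.1 ∈ GroupWord.span s i.2

/-- The power coset membership problem: given `x`, `g` and a finite set of generators of `H`,
decide whether `g ^ m ∈ x H` for some non-zero integer `m`. -/
def DecidablePowerCosetMembership (G : Type*) [Group G] : Prop :=
  Group.FG G ∧ ∀ (n : ℕ) (s : Fin n → G), Generates s →
    ComputablePred fun i : GroupWord n × GroupWord n × List (GroupWord n) =>
      ∃ m : ℤ, m ≠ 0 ∧ ∃ h ∈ GroupWord.span s i.2.2,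
        GroupWord.eval s i.2.1 ^ m = GroupWord.eval s i.1 * h

/-- The power membership problem: the power coset membership problem with `x = 1`. -/
def DecidablePowerMembership (G : Type*) [Group G] : Prop :=
  Group.FG G ∧ ∀ (n : ℕ) (s : Fin n → G), Generates s →
    ComputablePred fun i : GroupWord n × List (GroupWord n) =>
      ∃ m : ℤ, m ≠ 0 ∧ GroupWord.eval s i.1 ^ m ∈ GroupWord.span s i.2

/-- The conjugate `C ^ x = x⁻¹ C x`. -/
def conjSubgroup {G : Type*} [Group G] (C : Subgroup G) (x : G) : Subgroup G :=
  C.map (MulAut.conj x⁻¹).toMonoidHom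

/-- The double coset property of `G` with respect to one subgroup `C`. -/
def DoubleCosetProperty {G : Type*} [Group G] (C : Subgroup G) : Prop :=
  ∀ H : Subgroup G, H.FG → ∀ x g : G, g * x⁻¹ ∉ C →
    Finite ↥(H ⊓ C) → Finite ↥(H ⊓ conjSubgroup C x) →
      {p : G × G | p.1 ∈ C ∧ p.2 ∈ conjSubgroup C x ∧ p.1 * g * p.2 ∈ H}.Finite

/-- The double coset property of `G` with respect to a pair of subgroups `(C, C')`. -/
def DoubleCosetPairProperty {G : Type*} [Group G] (C C' : Subgroup G) : Prop :=
  ∀ H : Subgroup G, H.FG → ∀ g : G,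
    Finite ↥(H ⊓ C) → Finite ↥(H ⊓ C') →
      {p : G × G | p.1 ∈ C ∧ p.2 ∈ C' ∧ p.1 * g * p.2 ∈ H}.Finite

/-! ### Graphs of groups and their fundamental groups -/

/-- A graph of groups. The underlying graph has vertex set `V`; an edge `e` with `o(e) = a` and
`t(e) = b` is an arrow `e : a ⟶ b`, and `e⁻¹` is `Quiver.reverse e : b ⟶ a`, a fixed-point-free
involution. The equality of the groups of `e` and `e⁻¹` is an identification `flip e` under which
`α` and `ω` are exchanged. -/
structure GraphOfGroups (V : Type u) [Quiver.{v} V] [Quiver.HasInvolutiveReverse V] where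
  reverse_ne : ∀ (a : V) (e : a ⟶ a), Quiver.reverse e ≠ e
  VG : V → Type w
  [vGroup : ∀ a, Group (VG a)]
  EG : ∀ {a b : V}, (a ⟶ b) → Type x
  [eGroup : ∀ {a b : V} (e : a ⟶ b), Group (EG e)]
  α : ∀ {a b : V} (e : a ⟶ b), EG e →* VG a
  ω : ∀ {a b : V} (e : a ⟶ b), EG e →* VG b
  α_injective : ∀ {a b : V} (e : a ⟶ b), Function.Injective (α e)
  ω_injective : ∀ {a b : V} (e : a ⟶ b), Function.Injective (ω e)
  flip : ∀ {a b : V} (e : a ⟶ b), EG e ≃* EG (Quiver.reverse e)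
  α_flip : ∀ {a b : V} (e : a ⟶ b) (c : EG e), α (Quiver.reverse e) (flip e c) = ω e c
  ω_flip : ∀ {a b : V} (e : a ⟶ b) (c : EG e), ω (Quiver.reverse e) (flip e c) = α e c

attribute [instance] GraphOfGroups.vGroup GraphOfGroups.eGroup

namespace GraphOfGroups

variable {V : Type u} [Quiver.{v} V] [Quiver.HasInvolutiveReverse V]

/-- `𝔸`-paths `⟨p₀, e₁, p₁, …, eₙ, pₙ⟩` from one vertex to another. -/
inductive Path (A : GraphOfGroups.{u, v, w, x} V) : V → V → Type (max u v w) where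
  | nil {a : V} (g : A.VG a) : Path A a a
  | cons {a b c : V} (g : A.VG a) (e : a ⟶ b) (p : Path A b c) : Path A a c

namespace Path

variable {A : GraphOfGroups.{u, v, w, x} V} {a b c d : V}

/-- Multiply the first group element of a path on the left by `g`. -/
def headMul (g : A.VG a) : A.Path a b → A.Path a b
  | nil h => nil (g * h)
  | cons h e p => cons (g * h) e p

/-- Concatenation of `𝔸`-paths. -/
def comp : {a b c : V} → A.Path a b → A.Path b c → A.Path a c
  | _, _, _, nil g, q => headMul g q
  | _, _, _, cons g e p, q => cons g e (comp p q)

/-- The path `⟨pₙ⁻¹, eₙ⁻¹, …, e₁⁻¹, p₀⁻¹⟩`. -/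
def inv : {a b : V} → A.Path a b → A.Path b a
  | _, _, nil g => nil g⁻¹
  | _, _, cons g e p => comp (inv p) (cons 1 (Quiver.reverse e) (nil g⁻¹))

/-- Elementary reductions: a subpath `⟨g, e, ω_e(c), e⁻¹, h⟩` is replaced by `⟨g α_e(c) h⟩`. -/
inductive Red : {a b : V} → A.Path a b → A.Path a b → Prop where
  | head {a b d : V} (g : A.VG a) (e : a ⟶ b) (c : A.EG e) (p : A.Path a d) :
      Red (cons g e (cons (A.ω e c) (Quiver.reverse e) p)) (headMul (g * A.α e c) p)
  | tail {a b d : V} (g : A.VG a) (e : a ⟶ b) {p q : A.Path b d} :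
      Red p q → Red (cons g e p) (cons g e q)

/-- The equivalence relation generated by the elementary reductions. -/
def Equiv (p q : A.Path a b) : Prop := Relation.EqvGen Red p q

theorem headMul_headMul (g h : A.VG a) (p : A.Path a b) :
    headMul g (headMul h p) = headMul (g * h) p := by
  cases p <;> simp [headMul, mul_assoc]

theorem headMul_one (p : A.Path a b) : headMul 1 p = p := by
  cases p <;> simp [headMul]

theorem comp_headMul (g : A.VG a) (p : A.Path a b) (q : A.Path b c) :
    comp (headMul g p) q = headMul g (comp p q) := by
  cases p with
  | nil h => exact (headMul_headMul g h q).symm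
  | cons h e p => rfl

theorem comp_assoc (p : A.Path a b) (q : A.Path b c) (r : A.Path c d) :
    comp (comp p q) r = comp p (comp q r) := by
  induction p with
  | nil g => simp [comp, comp_headMul]
  | cons g e p ih => simp [comp, ih]

theorem comp_one (p : A.Path a b) : comp p (nil 1) = p := by
  induction p with
  | nil g => simp [comp, headMul]
  | cons g e p ih => simp [comp, ih]

theorem one_comp (p : A.Path a b) : comp (nil 1) p = p := by
  simp [comp, headMul_one]

theorem Red.headMul (g : A.VG a) {p q : A.Path a b} (h : Red p q) :
    Red (headMul g p) (headMul g q) := by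
  cases h with
  | head g' e c p =>
    rw [headMul_headMul, ← mul_assoc]
    exact Red.head (g * g') e c p
  | tail g' e h => exact Red.tail (g * g') e h

theorem Red.comp_right {p p' : A.Path a b} (h : Red p p') (q : A.Path b c) :
    Red (comp p q) (comp p' q) := by
  induction h with
  | head g e c p =>
    simpa [comp, comp_headMul] using Red.head g e c (comp p q)
  | tail g e _ ih => exact Red.tail g e (ih q)

theorem Red.comp_left (p : A.Path a b) {q q' : A.Path b c} (h : Red q q') :
    Red (comp p q) (comp p q') := by
  induction p with
  | nil g => exact h.headMul g
  | cons g e p ih => exact Red.tail g e (ih h)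

theorem Equiv.refl (p : A.Path a b) : Equiv p p := Relation.EqvGen.refl p

theorem Equiv.symm {p q : A.Path a b} (h : Equiv p q) : Equiv q p := Relation.EqvGen.symm _ _ h

theorem Equiv.trans {p q r : A.Path a b} (h : Equiv p q) (h' : Equiv q r) : Equiv p r :=
  Relation.EqvGen.trans _ _ _ h h'

theorem Equiv.map {a' b' : V} (F : A.Path a b → A.Path a' b')
    (hF : ∀ {p q : A.Path a b}, Red p q → Red (F p) (F q))
    {p q : A.Path a b} (h : Equiv p q) : Equiv (F p) (F q) := by
  induction h with
  | rel p q h => exact Relation.EqvGen.rel _ _ (hF h)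
  | refl p => exact Equiv.refl _
  | symm p q _ ih => exact ih.symm
  | trans p q r _ _ ih ih' => exact ih.trans ih'

theorem Equiv.comp {p p' : A.Path a b} {q q' : A.Path b c} (h : Equiv p p') (h' : Equiv q q') :
    Equiv (comp p q) (comp p' q') :=
  (Equiv.map (fun r => Path.comp r q) (fun hr => hr.comp_right q) h).trans
    (Equiv.map (fun r => Path.comp p' r) (fun hr => hr.comp_left p') h')

theorem comp_inv (p : A.Path a b) : Equiv (comp p (inv p)) (nil 1) := by
  induction p with
  | nil g => simpa [comp, inv, headMul] using Equiv.refl (nil 1)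
  | @cons a b c g e p ih =>
    have h1 : Equiv (comp (comp p (inv p)) (cons 1 (Quiver.reverse e) (nil g⁻¹)))
        (cons 1 (Quiver.reverse e) (nil g⁻¹)) := by
      simpa [comp, headMul] using
        ih.comp (Equiv.refl (cons 1 (Quiver.reverse e) (nil g⁻¹)))
    have h2 := Equiv.map (fun r => cons g e r) (fun hr => Red.tail g e hr) h1
    have h3 : Red (cons g e (cons 1 (Quiver.reverse e) (nil g⁻¹))) (nil 1) := by
      simpa [headMul] using Red.head g e 1 (nil g⁻¹)
    have h4 := h2.trans (Relation.EqvGen.rel _ _ h3)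
    simpa [comp, inv, comp_assoc] using h4

theorem inv_comp (p : A.Path a b) : Equiv (comp (inv p) p) (nil 1) := by
  induction p with
  | nil g => simpa [comp, inv, headMul] using Equiv.refl (nil 1)
  | @cons a b c g e p ih =>
    have h1 : Red (cons 1 (Quiver.reverse e) (cons 1 e p)) p := by
      have := Red.head (A := A) 1 (Quiver.reverse e) 1 p
      rw [Quiver.reverse_reverse] at this
      simpa [headMul_one] using this
    have h2 := Relation.EqvGen.rel _ _ (h1.comp_left (inv p))
    have h3 : comp (inv (cons g e p)) (cons g e p)
        = comp (inv p) (cons 1 (Quiver.reverse e) (cons 1 e p)) := by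
      simp [inv, comp_assoc, comp, headMul]
    rw [h3]
    exact Equiv.trans h2 ih

theorem Equiv.inv {p q : A.Path a b} (h : Equiv p q) : Equiv (inv p) (inv q) := by
  have h1 : Equiv (Path.inv p) (Path.comp (Path.inv p) (Path.comp q (Path.inv q))) := by
    simpa [comp_one] using (Equiv.refl (Path.inv p)).comp (comp_inv q).symm
  have h2 : Equiv (Path.comp (Path.inv p) (Path.comp q (Path.inv q)))
      (Path.comp (Path.inv p) (Path.comp p (Path.inv q))) :=
    (Equiv.refl _).comp (h.symm.comp (Equiv.refl _))
  have h3 : Equiv (Path.comp (Path.inv p) (Path.comp p (Path.inv q))) (Path.inv q) := by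
    rw [← comp_assoc]
    simpa [one_comp] using (inv_comp p).comp (Equiv.refl (Path.inv q))
  exact h1.trans (h2.trans h3)

/-- Equivalence of `𝔸`-loops at `a`. -/
def loopSetoid (A : GraphOfGroups.{u, v, w, x} V) (a : V) : Setoid (A.Path a a) where
  r := Equiv
  iseqv := ⟨Equiv.refl, Equiv.symm, Equiv.trans⟩

end Path

/-- The fundamental group `π₁(𝔸, v₀)`: equivalence classes of `𝔸`-loops at `v₀` under
concatenation. -/
def FundamentalGroup (A : GraphOfGroups.{u, v, w, x} V) (v₀ : V) : Type (max u v w) :=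
  Quotient (Path.loopSetoid A v₀)

instance (A : GraphOfGroups.{u, v, w, x} V) (v₀ : V) : Group (A.FundamentalGroup v₀) where
  mul := Quotient.map₂ Path.comp fun _ _ h _ _ h' => Path.Equiv.comp h h'
  one := Quotient.mk _ (Path.nil 1)
  inv := Quotient.map Path.inv fun _ _ h => Path.Equiv.inv h
  mul_assoc := by
    rintro ⟨p⟩ ⟨q⟩ ⟨r⟩
    exact congrArg (Quotient.mk _) (Path.comp_assoc p q r)
  one_mul := by
    rintro ⟨p⟩
    exact congrArg (Quotient.mk _) (Path.one_comp p)
  mul_one := by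
    rintro ⟨p⟩
    exact congrArg (Quotient.mk _) (Path.comp_one p)
  inv_mul_cancel := by
    rintro ⟨p⟩
    exact Quotient.sound (Path.inv_comp p)

/-- Benign graphs of groups: finite connected graphs of finitely generated groups with the four
conditions below. -/
structure IsBenign (A : GraphOfGroups.{u, v, w, x} V) : Prop where
  finite_vertices : Finite V
  finite_edges : ∀ a b : V, Finite (a ⟶ b)
  connected : ∀ a b : V, Nonempty (Quiver.Path a b)
  vertex_fg : ∀ a : V, Group.FG (A.VG a)
  edge_fg : ∀ {a b : V} (e : a ⟶ b), Group.FG (A.EG e)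
  /-- An algorithm that, given a finite `X ⊆ A_{o(e)}` and `g ∈ A_{o(e)}`, decides whether
  `⟨X⟩ ∩ g α_e(A_e)` is empty and, if it is not, produces an element of it. -/
  coset_intersection : ∀ {a b : V} (e : a ⟶ b) (n : ℕ) (s : Fin n → A.VG a), Generates s →
    ∃ F : List (GroupWord n) × GroupWord n → Option (GroupWord n), Computable F ∧
      ∀ (X : List (GroupWord n)) (g : GroupWord n),
        (F (X, g) = none ↔ ∀ c : A.EG e, GroupWord.eval s g * A.α e c ∉ GroupWord.span s X) ∧
        ∀ y : GroupWord n, F (X, g) = some y →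
          GroupWord.eval s y ∈ GroupWord.span s X ∧
            ∃ c : A.EG e, GroupWord.eval s y = GroupWord.eval s g * A.α e c
  /-- Edge groups are Noetherian. -/
  noetherian : ∀ {a b : V} (e : a ⟶ b) (H : Subgroup (A.EG e)), H.FG
  /-- Edge groups have decidable uniform membership problem. -/
  edge_membership : ∀ {a b : V} (e : a ⟶ b), DecidableMembership (A.EG e)
  /-- An algorithm that, given a finite `X ⊆ A_{o(e)}`, computes a finite generating set of
  `⟨X⟩ ∩ α_e(A_e)`. -/
  intersection_generators : ∀ {a b : V} (e : a ⟶ b) (n : ℕ) (s : Fin n → A.VG a), Generates s →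
    ∃ F : List (GroupWord n) → List (GroupWord n), Computable F ∧
      ∀ X : List (GroupWord n), GroupWord.span s (F X) = GroupWord.span s X ⊓ (A.α e).range

/-! ### `𝔸`-graphs -/

/-- An `𝔸`-graph: a graph `B` with a graph morphism `f ↦ [f]` to the graph of `𝔸`, subgroups
`B_u ≤ A_{[u]}`, and elements `f_α ∈ A_{[o(f)]}`, `f_ω ∈ A_{[t(f)]}`. -/
structure AGraph (A : GraphOfGroups.{u, v, w, x} V) where
  B : Type
  [quiver : Quiver.{0} B]
  [involutiveReverse : Quiver.HasInvolutiveReverse B]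
  reverse_ne : ∀ (a : B) (f : a ⟶ a), Quiver.reverse f ≠ f
  type : B ⥤q V
  type_reverse : ∀ {a b : B} (f : a ⟶ b),
    type.map (Quiver.reverse f) = Quiver.reverse (type.map f)
  grp : ∀ a : B, Subgroup (A.VG (type.obj a))
  fα : ∀ {a b : B}, (a ⟶ b) → A.VG (type.obj a)
  fω : ∀ {a b : B}, (a ⟶ b) → A.VG (type.obj b)
  fα_reverse : ∀ {a b : B} (f : a ⟶ b), fα (Quiver.reverse f) = (fω f)⁻¹

attribute [instance] AGraph.quiver AGraph.involutiveReverse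

namespace AGraph

variable {A : GraphOfGroups.{u, v, w, x} V}

/-- `α_{[f]}⁻¹(f_α⁻¹ B_{o(f)} f_α)`. -/
def edgeGroupα (𝔹 : A.AGraph) {a b : 𝔹.B} (f : a ⟶ b) : Subgroup (A.EG (𝔹.type.map f)) :=
  (conjSubgroup (𝔹.grp a) (𝔹.fα f)).comap (A.α (𝔹.type.map f))

/-- `ω_{[f]}⁻¹(f_ω B_{t(f)} f_ω⁻¹)`. -/
def edgeGroupω (𝔹 : A.AGraph) {a b : 𝔹.B} (f : a ⟶ b) : Subgroup (A.EG (𝔹.type.map f)) :=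
  (conjSubgroup (𝔹.grp b) (𝔹.fω f)⁻¹).comap (A.ω (𝔹.type.map f))

/-- The edge group `B_f ≤ A_{[f]}`. -/
def edgeGroup (𝔹 : A.AGraph) {a b : 𝔹.B} (f : a ⟶ b) : Subgroup (A.EG (𝔹.type.map f)) :=
  𝔹.edgeGroupα f ⊓ 𝔹.edgeGroupω f

/-- Finite `𝔸`-graphs with finitely generated vertex groups, that is, those that can be given to an
algorithm by a finite amount of data. -/
structure IsFinitelyDescribed (𝔹 : A.AGraph) : Prop where
  finite_vertices : Finite 𝔹.B
  finite_edges : ∀ a b : 𝔹.B, Finite (a ⟶ b)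
  grp_fg : ∀ a : 𝔹.B, (𝔹.grp a).FG

/-- Folded `𝔸`-graphs. In the first condition `f₁` and `f₂⁻¹` are distinct edges of the same type
that end at the same vertex `b`. -/
structure IsFolded (𝔹 : A.AGraph) : Prop where
  no_fold : ∀ {a b c : 𝔹.B} (f₁ : a ⟶ b) (f₂ : b ⟶ c),
    Quiver.Star.mk f₂ ≠ Quiver.Star.mk (Quiver.reverse f₁) →
    Quiver.Star.mk (𝔹.type.map f₂) = Quiver.Star.mk (Quiver.reverse (𝔹.type.map f₁)) →
    ∀ g ∈ 𝔹.grp b, ∀ z : A.EG (𝔹.type.map f₁),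
      𝔹.fω f₁ * g * 𝔹.fα f₂ ≠ A.ω (𝔹.type.map f₁) z
  edgeGroup_eq : ∀ {a b : 𝔹.B} (f : a ⟶ b), 𝔹.edgeGroupα f = 𝔹.edgeGroupω f

/-- The power reading conditions for a pair `(𝔸, 𝔹)`. -/
structure PowerReadingConditions (𝔹 : A.AGraph) : Prop where
  membership : ∀ a : V, DecidableMembership (A.VG a)
  powerMembership : ∀ a : V, DecidablePowerMembership (A.VG a)
  /-- For every edge `f`, given `y ∈ A_{[o(f)]}` it is decidable whether
  `y B_{o(f)} ∩ f_α α_{[f]}(A_{[f]}) f_α⁻¹` is empty. -/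
  intersection : ∀ {a b : 𝔹.B} (f : a ⟶ b) (n : ℕ) (s : Fin n → A.VG (𝔹.type.obj a)),
    Generates s → ComputablePred fun y : GroupWord n =>
      ¬ ∃ h ∈ 𝔹.grp a,
        GroupWord.eval s y * h ∈ conjSubgroup (A.α (𝔹.type.map f)).range (𝔹.fα f)⁻¹
  /-- Infinite edge groups have finite index. (Which of them are infinite is a finite table for
  a fixed finite `𝔹`, so that this knowledge is not a condition on the pair.) -/
  finiteIndex : ∀ {a b : 𝔹.B} (f : a ⟶ b),
    Infinite (𝔹.edgeGroup f) → (𝔹.edgeGroup f).FiniteIndex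
  /-- An edge cycle of length `m ≥ 1` consists of vertices `p i` and edges `f i : p i ⟶ p (i + 1)`,
  where the indices are taken modulo `m`. -/
  doubleCoset : ∀ (m : ℕ) [NeZero m] (p : Fin m → 𝔹.B) (f : ∀ i : Fin m, p i ⟶ p (i + 1)),
    (∀ i, Finite (𝔹.edgeGroup (f i))) → ∃ i : Fin m,
      (Quiver.Star.mk (𝔹.type.map (f (i + 1)))
          ≠ Quiver.Star.mk (Quiver.reverse (𝔹.type.map (f i))) →
        DoubleCosetPairProperty
          (conjSubgroup (A.ω (𝔹.type.map (f i))).range (𝔹.fω (f i)))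
          (conjSubgroup (A.α (𝔹.type.map (f (i + 1)))).range (𝔹.fα (f (i + 1)))⁻¹)) ∧
      (Quiver.Star.mk (𝔹.type.map (f (i + 1)))
          = Quiver.Star.mk (Quiver.reverse (𝔹.type.map (f i))) →
        DoubleCosetProperty
          (conjSubgroup (A.ω (𝔹.type.map (f i))).range (𝔹.fω (f i))))

end AGraph

end GraphOfGroups

/-!
# Powers in cosets of subgroups of fundamental groups of graphs of groups

Let `G` be the fundamental group of the graph of groups `A`. The elements `x`, `g` and the
generators of `H` being given, both the predicate "some `g ^ m` with `m ≠ 0` is in `x H`" and its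
complement are recursively enumerable, and Post's theorem gives the algorithm
(`Splitting.computablePred_powerCoset`).

*The ambient splitting.* Everything takes place inside `G`: a `Splitting` consists of the images of
the vertex and edge groups and of the elements of `G` that belong to the edges. By the normal form
theorem (`GraphOfGroups.isFaithful_splitting`), two reduced paths that represent the same element
differ by elements of the edge groups only. The benign graph of groups makes this description
effective (`GraphOfGroups.effective_splitting`). The element `1` is represented only by paths that
can be rewritten to the trivial one, so that equality in `G` is recursively enumerable
(`Splitting.Effective.re_parallel`), and the positive answers can be found by a search through
`m` and through the words in the generators of `H`.

*Folded graphs.* For the negative answers, certificates are needed. The graph of `H` is the quotient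
by `H` of the Bass–Serre tree, with stabilizers as vertex groups. A finite piece of it, in which the
vertex groups are generated by finitely many elements and the stabilizers of the edges, carries the
generators of `H` as loops at `y₀`, and paths from `y₀` to states `y₁` and `y₂` that represent
`x⁻¹ κ` and `κ`. As the subgroups of the edge groups are finitely generated, the piece is a finite
folded graph over `A` with finitely generated vertex groups (`Splitting.exists_frame`). In a folded
graph, reading a path is deterministic, and every reduced representative of an element is readable
as soon as one representative is (`Splitting.Readable.rd`): two successive edges that cancel in a
readable path are inverse to each other also in the folded graph. If `g = κ c κ⁻¹`, then
`g ^ m ∈ x H` if and only if `c ^ m` can be read from `y₁` to `y₂`.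

*Certificates.* Every `g` is conjugate to an element `c` of a vertex group, or to an element `c`
that is represented by a cyclically reduced closed path `l` (`Splitting.IsFaithful.exists_conj`). In
the first case the question is whether a power of `c` is in a coset of the group of a vertex of the
folded graph, and power coset membership in the vertex group of `A` answers it. In the second case,
all powers of `l` are reduced. Reading `l` over and over again either comes to a halt or repeats a
state (`Splitting.Run.exists_same`). Indeed, if an edge with an infinite group is used infinitely
often, then this group has finite index in the edge group of `A`, so that only finitely many states
follow the edge; and if only edges with finite groups are used from some time on, then the run
contains an edge cycle, and the double coset property at a vertex of this cycle leaves only finitely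
many states there. So, if no power of `l` can be read from `y₁` to `y₂`, a finite set of states that
does not contain `y₂` is closed under the reading of `l` (`Splitting.exists_trap`). Such sets for
`g` and for `g⁻¹`, together with the folded graph, are certificates that can be confirmed by an
enumeration (`Splitting.exists_certificate`, `Splitting.HyperbolicCertificate.ne`,
`Splitting.EllipticCertificate.ne`). The conditions on infinite edge groups and on edge cycles are
those of `GraphOfGroups.AGraph.PowerReadingConditions`, applied to the graph over
`A` that the code of the folded graph describes (`GraphOfGroups.tame_of_powerReadingConditions`).
-/

/-! ### Recursively enumerable predicates -/

attribute [fun_prop] Computable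
attribute [fun_prop] Computable.id Computable.const Computable.comp Computable.pair Computable.fst
  Computable.snd

namespace REPred

variable {α β γ : Type*} [Primcodable α] [Primcodable β] [Primcodable γ]

theorem comp {p : β → Prop} (hp : REPred p) {f : α → β} (hf : Computable f) :
    REPred fun a => p (f a) :=
  Partrec.comp (f := fun b => Part.assert (p b) fun _ => Part.some ()) hp hf

/-- A recursively enumerable predicate is a projection of a primitive recursive one. Primitive
recursion is what the closure properties under bounded quantifiers are stated for. -/
theorem exists_primrec {p : α → Prop} (hp : REPred p) :
    ∃ R : α → ℕ → Prop, PrimrecRel R ∧ ∀ a, p a ↔ ∃ n, R a n := by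
  obtain ⟨c, hc⟩ := Nat.Partrec.Code.exists_code.1 hp
  refine ⟨fun a n => Nat.Partrec.Code.evaln n c (Encodable.encode a) ≠ none, ?_, fun a => ?_⟩
  · have h : Primrec fun q : α × ℕ => Nat.Partrec.Code.evaln q.2 c (Encodable.encode q.1) :=
      Nat.Partrec.Code.primrec_evaln.comp
        ((Primrec.snd.pair (Primrec.const c)).pair (Primrec.encode.comp Primrec.fst))
    exact PrimrecPred.not (PrimrecRel.comp Primrec.eq h (Primrec.const none))
  · have h1 : p a ↔ (Nat.Partrec.Code.eval c (Encodable.encode a)).Dom := by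
      rw [hc]
      simp [Part.dom_iff_mem]
    rw [h1, Part.dom_iff_mem]
    constructor
    · rintro ⟨y, hy⟩
      obtain ⟨k, hk⟩ := Nat.Partrec.Code.evaln_complete.1 hy
      exact ⟨k, fun h => by simp [h] at hk⟩
    · rintro ⟨k, hk⟩
      obtain ⟨y, hy⟩ := Option.ne_none_iff_exists'.1 hk
      exact ⟨y, Nat.Partrec.Code.evaln_sound hy⟩

/-- Unbounded search through a computable relation. -/
theorem of_exists_nat {R : α → ℕ → Prop} (hR : PrimrecRel R) : REPred fun a => ∃ n, R a n := by
  classical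
  have h : Partrec fun a => Nat.rfind fun n => Part.some (decide (R a n)) := by
    refine Partrec.rfind ?_
    exact (hR.decide.to_comp).partrec₂
  refine h.dom_re.of_eq fun a => ?_
  refine Nat.rfind_dom'.trans ?_
  simp

theorem of_primrec {p : α → Prop} (hp : PrimrecPred p) : REPred p :=
  hp.computablePred.to_re

theorem ex {p : α → β → Prop} (hp : REPred fun q : α × β => p q.1 q.2) :
    REPred fun a => ∃ b, p a b := by
  obtain ⟨R, hR, h⟩ := hp.exists_primrec
  have h2 : PrimrecRel fun (a : α) (n : ℕ) =>
      ∃ b ∈ (Encodable.decode (α := β) n.unpair.1).toList, R (a, b) n.unpair.2 := by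
    have h3 : PrimrecRel fun (b : β) (q : α × ℕ) => R (q.1, b) q.2 :=
      PrimrecRel.comp hR ((Primrec.fst.comp Primrec.snd).pair Primrec.fst)
        (Primrec.snd.comp Primrec.snd)
    exact PrimrecRel.comp (PrimrecRel.exists_mem_list h3)
      (Primrec.optionToList.comp (Primrec.decode.comp
        (Primrec.fst.comp (Primrec.unpair.comp Primrec.snd))))
      (Primrec.fst.pair (Primrec.snd.comp (Primrec.unpair.comp Primrec.snd)))
  refine (of_exists_nat h2).of_eq fun a => ?_
  constructor
  · rintro ⟨n, b, -, hb⟩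
    exact ⟨b, (h (a, b)).2 ⟨_, hb⟩⟩
  · rintro ⟨b, hb⟩
    obtain ⟨n, hn⟩ := (h (a, b)).1 hb
    exact ⟨Nat.pair (Encodable.encode b) n, b, by simp, by simpa using hn⟩

theorem and {p q : α → Prop} (hp : REPred p) (hq : REPred q) : REPred fun a => p a ∧ q a := by
  obtain ⟨R, hR, h⟩ := hp.exists_primrec
  obtain ⟨S, hS, h'⟩ := hq.exists_primrec
  have h2 : PrimrecRel fun (a : α) (n : ℕ) => R a n.unpair.1 ∧ S a n.unpair.2 :=
    PrimrecPred.and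
      (PrimrecRel.comp hR Primrec.fst (Primrec.fst.comp (Primrec.unpair.comp Primrec.snd)))
      (PrimrecRel.comp hS Primrec.fst (Primrec.snd.comp (Primrec.unpair.comp Primrec.snd)))
  refine (of_exists_nat h2).of_eq fun a => ?_
  rw [h, h']
  constructor
  · rintro ⟨n, h1, h2⟩
    exact ⟨⟨_, h1⟩, ⟨_, h2⟩⟩
  · rintro ⟨⟨n, h1⟩, ⟨m, h2⟩⟩
    exact ⟨Nat.pair n m, by simpa using h1, by simpa using h2⟩

theorem or {p q : α → Prop} (hp : REPred p) (hq : REPred q) : REPred fun a => p a ∨ q a := by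
  obtain ⟨R, hR, h⟩ := hp.exists_primrec
  obtain ⟨S, hS, h'⟩ := hq.exists_primrec
  have h2 : PrimrecRel fun (a : α) (n : ℕ) => R a n ∨ S a n := PrimrecPred.or hR hS
  refine (of_exists_nat h2).of_eq fun a => ?_
  rw [h, h', exists_or]

theorem of_false : REPred fun _ : α => False :=
  of_primrec ((PrimrecPred.of_eq (Primrec.eq.comp (Primrec.const 0) (Primrec.const 1))) (by simp))

theorem eq {f g : α → β} (hf : Computable f) (hg : Computable g) : REPred fun a => f a = g a :=
  (of_primrec (p := fun q : β × β => q.1 = q.2) Primrec.eq).comp (hf.pair hg)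

theorem ne {f g : α → β} (hf : Computable f) (hg : Computable g) : REPred fun a => f a ≠ g a :=
  (of_primrec (p := fun q : β × β => q.1 ≠ q.2) (PrimrecPred.not Primrec.eq)).comp (hf.pair hg)

theorem mem {f : α → β} {l : α → List β} (hf : Computable f) (hl : Computable l) :
    REPred fun a => f a ∈ l a := by
  have h : PrimrecRel fun (l : List β) (b : β) => ∃ a ∈ l, a = b :=
    PrimrecRel.exists_mem_list Primrec.eq
  refine ((of_primrec (p := fun q : List β × β => ∃ a ∈ q.1, a = q.2) h).comp
    (hl.pair hf)).of_eq fun a => ?_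
  simp

theorem forall_mem {p : α → β → Prop} (hp : REPred fun q : α × β => p q.1 q.2)
    {l : α → List β} (hl : Computable l) : REPred fun a => ∀ b ∈ l a, p a b := by
  obtain ⟨R, hR, h⟩ := hp.exists_primrec
  have h1 : PrimrecRel fun (n : ℕ) (q : α × β) => ∃ m < n, R q m :=
    (PrimrecRel.comp (PrimrecRel.exists_mem_list hR.swap) (Primrec.list_range.comp Primrec.fst)
      Primrec.snd).of_eq fun q => by simp
  have h2 : PrimrecRel fun (l : List β) (q : α × ℕ) => ∀ b ∈ l, ∃ m < q.2, R (q.1, b) m :=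
    PrimrecRel.forall_mem_list (PrimrecRel.comp h1 (Primrec.snd.comp Primrec.snd)
      ((Primrec.fst.comp Primrec.snd).pair Primrec.fst))
  have h3 : REPred fun q : α × List β => ∃ n, ∀ b ∈ q.2, ∃ m < n, R (q.1, b) m :=
    of_exists_nat (R := fun (q : α × List β) n => ∀ b ∈ q.2, ∃ m < n, R (q.1, b) m)
      (PrimrecRel.comp h2 (Primrec.snd.comp Primrec.fst)
        ((Primrec.fst.comp Primrec.fst).pair Primrec.snd))
  refine (h3.comp (Computable.id.pair hl)).of_eq fun a => ?_
  constructor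
  · rintro ⟨n, hn⟩ b hb
    obtain ⟨m, -, hm⟩ := hn b hb
    exact (h (a, b)).2 ⟨m, hm⟩
  · intro hall
    have h4 : ∀ l : List β, (∀ b ∈ l, p a b) → ∃ n, ∀ b ∈ l, ∃ m < n, R (a, b) m := by
      intro l
      induction l with
      | nil => intro _; exact ⟨0, by simp⟩
      | cons b l ih =>
        intro hl
        obtain ⟨n, hn⟩ := ih fun b hb => hl b (List.mem_cons_of_mem _ hb)
        obtain ⟨m, hm⟩ := (h (a, b)).1 (hl b List.mem_cons_self)
        refine ⟨max n (m + 1), fun c hc => ?_⟩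
        rcases List.mem_cons.1 hc with rfl | hc
        · exact ⟨m, by omega, hm⟩
        · obtain ⟨k, hk, hk'⟩ := hn c hc
          exact ⟨k, by omega, hk'⟩
    exact h4 _ hall

theorem exists_mem {p : α → β → Prop} (hp : REPred fun q : α × β => p q.1 q.2)
    {l : α → List β} (hl : Computable l) : REPred fun a => ∃ b ∈ l a, p a b :=
  REPred.ex (p := fun a b => b ∈ l a ∧ p a b) ((mem Computable.snd (hl.comp Computable.fst)).and hp)

theorem forall_bool {p : α → Bool → Prop} (hp : REPred fun q : α × Bool => p q.1 q.2) :
    REPred fun a => ∀ b, p a b := by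
  refine (forall_mem hp (Computable.const [true, false])).of_eq fun a => ?_
  simp

/-- A finite family of recursively enumerable predicates is uniformly recursively enumerable. -/
theorem of_finite [Finite β] {p : β → α → Prop} (hp : ∀ b, REPred (p b)) :
    REPred fun q : β × α => p q.1 q.2 := by
  have h : ∀ s : Finset β, REPred fun q : β × α => ∃ b ∈ s, q.1 = b ∧ p b q.2 := by
    intro s
    induction s using Finset.cons_induction with
    | empty => simpa using (REPred.of_false (α := β × α))
    | cons b s hb ih =>
      have h1 : REPred fun q : β × α => q.1 = b ∧ p b q.2 :=
        (eq Computable.fst (Computable.const b)).and ((hp b).comp Computable.snd)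
      exact (h1.or ih).of_eq fun q => by
        simp only [Finset.mem_cons, exists_eq_or_imp]
  cases nonempty_fintype β
  exact (h Finset.univ).of_eq fun q => by simp

/-- The reflexive transitive closure of a recursively enumerable relation is recursively
enumerable: the certificate is the list of the steps. -/
theorem reflTransGen {R : γ → α → α → Prop} (hR : REPred fun q : γ × α × α => R q.1 q.2.1 q.2.2) :
    REPred fun q : γ × α × α => Relation.ReflTransGen (R q.1) q.2.1 q.2.2 := by
  classical
  let run : Option α → List (α × α) → Option α := fun o L =>
    L.foldl (fun o s => if o = some s.1 then some s.2 else none) o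
  have hrun : Primrec fun q : Option α × List (α × α) => run q.1 q.2 := by
    refine Primrec.list_foldl (h := fun (_ : Option α × List (α × α)) (p : Option α × α × α) =>
      if p.1 = some p.2.1 then some p.2.2 else none) Primrec.snd Primrec.fst ?_
    exact Primrec.to₂ <| Primrec.ite (PrimrecRel.comp Primrec.eq (Primrec.fst.comp Primrec.snd)
      (Primrec.option_some.comp (Primrec.fst.comp (Primrec.snd.comp Primrec.snd))))
      (Primrec.option_some.comp (Primrec.snd.comp (Primrec.snd.comp Primrec.snd)))
      (Primrec.const none)
  have hnone : ∀ L, run none L = none := by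
    intro L
    induction L with
    | nil => rfl
    | cons s L ih => simpa [run] using ih
  have key : ∀ (c : γ) (x y : α), Relation.ReflTransGen (R c) x y ↔
      ∃ L : List (α × α), run (some x) L = some y ∧ ∀ s ∈ L, R c s.1 s.2 := by
    intro c x y
    constructor
    · intro h
      induction h using Relation.ReflTransGen.head_induction_on with
      | refl => exact ⟨[], rfl, by simp⟩
      | @head x z hxz _ ih =>
        obtain ⟨L, hL, hL'⟩ := ih
        refine ⟨(x, z) :: L, ?_, ?_⟩
        · simpa [run] using hL
        · rintro s hs
          rcases List.mem_cons.1 hs with rfl | hs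
          · exact hxz
          · exact hL' s hs
    · rintro ⟨L, hL, hL'⟩
      induction L generalizing x with
      | nil => obtain rfl : x = y := by simpa [run] using hL
               exact Relation.ReflTransGen.refl
      | cons s L ih =>
        by_cases hs : x = s.1
        · subst hs
          exact Relation.ReflTransGen.head (hL' s List.mem_cons_self)
            (ih s.2 (by simpa [run] using hL) fun t ht => hL' t (List.mem_cons_of_mem _ ht))
        · have : run (some x) (s :: L) = run none L := by simp [run, hs]
          rw [this, hnone] at hL
          exact absurd hL (by simp)
  have h0 : Computable fun q : (γ × α × α) × List (α × α) => run (some q.1.2.1) q.2 :=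
    hrun.to_comp.comp ((Computable.option_some.comp (by fun_prop)).pair (by fun_prop))
  have h1 : REPred fun q : (γ × α × α) × List (α × α) =>
      run (some q.1.2.1) q.2 = some q.1.2.2 ∧ ∀ s ∈ q.2, R q.1.1 s.1 s.2 :=
    (REPred.eq h0 (Computable.option_some.comp (by fun_prop))).and
      (forall_mem (p := fun (q : (γ × α × α) × List (α × α)) (s : α × α) => R q.1.1 s.1 s.2)
        (hR.comp (f := fun q : ((γ × α × α) × List (α × α)) × α × α => (q.1.1.1, q.2.1, q.2.2))
          (by fun_prop)) Computable.snd)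
  exact (REPred.ex (p := fun (q : γ × α × α) L =>
    run (some q.2.1) L = some q.2.2 ∧ ∀ s ∈ L, R q.1 s.1 s.2) h1).of_eq fun q => (key _ _ _).symm

end REPred

/-! ### Computable operations on words -/

section Words

variable {α β γ : Type*} [Primcodable α] [Primcodable β] [Primcodable γ]

theorem Computable.append {f g : α → List β} (hf : Computable f) (hg : Computable g) :
    Computable fun a => f a ++ g a := Computable.list_append.comp hf hg

theorem Computable.cons {f : α → β} {g : α → List β} (hf : Computable f) (hg : Computable g) :
    Computable fun a => f a :: g a := Computable.list_cons.comp hf hg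

/-- The formal inverse of a word. -/
def GroupWord.inv {n : ℕ} (w : GroupWord n) : GroupWord n := (w.map fun p => (p.1, !p.2)).reverse

theorem GroupWord.primrec_inv {n : ℕ} : Primrec (GroupWord.inv (n := n)) := by
  refine Primrec.list_reverse.comp (Primrec.list_map Primrec.id ?_)
  exact Primrec.to₂ <| (Primrec.fst.comp Primrec.snd).pair
    (Primrec.not.comp (Primrec.snd.comp Primrec.snd))

theorem Computable.wordInv {n : ℕ} {f : α → GroupWord n} (hf : Computable f) :
    Computable fun a => (f a).inv := GroupWord.primrec_inv.to_comp.comp hf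

theorem Computable.ite_bool {c : α → Bool} {f g : α → β} (hc : Computable c) (hf : Computable f)
    (hg : Computable g) : Computable fun a => if c a = true then f a else g a :=
  (Computable.cond hc hf hg).of_eq fun a => by cases c a <;> rfl

attribute [fun_prop] Computable.append Computable.cons Computable.wordInv Computable.ite_bool

variable {G : Type*} [Group G] {n : ℕ} (s : Fin n → G)

@[simp] theorem GroupWord.eval_nil : GroupWord.eval s [] = 1 := rfl

@[simp] theorem GroupWord.eval_append (w w' : GroupWord n) :
    GroupWord.eval s (w ++ w') = GroupWord.eval s w * GroupWord.eval s w' := by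
  simp [GroupWord.eval]

theorem GroupWord.eval_cons (p : Fin n × Bool) (w : GroupWord n) :
    GroupWord.eval s (p :: w) = (if p.2 then s p.1 else (s p.1)⁻¹) * GroupWord.eval s w := by
  simp [GroupWord.eval]

@[simp] theorem GroupWord.eval_inv (w : GroupWord n) :
    GroupWord.eval s w.inv = (GroupWord.eval s w)⁻¹ := by
  induction w with
  | nil => simp [GroupWord.inv]
  | cons p w ih =>
    have : GroupWord.inv (p :: w) = GroupWord.inv w ++ [(p.1, !p.2)] := by simp [GroupWord.inv]
    rw [this, GroupWord.eval_append, ih, GroupWord.eval_cons, GroupWord.eval_cons]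
    cases p.2 <;> simp

theorem GroupWord.eval_comp {G' : Type*} [Group G'] (f : G →* G') (w : GroupWord n) :
    GroupWord.eval (fun i => f (s i)) w = f (GroupWord.eval s w) := by
  induction w with
  | nil => simp
  | cons p w ih =>
    rw [GroupWord.eval_cons, GroupWord.eval_cons, ih]
    cases p.2 <;> simp

theorem GroupWord.span_comp {G' : Type*} [Group G'] (f : G →* G') (X : List (GroupWord n)) :
    GroupWord.span (fun i => f (s i)) X = (GroupWord.span s X).map f := by
  rw [GroupWord.span, GroupWord.span, MonoidHom.map_closure]
  congr 1
  ext g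
  simp [GroupWord.eval_comp]

theorem GroupWord.exists_eval_iff (g : G) :
    (∃ w, GroupWord.eval s w = g) ↔ g ∈ Subgroup.closure (Set.range s) := by
  constructor
  · rintro ⟨w, rfl⟩
    induction w with
    | nil => simp [one_mem]
    | cons p w ih =>
      rw [GroupWord.eval_cons]
      refine mul_mem ?_ ih
      have := Subgroup.subset_closure (Set.mem_range_self (f := s) p.1)
      cases p.2 <;> simpa using this
  · intro h
    induction h using Subgroup.closure_induction with
    | mem x hx =>
      obtain ⟨i, rfl⟩ := hx
      exact ⟨[(i, true)], by simp [GroupWord.eval_cons]⟩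
    | one => exact ⟨[], rfl⟩
    | mul x y _ _ hx hy =>
      obtain ⟨w, rfl⟩ := hx
      obtain ⟨w', rfl⟩ := hy
      exact ⟨w ++ w', by simp⟩
    | inv x _ hx =>
      obtain ⟨w, rfl⟩ := hx
      exact ⟨w.inv, by simp⟩

theorem GroupWord.eval_mem_span {X : List (GroupWord n)} {w : GroupWord n} (h : w ∈ X) :
    GroupWord.eval s w ∈ GroupWord.span s X := Subgroup.subset_closure ⟨w, h, rfl⟩

theorem GroupWord.span_le {X : List (GroupWord n)} {H : Subgroup G} :
    GroupWord.span s X ≤ H ↔ ∀ w ∈ X, GroupWord.eval s w ∈ H := by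
  simp [GroupWord.span, Subgroup.closure_le, Set.subset_def]

end Words

/-! ### Splittings: graphs of groups seen inside their fundamental group -/

/-- A graph of groups seen inside a group `G`: `vert v` and `edge e` are the images of the vertex
group of `v` and of the edge group of `e` (embedded by `α_e`), and `τ e` is the element of `G`
that corresponds to the edge `e`, so that `τ e` conjugates `edge e` to `edge (rev e)`. Each vertex
group comes with a generating `N`-tuple. -/
structure Splitting (V E G : Type*) [Group G] (N : ℕ) where
  src : E → V
  tgt : E → V
  rev : E → E
  rev_rev : ∀ e, rev (rev e) = e
  src_rev : ∀ e, src (rev e) = tgt e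
  rev_ne : ∀ e, rev e ≠ e
  vert : V → Subgroup G
  gen : V → Fin N → G
  closure_gen : ∀ v, Subgroup.closure (Set.range (gen v)) = vert v
  edge : E → Subgroup G
  edge_le : ∀ e, edge e ≤ vert (src e)
  τ : E → G
  τ_rev : ∀ e, τ (rev e) = (τ e)⁻¹
  conj_mem : ∀ e, ∀ z ∈ edge e, (τ e)⁻¹ * z * τ e ∈ edge (rev e)

namespace Splitting

variable {V E G : Type*} [Group G] {N : ℕ} (S : Splitting V E G N)

theorem tgt_rev (e : E) : S.tgt (S.rev e) = S.src e := by
  rw [← S.src_rev, S.rev_rev]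

theorem conj_mem' (e : E) {z : G} (hz : z ∈ S.edge (S.rev e)) :
    S.τ e * z * (S.τ e)⁻¹ ∈ S.edge e := by
  have := S.conj_mem _ z hz
  rwa [S.τ_rev, inv_inv, S.rev_rev] at this

/-- The element of `G` spelled by a word in the generators of the vertex group of `v`. -/
def ev (v : V) (w : GroupWord N) : G := GroupWord.eval (S.gen v) w

@[simp] theorem ev_append (v : V) (w w' : GroupWord N) : S.ev v (w ++ w') = S.ev v w * S.ev v w' :=
  GroupWord.eval_append _ _ _

@[simp] theorem ev_inv (v : V) (w : GroupWord N) : S.ev v w.inv = (S.ev v w)⁻¹ :=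
  GroupWord.eval_inv _ _

@[simp] theorem ev_nil (v : V) : S.ev v [] = 1 := rfl

theorem ev_mem (v : V) (w : GroupWord N) : S.ev v w ∈ S.vert v := by
  rw [← S.closure_gen]
  exact (GroupWord.exists_eval_iff _ _).1 ⟨w, rfl⟩

theorem exists_ev {v : V} {g : G} (hg : g ∈ S.vert v) : ∃ w, S.ev v w = g := by
  rw [← S.closure_gen] at hg
  exact (GroupWord.exists_eval_iff _ _).2 hg

/-- A path `⟨g₀, e₁, g₁, …, eₙ, gₙ⟩` is represented by the pair of `g₀` and the list of the
`(eᵢ, gᵢ)`. This predicate says that such a list is a path from `a` to `b`. -/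
def IsPath : V → List (E × G) → V → Prop
  | a, [], b => a = b
  | a, p :: l, b => S.src p.1 = a ∧ p.2 ∈ S.vert (S.tgt p.1) ∧ IsPath (S.tgt p.1) l b

/-- The element of `G` represented by a list of edges and vertex group elements. -/
def lval (l : List (E × G)) : G := (l.map fun p => S.τ p.1 * p.2).prod

@[simp] theorem lval_nil : S.lval [] = 1 := rfl

@[simp] theorem lval_cons (p : E × G) (l : List (E × G)) :
    S.lval (p :: l) = S.τ p.1 * p.2 * S.lval l := by simp [lval]

@[simp] theorem lval_append (l l' : List (E × G)) : S.lval (l ++ l') = S.lval l * S.lval l' := by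
  simp [lval]

/-- `(e, g)` may be followed by `(e', g')` in a reduced path. -/
def Good (p q : E × G) : Prop := ¬ (q.1 = S.rev p.1 ∧ p.2 ∈ S.edge q.1)

/-- Reduced paths. -/
def Reduced (l : List (E × G)) : Prop := l.IsChain S.Good

/-- Two paths with the same edges that differ by elements of the edge groups. -/
inductive Slide : G → List (E × G) → G → List (E × G) → Prop
  | nil (g : G) : Slide g [] g []
  | cons (g : G) (e : E) {z x x' : G} {l l' : List (E × G)} (hz : z ∈ S.edge e) :
      Slide x l x' l' →
        Slide (g * z) ((e, x) :: l) g ((e, (S.τ e)⁻¹ * z * S.τ e * x') :: l')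

theorem isPath_append {a b : V} {l l' : List (E × G)} :
    S.IsPath a (l ++ l') b ↔ ∃ c, S.IsPath a l c ∧ S.IsPath c l' b := by
  induction l generalizing a with
  | nil => simp [IsPath]
  | cons p l ih => simp [IsPath, ih, and_assoc]

/-- `S` is the splitting of `G` as the fundamental group of the graph of groups: paths between any
two vertices represent all elements of `G`, and reduced paths have a normal form. -/
structure IsFaithful : Prop where
  exists_path : ∀ (a b : V) (g : G), ∃ g₀ ∈ S.vert a, ∃ l, S.IsPath a l b ∧ g₀ * S.lval l = g
  slide : ∀ {a b : V} {g h : G} {l l' : List (E × G)}, g ∈ S.vert a → h ∈ S.vert a →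
    S.IsPath a l b → S.IsPath a l' b → S.Reduced l → S.Reduced l' →
    g * S.lval l = h * S.lval l' → S.Slide g l h l'

end Splitting

/-! ### Folded graphs over a splitting and the reading of paths -/

/-- The data of a finite graph over a splitting, coded by words. A vertex of it is a pair `(v, i)`
of a vertex `v` of the splitting and a number. The first list has an entry `((v, i), w)` for each
generator `w` of the group of the vertex `(v, i)`; the second list has an entry `(i, e, j, p, q)`
for each positive edge, which runs from `(o(e), i)` to `(t(e), j)`, has the type `e` and is labelled
by `p` and `q` at its two ends. -/
abbrev GraphCode (V E : Type*) (N : ℕ) : Type _ :=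
  List ((V × ℕ) × GroupWord N) × List (ℕ × E × ℕ × GroupWord N × GroupWord N)

/-- An edge of a coded graph: a positive edge and its direction. -/
abbrev CodedEdge (E : Type*) (N : ℕ) : Type _ :=
  (ℕ × E × ℕ × GroupWord N × GroupWord N) × Bool

namespace Splitting

variable {V E G : Type*} [Group G] {N : ℕ} (S : Splitting V E G N)

/-- The edge of the splitting below a coded edge. -/
def eE (t : CodedEdge E N) : E := if t.2 = true then t.1.2.1 else S.rev t.1.2.1

/-- The origin of a coded edge. -/
def eO (t : CodedEdge E N) : V × ℕ := (S.src (S.eE t), if t.2 = true then t.1.1 else t.1.2.2.1)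

/-- The terminus of a coded edge. -/
def eT (t : CodedEdge E N) : V × ℕ := (S.tgt (S.eE t), if t.2 = true then t.1.2.2.1 else t.1.1)

/-- The label of a coded edge at its origin, as a word. -/
def eα (t : CodedEdge E N) : GroupWord N :=
  if t.2 = true then t.1.2.2.2.1 else t.1.2.2.2.2.inv

/-- The label of a coded edge at its terminus, as a word. -/
def eω (t : CodedEdge E N) : GroupWord N :=
  if t.2 = true then t.1.2.2.2.2 else t.1.2.2.2.1.inv

/-- The label of a coded edge at its origin. -/
def α (t : CodedEdge E N) : G := S.ev (S.src (S.eE t)) (eα t)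

/-- The label of a coded edge at its terminus. -/
def ω (t : CodedEdge E N) : G := S.ev (S.tgt (S.eE t)) (eω t)

/-- The inverse of a coded edge. -/
def bar (t : CodedEdge E N) : CodedEdge E N := (t.1, !t.2)

theorem bar_bar (t : CodedEdge E N) : bar (bar t) = t := by simp [bar]

theorem eE_bar (t : CodedEdge E N) : S.eE (bar t) = S.rev (S.eE t) := by
  obtain ⟨t, b⟩ := t
  cases b <;> simp [eE, bar, S.rev_rev]

theorem eO_bar (t : CodedEdge E N) : S.eO (bar t) = S.eT t := by
  simp only [eO, eT, eE_bar, S.src_rev]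
  obtain ⟨t, b⟩ := t
  cases b <;> simp [bar]

theorem eT_bar (t : CodedEdge E N) : S.eT (bar t) = S.eO t := by
  rw [← eO_bar, bar_bar]

theorem α_bar (t : CodedEdge E N) : S.α (bar t) = (S.ω t)⁻¹ := by
  simp only [α, ω, eE_bar, S.src_rev, ← ev_inv]
  obtain ⟨t, b⟩ := t
  cases b <;> simp [bar, eα, eω]

theorem ω_bar (t : CodedEdge E N) : S.ω (bar t) = (S.α t)⁻¹ := by
  rw [eq_comm, inv_eq_iff_eq_inv, ← α_bar, bar_bar]

theorem α_mem (t : CodedEdge E N) : S.α t ∈ S.vert (S.eO t).1 := S.ev_mem _ _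

theorem ω_mem (t : CodedEdge E N) : S.ω t ∈ S.vert (S.eT t).1 := S.ev_mem _ _

open Classical in
/-- The words that generate the group of a vertex of a coded graph. -/
noncomputable def gens (D : GraphCode V E N) (u : V × ℕ) : List (GroupWord N) :=
  D.1.filterMap fun p => if p.1 = u then some p.2 else none

theorem mem_gens {D : GraphCode V E N} {u : V × ℕ} {w : GroupWord N} :
    w ∈ gens D u ↔ (u, w) ∈ D.1 := by
  simp only [gens, List.mem_filterMap, Option.ite_none_right_eq_some, Option.some.injEq,
    Prod.exists]
  constructor
  · rintro ⟨a, b, w', h, rfl, rfl⟩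
    exact h
  · intro h
    exact ⟨_, _, _, h, rfl, rfl⟩

/-- The group of a vertex of a coded graph. -/
noncomputable def B (D : GraphCode V E N) (u : V × ℕ) : Subgroup G :=
    GroupWord.span (S.gen u.1) (gens D u)

/-- `a ∈ B α_t z` for an element `z` of the edge group: the edge `t` can be read from the state
with the vertex `o(t)` and the coset `B a`. -/
def Meets (D : GraphCode V E N) (t : CodedEdge E N) (a z : G) : Prop :=
  z ∈ S.edge (S.eE t) ∧ a * z⁻¹ * (S.α t)⁻¹ ∈ S.B D (S.eO t)

/-- Folded coded graphs. -/
structure Folded (D : GraphCode V E N) : Prop where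
  no_fold : ∀ t t' : CodedEdge E N, t.1 ∈ D.2 → t'.1 ∈ D.2 → t ≠ t' → S.eO t = S.eO t' →
    S.eE t = S.eE t' → ∀ z, ¬ S.Meets D t' (S.α t) z
  edge_group : ∀ t : CodedEdge E N, t.1 ∈ D.2 → ∀ z ∈ S.edge (S.eE t),
    S.α t * z * (S.α t)⁻¹ ∈ S.B D (S.eO t) →
      (S.ω t)⁻¹ * ((S.τ (S.eE t))⁻¹ * z * S.τ (S.eE t)) * S.ω t ∈ S.B D (S.eT t)

/-- The state that is reached by reading the edge `t` and then `g`. -/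
def nxt (t : CodedEdge E N) (z g : G) : (V × ℕ) × G :=
  (S.eT t, (S.ω t)⁻¹ * ((S.τ (S.eE t))⁻¹ * z * S.τ (S.eE t)) * g)

/-- Reading a path in a coded graph. A state is a vertex `u` with a coset `B_u a`, which is
represented by the pair `(u, a)`. -/
def Rd (D : GraphCode V E N) : (V × ℕ) × G → List (E × G) → (V × ℕ) × G → Prop
  | y, [], y' => y.1 = y'.1 ∧ y.2 * y'.2⁻¹ ∈ S.B D y.1
  | y, p :: l, y' => ∃ t : CodedEdge E N, t.1 ∈ D.2 ∧ S.eO t = y.1 ∧ S.eE t = p.1 ∧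
      ∃ z, S.Meets D t y.2 z ∧ Rd D (S.nxt t z p.2) l y'

variable {S} {D : GraphCode V E N}

theorem Folded.edge_group_iff (hD : S.Folded D) {t : CodedEdge E N} (ht : t.1 ∈ D.2) {z : G}
    (hz : z ∈ S.edge (S.eE t)) : S.α t * z * (S.α t)⁻¹ ∈ S.B D (S.eO t) ↔
      (S.ω t)⁻¹ * ((S.τ (S.eE t))⁻¹ * z * S.τ (S.eE t)) * S.ω t ∈ S.B D (S.eT t) := by
  refine ⟨hD.edge_group t ht z hz, fun h => ?_⟩
  have := hD.edge_group (bar t) ht ((S.τ (S.eE t))⁻¹ * z * S.τ (S.eE t))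
    (by rw [eE_bar]; exact S.conj_mem _ _ hz) (by rw [α_bar, eO_bar, inv_inv]; exact h)
  rw [eT_bar, eE_bar, ω_bar, S.τ_rev, inv_inv, inv_inv] at this
  convert this using 1
  group

theorem Rd.congr_left {y y' : (V × ℕ) × G} {l : List (E × G)} (h : S.Rd D y l y') {a : G}
    (ha : a * y.2⁻¹ ∈ S.B D y.1) : S.Rd D (y.1, a) l y' := by
  cases l with
  | nil =>
    refine ⟨h.1, ?_⟩
    have := mul_mem ha h.2
    simpa [mul_assoc] using this
  | cons p l =>
    obtain ⟨t, ht, h1, h2, z, ⟨hz, hz'⟩, h3⟩ := h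
    refine ⟨t, ht, h1, h2, z, ⟨hz, ?_⟩, h3⟩
    rw [h1] at hz' ⊢
    have := mul_mem ha hz'
    simpa [mul_assoc] using this

theorem rd_append {y y' : (V × ℕ) × G} {l l' : List (E × G)} :
    S.Rd D y (l ++ l') y' ↔ ∃ y₁, S.Rd D y l y₁ ∧ S.Rd D y₁ l' y' := by
  induction l generalizing y with
  | nil =>
    constructor
    · intro h
      exact ⟨y, ⟨rfl, by simp [one_mem]⟩, h⟩
    · rintro ⟨y₁, ⟨h1, h2⟩, h⟩
      have := h.congr_left (a := y.2) (by rw [← h1]; exact h2)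
      rwa [← h1] at this
  | cons p l ih =>
    constructor
    · rintro ⟨t, ht, h1, h2, z, hz, h3⟩
      obtain ⟨y₁, h4, h5⟩ := ih.1 h3
      exact ⟨y₁, ⟨t, ht, h1, h2, z, hz, h4⟩, h5⟩
    · rintro ⟨y₁, ⟨t, ht, h1, h2, z, hz, h4⟩, h5⟩
      exact ⟨t, ht, h1, h2, z, hz, ih.2 ⟨y₁, h4, h5⟩⟩

/-- Two edges that can be read from the same state are equal, and lead to the same state. -/
theorem Folded.meets_unique (hD : S.Folded D) {t t' : CodedEdge E N} (ht : t.1 ∈ D.2)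
    (ht' : t'.1 ∈ D.2) (hO : S.eO t = S.eO t') (hE : S.eE t = S.eE t') {a z z' : G}
    (h : S.Meets D t a z) (h' : S.Meets D t' a z') : t = t' := by
  by_contra hne
  refine hD.no_fold t t' ht ht' hne hO hE (z' * z⁻¹) ⟨?_, ?_⟩
  · exact mul_mem h'.1 (inv_mem (hE ▸ h.1))
  · have h1 := h.2
    rw [hO] at h1
    have := mul_mem (inv_mem h1) h'.2
    convert this using 1
    group

theorem Folded.nxt_mem (hD : S.Folded D) {t : CodedEdge E N} (ht : t.1 ∈ D.2) {a z z' : G}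
    (h : S.Meets D t a z) (h' : S.Meets D t a z') (g : G) :
    (S.nxt t z g).2 * ((S.nxt t z' g).2)⁻¹ ∈ S.B D (S.eT t) := by
  have h1 : S.α t * (z * z'⁻¹) * (S.α t)⁻¹ ∈ S.B D (S.eO t) := by
    have := mul_mem (inv_mem h.2) h'.2
    convert this using 1
    group
  have := (hD.edge_group_iff ht (mul_mem h.1 (inv_mem h'.1))).1 h1
  convert this using 1
  simp only [nxt]
  group

/-- Reading is deterministic in a folded graph. -/
theorem Folded.rd_unique (hD : S.Folded D) {y y' y'' : (V × ℕ) × G} {l : List (E × G)}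
    (h : S.Rd D y l y') (h' : S.Rd D y l y'') : y'.1 = y''.1 ∧ y'.2 * y''.2⁻¹ ∈ S.B D y'.1 := by
  induction l generalizing y with
  | nil =>
    refine ⟨h.1.symm.trans h'.1, ?_⟩
    rw [← h.1]
    have := mul_mem (inv_mem h.2) h'.2
    simpa [mul_assoc] using this
  | cons p l ih =>
    obtain ⟨t, ht, h1, h2, z, hz, h3⟩ := h
    obtain ⟨t', ht', h1', h2', z', hz', h3'⟩ := h'
    obtain rfl := hD.meets_unique ht ht' (h1.trans h1'.symm) (h2.trans h2'.symm) hz hz'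
    exact ih h3 (h3'.congr_left (hD.nxt_mem ht hz hz' p.2))

theorem Slide.rd {g h : G} {l l' : List (E × G)} (hs : S.Slide g l h l') {u : V × ℕ} {a : G}
    {y : (V × ℕ) × G} (hr : S.Rd D (u, a * g) l y) : S.Rd D (u, a * h) l' y := by
  induction hs generalizing u a with
  | nil => exact hr
  | cons g e hz _ ih =>
    rename_i z x x' l l' _
    obtain ⟨t, ht, h1, h2, z₁, ⟨hz1, hz2⟩, h3⟩ := hr
    dsimp only at h2
    subst h2
    refine ⟨t, ht, h1, rfl, z₁ * z⁻¹, ⟨mul_mem hz1 (inv_mem hz), ?_⟩, ?_⟩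
    · convert hz2 using 1
      simp only
      group
    · have := ih h3
      have h4 : S.nxt t (z₁ * z⁻¹) ((S.τ (S.eE t))⁻¹ * z * S.τ (S.eE t) * x') =
          (S.eT t, (S.ω t)⁻¹ * ((S.τ (S.eE t))⁻¹ * z₁ * S.τ (S.eE t)) * x') :=
        Prod.ext rfl (by simp only [nxt]; group)
      dsimp only
      rwa [h4]

/-- The element `h` is represented by a path that can be read from the state `y` to the state
`y'`. -/
def Readable (S : Splitting V E G N) (D : GraphCode V E N) (y : (V × ℕ) × G) (h : G)
    (y' : (V × ℕ) × G) : Prop :=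
  ∃ g₀ ∈ S.vert y.1.1, ∃ l, S.IsPath y.1.1 l y'.1.1 ∧ S.Rd D (y.1, y.2 * g₀) l y' ∧
    g₀ * S.lval l = h

theorem Readable.refl (y : (V × ℕ) × G) : S.Readable D y 1 y :=
  ⟨1, one_mem _, [], rfl, ⟨rfl, by simp [one_mem]⟩, by simp⟩

theorem Readable.congr_left {y y' : (V × ℕ) × G} {h : G} (hr : S.Readable D y h y') {a : G}
    (ha : a * y.2⁻¹ ∈ S.B D y.1) : S.Readable D (y.1, a) h y' := by
  obtain ⟨g₀, hg, l, hl, hr, h1⟩ := hr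
  refine ⟨g₀, hg, l, hl, ?_, h1⟩
  exact hr.congr_left (a := a * g₀) (by simpa [mul_assoc] using ha)

theorem Readable.mul_left {y y' : (V × ℕ) × G} {h g : G} (hg : g ∈ S.vert y.1.1)
    (hr : S.Readable D (y.1, y.2 * g) h y') : S.Readable D y (g * h) y' := by
  obtain ⟨g₀, hg₀, l, hl, hr, h1⟩ := hr
  exact ⟨g * g₀, mul_mem hg hg₀, l, hl, by simpa [mul_assoc] using hr, by rw [← h1, mul_assoc]⟩

theorem Readable.cons {y y' : (V × ℕ) × G} {t : CodedEdge E N} (ht : t.1 ∈ D.2)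
    (hO : S.eO t = y.1) {z h : G} (hz : S.Meets D t y.2 z)
    (hr : S.Readable D (S.nxt t z 1) h y') : S.Readable D y (S.τ (S.eE t) * h) y' := by
  obtain ⟨g₀, hg₀, l, hl, hr, h1⟩ := hr
  refine ⟨1, one_mem _, (S.eE t, g₀) :: l, ⟨by rw [← hO]; rfl, hg₀, hl⟩, ?_, ?_⟩
  · refine ⟨t, ht, hO, rfl, z, by simpa using hz, ?_⟩
    simpa [nxt] using hr
  · simp [← h1, mul_assoc]

/-- Induction along a readable path. -/
theorem Readable.induction {y' : (V × ℕ) × G} {P : (V × ℕ) × G → G → Prop}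
    (base : ∀ y : (V × ℕ) × G, y.1 = y'.1 → y.2 * y'.2⁻¹ ∈ S.B D y.1 → P y 1)
    (mul : ∀ (y : (V × ℕ) × G) (h g : G), g ∈ S.vert y.1.1 → P (y.1, y.2 * g) h → P y (g * h))
    (cons : ∀ (y : (V × ℕ) × G) (t : CodedEdge E N) (z h : G), t.1 ∈ D.2 → S.eO t = y.1 →
      S.Meets D t y.2 z → P (S.nxt t z 1) h → P y (S.τ (S.eE t) * h))
    {y : (V × ℕ) × G} {h : G} (hr : S.Readable D y h y') : P y h := by
  obtain ⟨g₀, hg₀, l, hl, hr, rfl⟩ := hr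
  refine mul _ _ _ hg₀ ?_
  obtain ⟨u, a⟩ := y
  dsimp only at hg₀ hl hr ⊢
  clear hg₀
  generalize a * g₀ = a' at hr ⊢
  clear g₀ a
  induction l generalizing u a' with
  | nil => exact base _ hr.1 hr.2
  | cons p l ih =>
    obtain ⟨t, ht, hO, hE, z, hz, hr⟩ := hr
    rw [lval_cons, ← hE, mul_assoc]
    refine cons _ t z _ ht hO hz (mul _ _ _ (by simpa [nxt, eT, hE] using hl.2.1) ?_)
    refine ih _ ?_ _ ?_
    · simpa [nxt, eT, hE] using hl.2.2
    · simpa [nxt] using hr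

theorem Readable.trans {y y' y'' : (V × ℕ) × G} {h h' : G} (h1 : S.Readable D y h y')
    (h2 : S.Readable D y' h' y'') : S.Readable D y (h * h') y'' := by
  refine h1.induction (P := fun y h => S.Readable D y (h * h') y'') ?_ ?_ ?_
  · rintro ⟨u, a⟩ h3 h4
    dsimp only at h3 h4
    subst h3
    rw [one_mul]
    exact h2.congr_left h4
  · intro y h g hg hr
    rw [mul_assoc]
    exact hr.mul_left hg
  · intro y t z h ht hO hz hr
    rw [mul_assoc]
    exact hr.cons ht hO hz

theorem Readable.vertex {y : (V × ℕ) × G} {g : G} (hg : g ∈ S.vert y.1.1) {a : G}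
    (ha : y.2 * g * a⁻¹ ∈ S.B D y.1) : S.Readable D y g (y.1, a) :=
  ⟨g, hg, [], rfl, ⟨rfl, ha⟩, by simp⟩

theorem Readable.symm {y y' : (V × ℕ) × G} {h : G} (h1 : S.Readable D y h y') :
    S.Readable D y' h⁻¹ y := by
  refine h1.induction (P := fun y h => S.Readable D y' h⁻¹ y) ?_ ?_ ?_
  · rintro ⟨u, a⟩ h3 h4
    dsimp only at h3 h4
    subst h3
    rw [inv_one]
    refine Readable.vertex (one_mem _) ?_
    have := inv_mem h4
    simpa using this
  · intro y h g hg hr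
    rw [mul_inv_rev]
    refine hr.trans ?_
    have := Readable.vertex (S := S) (D := D) (y := (y.1, y.2 * g)) (g := g⁻¹) (inv_mem hg)
        (a := y.2)
      (by simp [one_mem])
    exact this
  · intro y t z h ht hO hz hr
    rw [mul_inv_rev]
    refine hr.trans ?_
    have hz' : S.Meets D (bar t) (S.nxt t z 1).2 ((S.τ (S.eE t))⁻¹ * z * S.τ (S.eE t)) := by
      refine ⟨by rw [eE_bar]; exact S.conj_mem _ _ hz.1, ?_⟩
      rw [α_bar]
      simp [nxt, mul_assoc, one_mem]
    have h2 : S.Readable D (S.nxt (bar t) ((S.τ (S.eE t))⁻¹ * z * S.τ (S.eE t)) 1) 1 y := by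
      refine ⟨1, one_mem _, [], ?_, ⟨?_, ?_⟩, by simp⟩
      · simp only [nxt, eT_bar, hO]; rfl
      · simp only [nxt, eT_bar, hO]
      · have := inv_mem hz.2
        simp only [nxt, eT_bar, ω_bar, eE_bar, S.τ_rev]
        convert this using 1
        group
    have := h2.cons (y := S.nxt t z 1) (t := bar t) ht (by rw [eO_bar]; rfl) hz'
    simpa [eE_bar, S.τ_rev] using this

/-- In a folded graph, a readable path can be reduced without becoming unreadable: the two edges
that cancel are inverse to each other, because there is nothing to fold. -/
theorem Readable.exists_reduced (hD : S.Folded D) {y y' : (V × ℕ) × G} {h : G}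
    (hr : S.Readable D y h y') : ∃ g₀ ∈ S.vert y.1.1, ∃ l, S.IsPath y.1.1 l y'.1.1 ∧
      S.Rd D (y.1, y.2 * g₀) l y' ∧ g₀ * S.lval l = h ∧ S.Reduced l := by
  refine hr.induction (P := fun y h => ∃ g₀ ∈ S.vert y.1.1, ∃ l, S.IsPath y.1.1 l y'.1.1 ∧
      S.Rd D (y.1, y.2 * g₀) l y' ∧ g₀ * S.lval l = h ∧ S.Reduced l) ?_ ?_ ?_
  · intro y h1 h2
    exact ⟨1, one_mem _, [], by rw [h1]; rfl, ⟨h1, by simpa using h2⟩, by simp, List.isChain_nil⟩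
  · rintro y h g hg ⟨g₀, hg₀, l, hl, hr, rfl, hred⟩
    exact ⟨g * g₀, mul_mem hg hg₀, l, hl, by simpa [mul_assoc] using hr, by rw [mul_assoc], hred⟩
  · rintro y t z h ht hO hz ⟨g₀, hg₀, l, hl, hr, rfl, hred⟩
    have hnocancel : (∀ p ∈ l.head?, S.Good (S.eE t, g₀) p) → ∃ g₁ ∈ S.vert y.1.1, ∃ l',
        S.IsPath y.1.1 l' y'.1.1 ∧ S.Rd D (y.1, y.2 * g₁) l' y' ∧
          g₁ * S.lval l' = S.τ (S.eE t) * (g₀ * S.lval l) ∧ S.Reduced l' := by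
      intro hgood
      refine ⟨1, one_mem _, (S.eE t, g₀) :: l, ⟨by rw [← hO]; rfl, hg₀, hl⟩, ?_, ?_, ?_⟩
      · refine ⟨t, ht, hO, rfl, z, by simpa using hz, ?_⟩
        simpa [nxt] using hr
      · simp [mul_assoc]
      · exact List.isChain_cons.2 ⟨hgood, hred⟩
    cases l with
    | nil => exact hnocancel (by simp)
    | cons p l =>
      by_cases hp : S.Good (S.eE t, g₀) p
      · exact hnocancel (by simpa using hp)
      · obtain ⟨hp1, hp2⟩ := not_not.1 hp
        dsimp only at hp1 hp2
        obtain ⟨t', ht', hO', hE', z', hz', hr'⟩ := hr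
        dsimp only [nxt] at hO' hE'
        obtain ⟨hz1', hz2'⟩ := hz'
        dsimp only [nxt] at hz1' hz2'
        rw [hE'] at hz1'
        have hE2 : S.eE t' = S.rev (S.eE t) := hE'.trans hp1
        have htt : bar t = t' := by
          by_contra hne
          refine hD.no_fold (bar t) t' ht ht' hne (by rw [eO_bar, hO']) (by rw [eE_bar, hE2])
            (z' * g₀⁻¹ * ((S.τ (S.eE t))⁻¹ * z * S.τ (S.eE t))⁻¹) ⟨?_, ?_⟩
          · rw [hE']
            refine mul_mem (mul_mem hz1' (inv_mem hp2)) (inv_mem ?_)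
            rw [hp1]
            exact S.conj_mem _ _ hz.1
          · rw [α_bar]
            convert hz2' using 1
            group
        subst htt
        rw [α_bar, eO_bar] at hz2'
        rw [hp1] at hz1' hp2
        have hC : z * (S.τ (S.eE t) * (g₀ * z'⁻¹) * (S.τ (S.eE t))⁻¹) ∈ S.edge (S.eE t) :=
          mul_mem hz.1 (S.conj_mem' _ (mul_mem hp2 (inv_mem hz1')))
        have hB := (hD.edge_group_iff ht hC).2 (by convert hz2' using 1; group)
        have hy : S.src (S.eE t) = y.1.1 := by rw [← hO]; rfl
        refine ⟨S.τ (S.eE t) * g₀ * (S.τ (S.eE t))⁻¹ * p.2, mul_mem ?_ ?_, l, ?_, ?_, ?_, ?_⟩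
        · rw [← hy]
          exact S.edge_le _ (S.conj_mem' _ hp2)
        · have := hl.2.1
          rwa [hp1, S.tgt_rev, hy] at this
        · have := hl.2.2
          rwa [hp1, S.tgt_rev, hy] at this
        · have hs : S.nxt (bar t) z' p.2 =
              (y.1, S.α t * (S.τ (S.eE t) * z' * (S.τ (S.eE t))⁻¹) * p.2) := by
            simp [nxt, eT_bar, hO, ω_bar, eE_bar, S.τ_rev]
          rw [hs] at hr'
          refine hr'.congr_left ?_
          have := mul_mem hz.2 hB
          rw [hO] at this
          convert this using 1
          group
        · rw [lval_cons, hp1, S.τ_rev]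
          group
        · exact (List.isChain_cons.1 hred).2

/-- In a folded graph, all reduced paths that represent a readable element are readable. -/
theorem Readable.rd (hS : S.IsFaithful) (hD : S.Folded D) {y y' : (V × ℕ) × G} {h g₀ : G}
    {l : List (E × G)} (hr : S.Readable D y h y') (hg₀ : g₀ ∈ S.vert y.1.1)
    (hl : S.IsPath y.1.1 l y'.1.1) (hred : S.Reduced l) (hv : g₀ * S.lval l = h) :
    S.Rd D (y.1, y.2 * g₀) l y' := by
  obtain ⟨g₁, hg₁, l₁, hl₁, hr₁, hv₁, hred₁⟩ := hr.exists_reduced hD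
  exact (hS.slide hg₁ hg₀ hl₁ hl hred₁ hred (hv₁.trans hv.symm)).rd hr₁

end Splitting

/-! ### Cyclically reduced paths -/

/-- The `m`-fold concatenation of a list with itself. -/
def lpow {α : Type*} (l : List α) (m : ℕ) : List α := (List.replicate m l).flatten

@[simp] theorem lpow_zero {α : Type*} (l : List α) : lpow l 0 = [] := rfl

@[simp] theorem lpow_succ {α : Type*} (l : List α) (m : ℕ) : lpow l (m + 1) = l ++ lpow l m := by
  simp [lpow, List.replicate_succ]

theorem lpow_succ' {α : Type*} (l : List α) (m : ℕ) : lpow l (m + 1) = lpow l m ++ l := by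
  simp [lpow, List.replicate_succ']

namespace Splitting

variable {V E G : Type*} [Group G] {N : ℕ} {S : Splitting V E G N} {D : GraphCode V E N}

/-- Cyclically reduced closed paths at `v`. -/
def CycRed (S : Splitting V E G N) (v : V) (l : List (E × G)) : Prop :=
  S.IsPath v l v ∧ S.Reduced (l ++ l)

theorem lval_lpow (l : List (E × G)) (m : ℕ) : S.lval (lpow l m) = S.lval l ^ m := by
  induction m with
  | zero => simp
  | succ m ih => rw [lpow_succ, lval_append, ih, pow_succ']

theorem CycRed.isPath_lpow {v : V} {l : List (E × G)} (h : S.CycRed v l) (m : ℕ) :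
    S.IsPath v (lpow l m) v := by
  induction m with
  | zero => rfl
  | succ m ih => exact lpow_succ l m ▸ (S.isPath_append.2 ⟨v, h.1, ih⟩)

theorem CycRed.reduced_lpow {v : V} {l : List (E × G)} (h : S.CycRed v l) (m : ℕ) :
    S.Reduced (lpow l m) := by
  obtain ⟨h1, -, h3⟩ := List.isChain_append.1 h.2
  induction m with
  | zero => exact List.isChain_nil
  | succ m ih =>
    rw [lpow_succ]
    refine List.isChain_append.2 ⟨h1, ih, ?_⟩
    intro x hx y hy
    refine h3 x hx y ?_
    cases m with
    | zero => simp at hy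
    | succ m =>
      cases l with
      | nil => simp at hx
      | cons p l => simpa using hy

theorem exists_rotate {g κ : G} {v : V} {s t : List (E × G)} (h : S.IsPath v (s ++ t) v)
    (hg : g = κ * S.lval (s ++ t) * κ⁻¹) :
    ∃ v' κ', S.IsPath v' (t ++ s) v' ∧ g = κ' * S.lval (t ++ s) * κ'⁻¹ := by
  obtain ⟨c, h1, h2⟩ := S.isPath_append.1 h
  refine ⟨c, κ * S.lval s, S.isPath_append.2 ⟨v, h2, h1⟩, ?_⟩
  rw [hg, lval_append, lval_append]
  group

/-- Every element is conjugate to an element of a vertex group or to one that is represented by a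
cyclically reduced path: a closed path of minimal length among those that represent conjugates
of the element is of one of the two kinds. -/
theorem IsFaithful.exists_conj (hS : S.IsFaithful) (v₀ : V) (g : G) : ∃ v κ,
    (∃ c ∈ S.vert v, g = κ * c * κ⁻¹) ∨
      ∃ l, l ≠ [] ∧ S.CycRed v l ∧ g = κ * S.lval l * κ⁻¹ := by
  classical
  let P : ℕ → Prop := fun n => ∃ v κ, ∃ g₀ ∈ S.vert v, ∃ l, S.IsPath v l v ∧
    g = κ * (g₀ * S.lval l) * κ⁻¹ ∧ l.length = n
  have hP : ∃ n, P n := by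
    obtain ⟨g₀, hg₀, l, hl, h⟩ := hS.exists_path v₀ v₀ g
    exact ⟨_, v₀, 1, g₀, hg₀, l, hl, by simp [h], rfl⟩
  have hmin : ∀ (v : V) (κ g₀ : G) (l : List (E × G)), g₀ ∈ S.vert v → S.IsPath v l v →
      g = κ * (g₀ * S.lval l) * κ⁻¹ → Nat.find hP ≤ l.length := fun v κ g₀ l h1 h2 h3 =>
    Nat.find_min' hP ⟨v, κ, g₀, h1, l, h2, h3, rfl⟩
  -- A closed path of minimal length does not start with two edges that cancel.
  have hno : ∀ (v : V) (κ : G) (p q : E × G) (b : List (E × G)), S.IsPath v (p :: q :: b) v →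
      g = κ * S.lval (p :: q :: b) * κ⁻¹ → (p :: q :: b).length = Nat.find hP → S.Good p q := by
    rintro v κ ⟨e, x⟩ ⟨e', x'⟩ b ⟨h1, -, h2, h3, h4⟩ hg hlen hbad
    dsimp only at h1 h2 h3 h4 hbad
    obtain ⟨rfl, hx⟩ := hbad
    rw [S.tgt_rev, h1] at h3 h4
    have := hmin v κ (S.τ e * x * (S.τ e)⁻¹ * x') b
      (mul_mem (h1 ▸ S.edge_le _ (S.conj_mem' _ hx)) h3) h4 (by
        rw [hg]
        simp only [lval_cons, S.τ_rev]
        group)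
    simp at hlen
    omega
  obtain ⟨v, κ, g₀, hg₀, l, hl, hg, hlen⟩ := Nat.find_spec hP
  rcases List.eq_nil_or_concat l with rfl | ⟨i, ⟨e, x⟩, rfl⟩
  · exact ⟨v, κ, Or.inl ⟨g₀, hg₀, by simpa using hg⟩⟩
  · refine ⟨v, κ * g₀, Or.inr ⟨i ++ [(e, x * g₀)], by simp, ?_⟩⟩
    rw [List.concat_eq_append] at hl hlen hg
    have hl' : S.IsPath v (i ++ [(e, x * g₀)]) v := by
      obtain ⟨c, h1, h2, h3, h4⟩ := S.isPath_append.1 hl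
      refine S.isPath_append.2 ⟨c, h1, h2, mul_mem h3 ?_, h4⟩
      have h5 : S.tgt e = v := h4
      simpa [h5] using hg₀
    have hg' : g = κ * g₀ * S.lval (i ++ [(e, x * g₀)]) * (κ * g₀)⁻¹ := by
      rw [hg]
      simp only [lval_append, lval_cons, lval_nil]
      group
    have hlen' : (i ++ [(e, x * g₀)]).length = Nat.find hP := by
      rw [← hlen]
      simp
    refine ⟨⟨hl', ?_⟩, hg'⟩
    generalize κ * g₀ = κ' at hg'
    generalize hL : i ++ [(e, x * g₀)] = L at *
    have hchain : S.Reduced L := by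
      refine List.isChain_iff_forall_rel_of_append_cons_cons.2 fun p q a b hab => ?_
      subst hab
      obtain ⟨v', κ'', h1, h2⟩ := exists_rotate hl' hg'
      refine hno v' κ'' p q (b ++ a) h1 h2 ?_
      rw [← hlen']
      simp
      omega
    refine List.isChain_append.2 ⟨hchain, hchain, ?_⟩
    intro p hp q hq
    rw [← hL] at hp hq hlen'
    obtain rfl : (e, x * g₀) = p := by simpa using hp
    cases i with
    | nil =>
      obtain rfl : (e, x * g₀) = q := by simpa using hq
      exact fun h => S.rev_ne e h.1.symm
    | cons q' i =>
      obtain rfl : q' = q := by simpa using hq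
      subst hL
      have h0 : q' :: i ++ [(e, x * g₀)] = (q' :: i) ++ [(e, x * g₀)] := rfl
      obtain ⟨v', κ'', h1, h2⟩ := exists_rotate hl' hg'
      refine hno v' κ'' _ q' i h1 h2 ?_
      rw [← hlen']
      simp

/-! ### Certificates for elements without powers in a coset -/

/-- No edge that continues with the letter `p` starts at the state `y`. -/
def Stuck (S : Splitting V E G N) (D : GraphCode V E N) (y : (V × ℕ) × G) (p : E × G) : Prop :=
  ∀ t : CodedEdge E N, t.1 ∈ D.2 → S.eO t = y.1 → S.eE t = p.1 → ∀ z, ¬ S.Meets D t y.2 z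

/-- The path `l` cannot be read from the state `y`. -/
def Fails (S : Splitting V E G N) (D : GraphCode V E N) (y : (V × ℕ) × G) (l : List (E × G)) :
    Prop :=
  ∃ l₁ p l₂ y', l = l₁ ++ p :: l₂ ∧ S.Rd D y l₁ y' ∧ S.Stuck D y' p

theorem Fails.not_rd (hD : S.Folded D) {y y' : (V × ℕ) × G} {l l' : List (E × G)}
    (h : S.Fails D y l) : ¬ S.Rd D y (l ++ l') y' := by
  obtain ⟨l₁, p, l₂, y₁, rfl, h1, h2⟩ := h
  intro h3
  rw [List.append_assoc] at h3
  obtain ⟨y₂, h4, h5⟩ := rd_append.1 h3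
  obtain ⟨h6, h7⟩ := hD.rd_unique h1 h4
  rw [← Prod.mk.eta (p := y₂), ← h6] at h5
  obtain ⟨t, ht, hO, hE, z, hz, -⟩ := h5.congr_left (a := y₁.2) h7
  exact h2 t ht hO hE z hz

/-- Two pairs of a vertex and a group element that represent the same state. -/
def Same (S : Splitting V E G N) (D : GraphCode V E N) (y y' : (V × ℕ) × G) : Prop :=
  y.1 = y'.1 ∧ y.2 * y'.2⁻¹ ∈ S.B D y.1

theorem rd_nil {y y' : (V × ℕ) × G} : S.Rd D y [] y' ↔ S.Same D y y' := Iff.rfl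

theorem Same.symm {y y' : (V × ℕ) × G} (h : S.Same D y y') : S.Same D y' y :=
  ⟨h.1.symm, by rw [← h.1]; simpa using inv_mem h.2⟩

theorem Same.refl (y : (V × ℕ) × G) : S.Same D y y := ⟨rfl, by simp [one_mem]⟩

theorem Rd.same_left {y y₁ y' : (V × ℕ) × G} {l : List (E × G)} (h : S.Rd D y l y')
    (hy : S.Same D y₁ y) : S.Rd D y₁ l y' := by
  have := h.congr_left (a := y₁.2) (hy.1 ▸ hy.2)
  rwa [← hy.1] at this

theorem Rd.same_right {y y₁ y' : (V × ℕ) × G} {l : List (E × G)} (h : S.Rd D y l y')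
    (hy : S.Same D y' y₁) : S.Rd D y l y₁ := by
  have := rd_append.2 ⟨y', h, rd_nil.2 hy⟩
  rwa [List.append_nil] at this

/-- The list `Q` of states shows that no power of the closed path `l` can be read from `y₁` to
`y₂`: it is closed under the reading of `l`, as long as this is possible, and avoids `y₂`. -/
def Trap (S : Splitting V E G N) (D : GraphCode V E N) (y₁ y₂ : (V × ℕ) × G) (l : List (E × G))
    (Q : List ((V × ℕ) × G)) : Prop :=
  (∀ q ∈ y₁ :: Q, S.Fails D q l ∨ ∃ q' ∈ Q, S.Rd D q l q') ∧ ∀ q ∈ Q, ¬ S.Same D q y₂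

theorem Trap.not_rd (hD : S.Folded D) {y₁ y₂ : (V × ℕ) × G} {l : List (E × G)}
    {Q : List ((V × ℕ) × G)} (hQ : S.Trap D y₁ y₂ l Q) (m : ℕ) :
    ¬ S.Rd D y₁ (lpow l (m + 1)) y₂ := by
  have key : ∀ m, ∀ q ∈ y₁ :: Q, ¬ S.Rd D q (lpow l (m + 1)) y₂ := by
    intro m
    induction m with
    | zero =>
      intro q hq h
      rcases hQ.1 q hq with h1 | ⟨q', hq', h1⟩
      · rw [lpow_succ] at h
        exact h1.not_rd hD h
      · rw [lpow_succ, lpow_zero, List.append_nil] at h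
        exact hQ.2 q' hq' (hD.rd_unique h1 h)
    | succ m ih =>
      intro q hq h
      rw [lpow_succ] at h
      rcases hQ.1 q hq with h1 | ⟨q', hq', h1⟩
      · exact h1.not_rd hD h
      · obtain ⟨y, h2, h3⟩ := rd_append.1 h
        exact ih q' (List.mem_cons_of_mem _ hq') (h3.same_left (hD.rd_unique h1 h2))
  exact key m y₁ List.mem_cons_self

/-- A graph that carries the generators of a subgroup as loops at `y₀`, and paths to states `y₁`
and `y₂` whose labels differ by `x`. -/
structure Frame (S : Splitting V E G N) (D : GraphCode V E N) (X : Set G) (x p₁ p₂ : G)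
    (y₀ y₁ y₂ : (V × ℕ) × G) : Prop where
  folded : S.Folded D
  loops : ∀ h ∈ X, S.Readable D y₀ h y₀
  path₁ : S.Readable D y₀ p₁ y₁
  path₂ : S.Readable D y₀ p₂ y₂
  eq : x * p₁ = p₂
  vertex : y₂.1.1 = y₁.1.1

/-- An equation `g ^ m = x h` with `h ∈ H` closes up to a path from `y₁` to `y₂`: back to `y₀`,
along loops that represent `h`, and on to `y₂`. It represents the power of the conjugate `c`
of `g`. -/
theorem Frame.readable {X : Set G} {x p₁ p₂ g c : G} {y₀ y₁ y₂ : (V × ℕ) × G}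
    (F : S.Frame D X x p₁ p₂ y₀ y₁ y₂) (hg : g * p₂ = p₂ * c) {m : ℤ} {h : G}
    (hh : h ∈ Subgroup.closure X) (hm : g ^ m = x * h) : S.Readable D y₁ (c ^ m) y₂ := by
  have h1 : S.Readable D y₀ h y₀ := by
    clear hm
    induction hh using Subgroup.closure_induction with
    | mem h hh => exact F.loops h hh
    | one => exact Readable.refl _
    | mul a b _ _ ha hb => exact ha.trans hb
    | inv a _ ha => exact ha.symm
  have h2 := F.path₁.symm.trans (h1.trans F.path₂)
  have h3 : g = p₂ * c * p₂⁻¹ := by rw [← hg]; group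
  have h4 : p₁⁻¹ * (h * p₂) = c ^ m := by
    have h5 : h = x⁻¹ * g ^ m := by rw [hm]; group
    have h6 : g ^ m = p₂ * c ^ m * p₂⁻¹ := by rw [h3]; exact conj_zpow
    rw [h5, h6, ← F.eq]
    group
  rwa [h4] at h2

/-- Soundness of the certificates for elements that are conjugate to a cyclically reduced path. -/
theorem Frame.ne_of_trap (hS : S.IsFaithful) {X : Set G} {x p₁ p₂ g : G}
    {y₀ y₁ y₂ : (V × ℕ) × G} (F : S.Frame D X x p₁ p₂ y₀ y₁ y₂) {l : List (E × G)}
    (hg : g * p₂ = p₂ * S.lval l) (hl : S.CycRed y₁.1.1 l) {Q : List ((V × ℕ) × G)}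
    (hQ : S.Trap D y₁ y₂ l Q) {m : ℕ} (hm : m ≠ 0) {h : G} (hh : h ∈ Subgroup.closure X) :
    g ^ m ≠ x * h := by
  intro hgm
  obtain ⟨m, rfl⟩ := Nat.exists_eq_succ_of_ne_zero hm
  have h1 := F.readable hg (m := (m + 1 : ℕ)) hh (by rw [zpow_natCast]; exact hgm)
  have h2 := h1.rd hS F.folded (g₀ := 1) (one_mem _) (F.vertex ▸ hl.isPath_lpow (m + 1))
    (hl.reduced_lpow (m + 1)) (by rw [lval_lpow, one_mul, zpow_natCast])
  rw [mul_one] at h2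
  exact hQ.not_rd F.folded m h2

/-- For an element that is conjugate into a vertex group, an equation `g ^ m = x h` is an equation
between states at a single vertex of the folded graph. -/
theorem Frame.same_of_eq (hS : S.IsFaithful) {X : Set G} {x p₁ p₂ g c : G}
    {y₀ y₁ y₂ : (V × ℕ) × G} (F : S.Frame D X x p₁ p₂ y₀ y₁ y₂) (hc : c ∈ S.vert y₁.1.1)
    (hg : g * p₂ = p₂ * c) {m : ℤ} {h : G} (hh : h ∈ Subgroup.closure X) (hgm : g ^ m = x * h) :
    S.Same D (y₁.1, y₁.2 * c ^ m) y₂ := by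
  have h1 := F.readable hg hh hgm
  exact h1.rd hS F.folded (l := []) (zpow_mem hc m) (by rw [F.vertex]; rfl) List.isChain_nil
    (by simp)

end Splitting

/-! ### Reading a periodic path -/

/-- All but finitely many values of a sequence in a finite type are taken infinitely often. -/
theorem exists_forall_infinite_fiber {α : Type*} [Finite α] (F : ℕ → α) :
    ∃ T, ∀ t, T ≤ t → {s | F s = F t}.Infinite := by
  have h : {t | ¬ {s | F s = F t}.Infinite}.Finite := by
    have h1 : (⋃ a ∈ {a : α | {s | F s = a}.Finite}, {s | F s = a}).Finite :=
      Set.Finite.biUnion (Set.toFinite _) fun a ha => ha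
    refine h1.subset fun t ht => ?_
    simp only [Set.mem_iUnion]
    exact ⟨F t, Set.not_infinite.1 ht, rfl⟩
  obtain ⟨T, hT⟩ := h.bddAbove
  refine ⟨T + 1, fun t ht => ?_⟩
  by_contra hc
  have := hT hc
  omega

/-- The letters of a sequence from time `a` to time `a + d`. -/
def seg {α : Type*} (x : ℕ → α) (a d : ℕ) : List α := (List.range' a d).map x

theorem seg_add {α : Type*} (x : ℕ → α) (a d d' : ℕ) :
    seg x a (d + d') = seg x a d ++ seg x (a + d) d' := by
  simp [seg, ← List.range'_append_1]

theorem seg_succ {α : Type*} (x : ℕ → α) (a d : ℕ) :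
    seg x a (d + 1) = x a :: seg x (a + 1) d := by
  simp [seg, List.range'_succ]

namespace Splitting

variable {V E G : Type*} [Group G] {N : ℕ} {S : Splitting V E G N} {D : GraphCode V E N}

/-- The group of an edge of a coded graph, as a subgroup of the edge group. -/
noncomputable def edgeStab (S : Splitting V E G N) (D : GraphCode V E N) (t : CodedEdge E N) :
    Subgroup G :=
  S.edge (S.eE t) ⊓ (S.B D (S.eO t)).comap (MulAut.conj (S.α t)).toMonoidHom

theorem mem_edgeStab {t : CodedEdge E N} {z : G} : z ∈ S.edgeStab D t ↔
    z ∈ S.edge (S.eE t) ∧ S.α t * z * (S.α t)⁻¹ ∈ S.B D (S.eO t) := by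
  simp [edgeStab, Subgroup.mem_inf, Subgroup.mem_comap]

/-- The conditions on infinite edge groups and on edge cycles with finite edge groups. -/
structure Tame (S : Splitting V E G N) (D : GraphCode V E N) : Prop where
  relIndex : ∀ t : CodedEdge E N, t.1 ∈ D.2 → Infinite (S.edgeStab D t) →
    (S.edgeStab D t).relIndex (S.edge (S.eE t)) ≠ 0
  cycle : ∀ (m : ℕ) [NeZero m] (f : Fin m → CodedEdge E N), (∀ i, (f i).1 ∈ D.2) →
    (∀ i, S.eT (f i) = S.eO (f (i + 1))) → (∀ i, Finite (S.edgeStab D (f i))) →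
    ∃ i, ∀ g ∈ S.vert (S.eT (f i)).1, S.Good (S.eE (f i), g) (S.eE (f (i + 1)), 1) →
      {p : G × G | p.1 ∈ S.edge (S.rev (S.eE (f i))) ∧ p.2 ∈ S.edge (S.eE (f (i + 1))) ∧
        (S.ω (f i))⁻¹ * p.1 * g * p.2 * (S.α (f (i + 1)))⁻¹ ∈ S.B D (S.eT (f i))}.Finite

/-- The sequence `st` of states is obtained by reading the sequence `x` of letters: at time `t`
the edge `f t` and the element `z t` are used. -/
structure Run (S : Splitting V E G N) (D : GraphCode V E N) (x : ℕ → E × G)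
    (st : ℕ → (V × ℕ) × G) (f : ℕ → CodedEdge E N) (z : ℕ → G) : Prop where
  mem : ∀ t, (f t).1 ∈ D.2
  eO : ∀ t, S.eO (f t) = (st t).1
  eE : ∀ t, S.eE (f t) = (x t).1
  meets : ∀ t, S.Meets D (f t) (st t).2 (z t)
  next : ∀ t, st (t + 1) = S.nxt (f t) (z t) (x t).2

/-- Reading a reduced periodic sequence forever leads to the same state at two times that are
congruent modulo the period. If the edge groups that are met infinitely often are not all finite,
one of them has finite index in the ambient edge group, and there are only finitely many states
after its edge. Otherwise, the run closes up to an edge cycle with finite edge groups, and the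
double coset condition at a vertex of the cycle leaves only finitely many states there. -/
theorem Run.exists_same (hD : S.Folded D) (hT : S.Tame D) {x : ℕ → E × G}
    {st : ℕ → (V × ℕ) × G} {f : ℕ → CodedEdge E N} {z : ℕ → G} (R : S.Run D x st f z) {n : ℕ}
    (hn : 0 < n) (hper : ∀ s s', s % n = s' % n → x s = x s')
    (hgood : ∀ t, S.Good (x t) (x (t + 1))) (hvert : ∀ t, (x t).2 ∈ S.vert (S.tgt (x t).1)) :
    ∃ s s', s < s' ∧ s % n = s' % n ∧ S.Same D (st s) (st s') := by
  let A : Type _ := {t : CodedEdge E N // t.1 ∈ D.2}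
  have hA : Finite A := by
    have h1 : ({p | p ∈ D.2} : Set _).Finite := List.finite_toSet D.2
    have h2 : ({t : CodedEdge E N | t.1 ∈ D.2}).Finite :=
      ((h1.prod (Set.finite_univ (α := Bool)))).subset fun t ht => ⟨ht, trivial⟩
    exact h2.to_subtype
  let F : ℕ → Fin n × A × A := fun t =>
    (⟨t % n, Nat.mod_lt _ hn⟩, ⟨f t, R.mem t⟩, ⟨f (t + 1), R.mem (t + 1)⟩)
  have hF : ∀ s s', F s = F s' → s % n = s' % n ∧ f s = f s' ∧ f (s + 1) = f (s' + 1) := by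
    intro s s' h
    exact ⟨congrArg (fun q => q.1.1) h, congrArg (fun q => q.2.1.1) h,
      congrArg (fun q => q.2.2.1) h⟩
  obtain ⟨T, hTinf⟩ := exists_forall_infinite_fiber F
  have hmod : ∀ s s' : ℕ, s % n = s' % n → (s + 1) % n = (s' + 1) % n := by
    intro s s' h
    rw [Nat.add_mod, h, ← Nat.add_mod]
  have hB : ∀ t, (S.B D (S.eO (f (t + 1)))) = S.B D (S.eT (f t)) := by
    intro t
    rw [R.eO (t + 1), R.next t]
    rfl
  by_cases hcase : ∃ t, T ≤ t ∧ Infinite (S.edgeStab D (f t))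
  -- The state after an edge with an infinite group depends only on the coset of `z⁻¹`.
  · obtain ⟨t, ht, hinf⟩ := hcase
    have hrel := hT.relIndex _ (R.mem t) hinf
    have hfin : Finite
        (S.edge (S.eE (f t)) ⧸ (S.edgeStab D (f t)).subgroupOf (S.edge (S.eE (f t)))) :=
      have : ((S.edgeStab D (f t)).subgroupOf (S.edge (S.eE (f t)))).FiniteIndex := ⟨hrel⟩
      inferInstance
    have hz : ∀ s, F s = F t → (z s)⁻¹ ∈ S.edge (S.eE (f t)) := by
      intro s hs
      rw [← (hF s t hs).2.1]
      exact inv_mem (R.meets s).1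
    classical
    let φ : ℕ → S.edge (S.eE (f t)) ⧸ (S.edgeStab D (f t)).subgroupOf (S.edge (S.eE (f t))) :=
      fun s => if h : F s = F t then QuotientGroup.mk ⟨(z s)⁻¹, hz s h⟩ else QuotientGroup.mk 1
    obtain ⟨s, hs, s', hs', hlt, heq⟩ :=
      (hTinf t ht).exists_lt_map_eq_of_mapsTo (f := φ) (t := Set.univ) (fun _ _ => trivial)
        Set.finite_univ
    have hs0 : F s = F t := hs
    have hs0' : F s' = F t := hs'
    refine ⟨s + 1, s' + 1, by omega, hmod _ _ ((hF _ _ hs0).1.trans (hF _ _ hs0').1.symm), ?_⟩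
    simp only [φ, hs0, hs0', dif_pos] at heq
    rw [QuotientGroup.eq, Subgroup.mem_subgroupOf] at heq
    have h1 : z s * (z s')⁻¹ ∈ S.edgeStab D (f t) := by simpa using heq
    obtain ⟨h2, h3⟩ := mem_edgeStab.1 h1
    have h4 := hD.edge_group _ (R.mem t) _ h2 h3
    have hx : x s = x s' := hper _ _ ((hF _ _ hs0).1.trans (hF _ _ hs0').1.symm)
    rw [R.next s, R.next s', (hF _ _ hs0).2.1, (hF _ _ hs0').2.1, hx]
    refine ⟨rfl, ?_⟩
    change _ ∈ S.B D (S.eT (f t))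
    convert h4 using 1
    simp only [nxt]
    group
  -- From time `T` on all edge groups are finite, and the edges until `f T` recurs form a cycle.
  · push Not at hcase
    obtain ⟨T₂, hT₂, hlt⟩ := (hTinf T le_rfl).exists_gt T
    obtain ⟨m, rfl⟩ : ∃ m, T₂ = T + (m + 1) := ⟨T₂ - T - 1, by omega⟩
    have hTf : f (T + (m + 1)) = f T := (hF _ _ hT₂).2.1
    have hsucc : ∀ i : Fin (m + 1), f (T + (i + 1 : Fin (m + 1)).1) = f (T + i.1 + 1) := by
      intro i
      by_cases hi : i.1 = m
      · have h1 : i = Fin.last m := Fin.ext hi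
        subst h1
        simpa [add_assoc] using hTf.symm
      · rw [Fin.val_add_one_of_lt' (by omega)]
        rfl
    obtain ⟨i, hi⟩ := hT.cycle (m + 1) (fun i => f (T + i.1)) (fun i => R.mem _) (by
      intro i
      rw [hsucc, R.eO (T + i.1 + 1), R.next]
      rfl) (fun i => hcase _ (Nat.le_add_right _ _))
    rw [hsucc] at hi
    generalize ht : T + i.1 = t at hi
    have hTt : T ≤ t := by omega
    have hfin := hi (x t).2 (by
      have := hvert t
      rw [← R.eE] at this
      exact this) (by
      have := hgood t
      rw [R.eE, R.eE]
      exact this)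
    obtain ⟨s, hs, s', hs', hlt, heq⟩ :=
      (hTinf t hTt).exists_lt_map_eq_of_mapsTo
        (f := fun s => ((S.τ (S.eE (f t)))⁻¹ * z s * S.τ (S.eE (f t)), (z (s + 1))⁻¹)) (by
          intro s hs
          obtain ⟨h1, h2, h3⟩ := hF s t hs
          refine ⟨?_, ?_, ?_⟩
          · rw [← h2]
            exact S.conj_mem _ _ (R.meets s).1
          · rw [← h3]
            exact inv_mem (R.meets (s + 1)).1
          · have h4 := (R.meets (s + 1)).2
            rw [hB s, R.next s, h2, h3, hper s t h1] at h4
            exact h4) hfin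
    have h1 := hF s t hs
    have h1' := hF s' t hs'
    have hzz : z s = z s' := by
      have := (Prod.ext_iff.1 heq).1
      simpa using this
    refine ⟨s + 1, s' + 1, by omega, hmod _ _ (h1.1.trans h1'.1.symm), ?_⟩
    rw [R.next s, R.next s', h1.2.1, h1'.2.1, hzz, hper s s' (h1.1.trans h1'.1.symm)]
    exact Same.refl _

/-- In a folded graph with the conditions on edge groups and edge cycles, there is a finite reason
why no power of a cyclically reduced path can be read from `y₁` to `y₂`. -/
theorem exists_trap (hD : S.Folded D) (hT : S.Tame D) {y₁ y₂ : (V × ℕ) × G} {l : List (E × G)}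
    (hl0 : l ≠ []) (hl : S.CycRed y₁.1.1 l)
    (hno : ∀ m, ¬ S.Rd D y₁ (lpow l (m + 1)) y₂) : ∃ Q, S.Trap D y₁ y₂ l Q := by
  classical
  have hn : 0 < l.length := List.length_pos_iff.2 hl0
  set n := l.length with hn'
  let x : ℕ → E × G := fun t => l[t % n]'(Nat.mod_lt _ hn)
  have hper : ∀ s s', s % n = s' % n → x s = x s' := by
    intro s s' h
    simp only [x, h]
  have hseg : ∀ k, seg x (k * n) n = l := by
    intro k
    refine List.ext_getElem (by simp [seg, hn']) fun i h1 h2 => ?_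
    simp [seg, x, Nat.mod_eq_of_lt (show i < n from h2)]
  have hvert : ∀ t, (x t).2 ∈ S.vert (S.tgt (x t).1) := by
    intro t
    have h1 : ∀ (a b : V) (l : List (E × G)), S.IsPath a l b →
        ∀ p ∈ l, p.2 ∈ S.vert (S.tgt p.1) := by
      intro a b l h
      induction l generalizing a with
      | nil => simp
      | cons q l ih =>
        intro p hp
        rcases List.mem_cons.1 hp with rfl | hp
        · exact h.2.1
        · exact ih _ h.2.2 p hp
    exact h1 _ _ l hl.1 _ (List.getElem_mem _)
  have hgood : ∀ t, S.Good (x t) (x (t + 1)) := by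
    intro t
    have h1 : l ++ l = seg x (t / n * n) (n + n) := by
      rw [seg_add, hseg]
      have := hseg (t / n + 1)
      rw [add_mul, one_mul] at this
      rw [this]
    have h2 : t / n * n + t % n = t := by rw [mul_comm]; exact Nat.div_add_mod t n
    have h3 : t % n < n := Nat.mod_lt _ hn
    obtain ⟨d, hd⟩ : ∃ d, n + n = t % n + (d + 1 + 1) := ⟨n + n - t % n - 2, by omega⟩
    rw [hd, seg_add, seg_succ, seg_succ, h2] at h1
    exact List.isChain_iff_forall_rel_of_append_cons_cons.1 hl.2 h1
  -- The run: as long as possible, the letters are read one after the other.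
  let C : (V × ℕ) × G → E × G → Prop := fun y p => ∃ q : CodedEdge E N × G, q.1.1 ∈ D.2 ∧
    S.eO q.1 = y.1 ∧ S.eE q.1 = p.1 ∧ S.Meets D q.1 y.2 q.2
  let step : (V × ℕ) × G → E × G → (V × ℕ) × G := fun y p =>
    if h : C y p then S.nxt h.choose.1 h.choose.2 p.2 else y
  let st : ℕ → (V × ℕ) × G := fun t => Nat.rec y₁ (fun t y => step y (x t)) t
  have hst0 : st 0 = y₁ := rfl
  have hst : ∀ t, st (t + 1) = step (st t) (x t) := fun t => rfl
  have hrd : ∀ d a, (∀ t, a ≤ t → t < a + d → C (st t) (x t)) →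
      S.Rd D (st a) (seg x a d) (st (a + d)) := by
    intro d
    induction d with
    | zero => intro a _; exact Same.refl _
    | succ d ih =>
      intro a h
      have h1 := h a le_rfl (by omega)
      have h2 := ih (a + 1) fun t h3 h4 => h t (by omega) (by omega)
      rw [seg_succ]
      refine ⟨h1.choose.1, h1.choose_spec.1, h1.choose_spec.2.1, h1.choose_spec.2.2.1, h1.choose.2,
        h1.choose_spec.2.2.2, ?_⟩
      rw [hst, show a + (d + 1) = a + 1 + d by omega] at *
      simpa only [step, dif_pos h1] using h2
  have hsucc : ∀ k, (k + 1) * n = k * n + n := fun k => by ring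
  have hne : ∀ k, (∀ t, t < (k + 1) * n → C (st t) (x t)) → ¬ S.Same D (st ((k + 1) * n)) y₂ := by
    intro k hC hsame
    have h1 : ∀ k, (∀ t, t < k * n → C (st t) (x t)) → S.Rd D y₁ (lpow l k) (st (k * n)) := by
      intro k
      induction k with
      | zero =>
        intro _
        rw [zero_mul]
        exact Same.refl _
      | succ k ih =>
        intro h
        rw [lpow_succ']
        have h2 := hrd n (k * n) fun t h3 h4 => h t (by rw [hsucc]; exact h4)
        rw [hseg] at h2
        rw [hsucc]
        exact rd_append.2 ⟨_, ih fun t ht => h t (by rw [hsucc]; omega), h2⟩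
    exact hno k ((h1 _ hC).same_right hsame)
  by_cases hall : ∀ t, C (st t) (x t)
  · have R : S.Run D x st (fun t => (hall t).choose.1) (fun t => (hall t).choose.2) := by
      refine ⟨fun t => (hall t).choose_spec.1, fun t => (hall t).choose_spec.2.1,
        fun t => (hall t).choose_spec.2.2.1, fun t => (hall t).choose_spec.2.2.2, fun t => ?_⟩
      rw [hst]
      simp only [step, dif_pos (hall t)]
    obtain ⟨s, s', hlt, hmod, hsame⟩ := R.exists_same hD hT hn hper hgood hvert
    -- The trap consists of the states at multiples of the period; reading on from `s` and `s'`
    -- moves the repetition to the times `s * n` and `j * n`.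
    obtain ⟨j, hj⟩ : ∃ j, s' + (s * n - s) = j * n := by
      have hle : s ≤ s * n := Nat.le_mul_of_pos_right s hn
      have h1 : n ∣ s' - s := (Nat.modEq_iff_dvd' hlt.le).1 hmod
      obtain ⟨q, hq⟩ := h1
      refine ⟨s + q, ?_⟩
      rw [add_mul, mul_comm q, ← hq]
      omega
    have hle : s ≤ s * n := Nat.le_mul_of_pos_right s hn
    have hsj : s < j := by
      have : s * n < j * n := by omega
      exact lt_of_mul_lt_mul_right this (Nat.zero_le n)
    have hsame' : S.Same D (st (s * n)) (st (j * n)) := by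
      have h1 := hrd (s * n - s) s fun t _ _ => hall t
      have h2 := hrd (s * n - s) s' fun t _ _ => hall t
      have h3 : seg x s (s * n - s) = seg x s' (s * n - s) := by
        refine List.ext_getElem (by simp [seg]) fun i h1 h2 => ?_
        simp only [seg, List.getElem_map, List.getElem_range']
        refine hper _ _ ?_
        rw [Nat.add_mod, hmod, ← Nat.add_mod]
      rw [hj, ← h3] at h2
      rw [show s + (s * n - s) = s * n by omega] at h1
      exact hD.rd_unique h1 (h2.same_left hsame)
    refine ⟨(List.range j).map fun k => st ((k + 1) * n), ?_, ?_⟩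
    · intro q hq
      right
      have h1 : ∃ k, k ≤ j ∧ q = st (k * n) := by
        rcases List.mem_cons.1 hq with rfl | hq
        · exact ⟨0, by omega, by simp [hst0]⟩
        · obtain ⟨k, hk, rfl⟩ := List.mem_map.1 hq
          exact ⟨k + 1, by simpa using hk, rfl⟩
      obtain ⟨k, hk, rfl⟩ := h1
      have h2 : ∀ k, S.Rd D (st (k * n)) l (st ((k + 1) * n)) := by
        intro k
        have := hrd n (k * n) fun t _ _ => hall t
        rwa [hseg, ← hsucc] at this
      rcases hk.lt_or_eq with hk | rfl
      · exact ⟨_, List.mem_map.2 ⟨k, by simpa using hk, rfl⟩, h2 k⟩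
      · exact ⟨_, List.mem_map.2 ⟨s, by simpa using hsj, rfl⟩, (h2 s).same_left hsame'.symm⟩
    · intro q hq
      obtain ⟨k, hk, rfl⟩ := List.mem_map.1 hq
      exact hne k fun t _ => hall t
  · push Not at hall
    have hbad := Nat.find_spec hall
    have hok : ∀ t, t < Nat.find hall → C (st t) (x t) := fun t ht =>
        not_not.1 (Nat.find_min hall ht)
    generalize Nat.find hall = T at hbad hok
    have h2 : T / n * n + T % n = T := by rw [mul_comm]; exact Nat.div_add_mod T n
    have h3 : T % n < n := Nat.mod_lt _ hn
    refine ⟨(List.range (T / n)).map fun k => st ((k + 1) * n), ?_, ?_⟩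
    · intro q hq
      have h1 : ∃ k, k ≤ T / n ∧ q = st (k * n) := by
        rcases List.mem_cons.1 hq with rfl | hq
        · exact ⟨0, Nat.zero_le _, by simp [hst0]⟩
        · obtain ⟨k, hk, rfl⟩ := List.mem_map.1 hq
          exact ⟨k + 1, by simpa using hk, rfl⟩
      obtain ⟨k, hk, rfl⟩ := h1
      rcases hk.lt_or_eq with hk | rfl
      · right
        refine ⟨_, List.mem_map.2 ⟨k, by simpa using hk, rfl⟩, ?_⟩
        have h5 : (k + 1) * n ≤ T / n * n := Nat.mul_le_mul_right n hk
        have := hrd n (k * n) fun t _ h4 => hok t (by rw [hsucc] at h5; omega)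
        rwa [hseg, ← hsucc] at this
      · left
        obtain ⟨d, hd⟩ : ∃ d, n = T % n + (d + 1) := ⟨n - T % n - 1, by omega⟩
        have h4 : l = seg x (T / n * n) (T % n) ++ x T :: seg x (T + 1) d := by
          rw [← hseg (T / n)]
          conv_lhs =>
            rw [show seg x (T / n * n) n = seg x (T / n * n) (T % n + (d + 1)) by rw [← hd]]
          rw [seg_add, seg_succ, h2]
        refine ⟨_, _, _, st T, h4, ?_, ?_⟩
        · have := hrd (T % n) (T / n * n) fun t _ h4 => hok t (by rwa [h2] at h4)
          rwa [h2] at this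
        · intro t ht hO hE z hz
          exact hbad ⟨(t, z), ht, hO, hE, hz⟩
    · intro q hq
      obtain ⟨k, hk, rfl⟩ := List.mem_map.1 hq
      have h5 : (k + 1) * n ≤ T / n * n := Nat.mul_le_mul_right n (by simpa using hk)
      exact hne k fun t ht => hok t (by omega)

end Splitting

/-! ### The graph of a finitely generated subgroup -/

section DoubleCosets

variable {G : Type*} [Group G]

/-- A representative of the double coset `H p K`, which depends on the double coset only. -/
noncomputable def dcRep (H K : Subgroup G) (p : G) : G :=
  Quotient.out (s := DoubleCoset.setoid (H : Set G) (K : Set G)) (Quotient.mk _ p)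

theorem dcRep_spec (H K : Subgroup G) (p : G) : ∃ h ∈ H, ∃ k ∈ K, p = h * dcRep H K p * k := by
  have h := Quotient.mk_out (s := DoubleCoset.setoid (H : Set G) (K : Set G)) p
  exact DoubleCoset.rel_iff.1 h

theorem dcRep_eq {H K : Subgroup G} {p q h k : G} (hh : h ∈ H) (hk : k ∈ K) (hq : q = h * p * k) :
    dcRep H K q = dcRep H K p := by
  unfold dcRep
  congr 1
  exact (Quotient.sound (s := DoubleCoset.setoid (H : Set G) (K : Set G))
    (DoubleCoset.rel_iff.2 ⟨h, hh, k, hk, hq⟩)).symm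

/-- An injective numbering of a countable type. -/
noncomputable def numbering (α : Type*) [Countable α] : α → ℕ := (exists_injective_nat α).choose

theorem numbering_injective (α : Type*) [Countable α] : Function.Injective (numbering α) :=
  (exists_injective_nat α).choose_spec

end DoubleCosets

namespace Splitting

variable {V E G : Type*} [Group G] {N : ℕ} (S : Splitting V E G N) (H : Subgroup G)

/-- The edge `H p A_e` of the graph of `H`. -/
noncomputable def ex (e : E) (p : G) : E × G := (e, dcRep H (S.edge e) p)

/-- The inverse of an edge of the graph of `H`. -/
noncomputable def flip (x : E × G) : E × G := S.ex H (S.rev x.1) (x.2 * S.τ x.1)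

variable {S H}

theorem ex_eq {e : E} {p q h k : G} (hh : h ∈ H) (hk : k ∈ S.edge e) (hq : q = h * p * k) :
    S.ex H e q = S.ex H e p := by
  rw [ex, ex, dcRep_eq hh hk hq]

theorem flip_ex (e : E) (p : G) : S.flip H (S.ex H e p) = S.ex H (S.rev e) (p * S.τ e) := by
  obtain ⟨h, hh, k, hk, hp⟩ := dcRep_spec H (S.edge e) p
  simp only [flip]
  refine ex_eq (h := h⁻¹) (inv_mem hh) (S.conj_mem e _ (inv_mem hk)) ?_
  simp only [ex]
  nth_rewrite 2 [hp]
  group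

theorem flip_flip (e : E) (p : G) : S.flip H (S.flip H (S.ex H e p)) = S.ex H e p := by
  rw [flip_ex, flip_ex, S.rev_rev, S.τ_rev, mul_inv_cancel_right]

theorem exists_ex_eq (e : E) (p : G) : S.ex H e (S.ex H e p).2 = S.ex H e p := by
  obtain ⟨h, hh, k, hk, hp⟩ := dcRep_spec H (S.edge e) p
  refine ex_eq (h := h⁻¹) (inv_mem hh) (inv_mem hk) ?_
  simp only [ex]
  nth_rewrite 2 [hp]
  group

variable [Countable G] (S H)

/-- The vertex `H p A_v` of the graph of `H`. -/
noncomputable def vx (v : V) (p : G) : V × ℕ := (v, numbering G (dcRep H (S.vert v) p))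

/-- The element of `G` that a vertex number stands for. -/
noncomputable def vrep (u : V × ℕ) : G := Function.invFun (numbering G) u.2

/-- The state `y` is the point `H p` over the vertex `v`. -/
def IsState (v : V) (p : G) (y : (V × ℕ) × G) : Prop :=
  y.1 = S.vx H v p ∧ y.2 ∈ S.vert v ∧ ∃ h ∈ H, h * p = vrep y.1 * y.2

theorem vrep_vx (v : V) (p : G) : vrep (S.vx H v p) = dcRep H (S.vert v) p :=
  Function.leftInverse_invFun (numbering_injective G) _

variable {S H}

theorem vx_eq {v : V} {p q h k : G} (hh : h ∈ H) (hk : k ∈ S.vert v) (hq : q = h * p * k) :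
    S.vx H v q = S.vx H v p := by
  rw [vx, vx, dcRep_eq hh hk hq]

theorem exists_isState (v : V) (p : G) : ∃ y, S.IsState H v p y := by
  obtain ⟨h, hh, k, hk, hp⟩ := dcRep_spec H (S.vert v) p
  refine ⟨(S.vx H v p, k), rfl, hk, h⁻¹, inv_mem hh, ?_⟩
  rw [vrep_vx]
  nth_rewrite 1 [hp]
  group

/-- The coded edge `t` represents the edge `H p A_e`. -/
structure Represents (S : Splitting V E G N) (H : Subgroup G) (t : CodedEdge E N) (e : E) (p : G) :
    Prop where
  eE : S.eE t = e
  eO : S.eO t = S.vx H (S.src e) p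
  eT : S.eT t = S.vx H (S.tgt e) (p * S.τ e)
  label : ∃ h ∈ H, ∃ z ∈ S.edge e, p = h * (vrep (S.eO t) * S.α t) * z
  link : vrep (S.eO t) * S.α t * S.τ e * S.ω t * (vrep (S.eT t))⁻¹ ∈ H

theorem Represents.bar {t : CodedEdge E N} {e : E} {p : G} (h : S.Represents H t e p) :
    S.Represents H (Splitting.bar t) (S.rev e) (p * S.τ e) where
  eE := by rw [eE_bar, h.eE]
  eO := by rw [eO_bar, h.eT, S.src_rev]
  eT := by rw [eT_bar, h.eO, S.tgt_rev, S.τ_rev, mul_inv_cancel_right]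
  label := by
    obtain ⟨g, hg, z, hz, hp⟩ := h.label
    refine ⟨_, mul_mem hg h.link, _, S.conj_mem e z hz, ?_⟩
    rw [eO_bar, α_bar]
    nth_rewrite 1 [hp]
    group
  link := by
    have := inv_mem h.link
    rw [eO_bar, eT_bar, α_bar, ω_bar, S.τ_rev]
    convert this using 1
    group

/-- The edge of the graph of `H` that a coded edge represents. -/
noncomputable def cls (S : Splitting V E G N) (H : Subgroup G) (t : CodedEdge E N) : E × G :=
  S.ex H (S.eE t) (vrep (S.eO t) * S.α t)

theorem Represents.cls_eq {t : CodedEdge E N} {e : E} {p : G} (h : S.Represents H t e p) :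
    S.cls H t = S.ex H e p := by
  obtain ⟨g, hg, z, hz, hp⟩ := h.label
  rw [cls, h.eE]
  exact (ex_eq hg hz hp).symm

theorem exists_represents (e : E) (p : G) : ∃ f, S.Represents H (f, true) e p := by
  obtain ⟨y, hy1, hy2, h, hh, hy⟩ := exists_isState (S := S) (H := H) (S.src e) p
  obtain ⟨y', hy1', hy2', h', hh', hy'⟩ := exists_isState (S := S) (H := H) (S.tgt e) (p * S.τ e)
  obtain ⟨w, hw⟩ := S.exists_ev hy2
  obtain ⟨w', hw'⟩ := S.exists_ev (inv_mem hy2')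
  have h1 : S.eO ((y.1.2, e, y'.1.2, w, w'), true) = y.1 := by
    simp only [Splitting.eO, Splitting.eE, if_true]
    rw [hy1]
    rfl
  have h2 : S.eT ((y.1.2, e, y'.1.2, w, w'), true) = y'.1 := by
    simp only [Splitting.eT, Splitting.eE, if_true]
    rw [hy1']
    rfl
  have h3 : S.α ((y.1.2, e, y'.1.2, w, w'), true) = y.2 := hw
  have h4 : S.ω ((y.1.2, e, y'.1.2, w, w'), true) = y'.2⁻¹ := hw'
  refine ⟨(y.1.2, e, y'.1.2, w, w'), rfl, h1.trans hy1, h2.trans hy1', ?_, ?_⟩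
  · refine ⟨h⁻¹, inv_mem hh, 1, one_mem _, ?_⟩
    rw [h1, h3, ← hy]
    group
  · rw [h1, h2, h3, h4, ← hy]
    have : h * h'⁻¹ ∈ H := mul_mem hh (inv_mem hh')
    convert this using 1
    rw [mul_assoc _ y'.2⁻¹, ← mul_inv_rev, ← hy']
    group

/-- A positive coded edge for an edge of the graph of `H`. -/
noncomputable def pos (S : Splitting V E G N) (H : Subgroup G) (x : E × G) :
    ℕ × E × ℕ × GroupWord N × GroupWord N :=
  (exists_represents (S := S) (H := H) x.1 x.2).choose

theorem pos_represents (x : E × G) : S.Represents H (S.pos H x, true) x.1 x.2 :=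
  (exists_represents (S := S) (H := H) x.1 x.2).choose_spec

theorem Represents.congr {t : CodedEdge E N} {e : E} {p q : G} (h : S.Represents H t e p)
    (hq : S.ex H e q = S.ex H e p) : S.Represents H t e q := by
  have h0 : dcRep H (S.edge e) q = dcRep H (S.edge e) p := congrArg Prod.snd hq
  obtain ⟨g, hg, z, hz, hp⟩ := dcRep_spec H (S.edge e) p
  obtain ⟨g', hg', z', hz', hp'⟩ := dcRep_spec H (S.edge e) q
  rw [h0] at hp'
  have h1 : q = (g' * g⁻¹) * p * (z⁻¹ * z') := by
    generalize dcRep H (S.edge e) p = d at hp hp'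
    rw [hp', hp]
    group
  have h2 : g' * g⁻¹ ∈ H := mul_mem hg' (inv_mem hg)
  have h3 : z⁻¹ * z' ∈ S.edge e := mul_mem (inv_mem hz) hz'
  refine ⟨h.eE, ?_, ?_, ?_, h.link⟩
  · rw [h.eO, vx_eq h2 (S.edge_le e h3) h1]
  · rw [h.eT, vx_eq (q := q * S.τ e) (p := p * S.τ e) h2
      (k := (S.τ e)⁻¹ * (z⁻¹ * z') * S.τ e) ?_ ?_]
    · rw [← S.src_rev]
      exact S.edge_le _ (S.conj_mem e _ h3)
    · rw [h1]
      group
  · obtain ⟨k, hk, y, hy, hp2⟩ := h.label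
    refine ⟨_, mul_mem h2 hk, _, mul_mem hy h3, ?_⟩
    rw [h1]
    nth_rewrite 1 [hp2]
    group

/-- A coded graph all of whose vertex groups and edges come from the graph of `H`. -/
structure Within (S : Splitting V E G N) (H : Subgroup G) (D : GraphCode V E N) : Prop where
  groups : ∀ u, ∀ b ∈ S.B D u, vrep u * b * (vrep u)⁻¹ ∈ H
  edges : ∀ t : CodedEdge E N, t.1 ∈ D.2 → ∃ e p, S.Represents H t e p

/-- The paths that can be read in a piece of the graph of `H` lift to the tree: a path between two
states represents an element that carries one to the other up to an element of `H`. -/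
theorem Within.readable {D : GraphCode V E N} (hD : S.Within H D) {y y' : (V × ℕ) × G} {h : G}
    (hr : S.Readable D y h y') : vrep y.1 * y.2 * h * (vrep y'.1 * y'.2)⁻¹ ∈ H := by
  refine hr.induction (P := fun y h => vrep y.1 * y.2 * h * (vrep y'.1 * y'.2)⁻¹ ∈ H) ?_ ?_ ?_
  · intro y h1 h2
    have := hD.groups _ _ h2
    rw [← h1]
    convert this using 1
    group
  · intro y h g _ hm
    convert hm using 1
    group
  · intro y t z h ht hO hz hm
    obtain ⟨e, p, hr⟩ := hD.edges t ht
    have h1 := hD.groups _ _ hz.2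
    have h2 := hr.link
    rw [← hr.eE] at h2
    have := mul_mem (mul_mem h1 h2) hm
    rw [hO] at this
    convert this using 1
    simp only [nxt]
    group

/-- The elements of the edge group of a coded edge that come from `H`. -/
noncomputable def stab (S : Splitting V E G N) (H : Subgroup G) (t : CodedEdge E N) : Subgroup G :=
  S.edge (S.eE t) ⊓ H.comap (MulAut.conj (vrep (S.eO t) * S.α t)).toMonoidHom

theorem mem_stab {t : CodedEdge E N} {z : G} : z ∈ S.stab H t ↔ z ∈ S.edge (S.eE t) ∧
    vrep (S.eO t) * S.α t * z * (vrep (S.eO t) * S.α t)⁻¹ ∈ H := by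
  rfl

variable [Countable E]

open Classical in
/-- The coded edge that is used for an edge of the graph of `H`. Of an edge and its inverse, the one
with the smaller number is the positive one. -/
noncomputable def codedEdge (S : Splitting V E G N) (H : Subgroup G) (x : E × G) : CodedEdge E N :=
  if numbering (E × G) x < numbering (E × G) (S.flip H x) then (S.pos H x, true)
  else (S.pos H (S.flip H x), false)

theorem codedEdge_represents (e : E) (p : G) :
    S.Represents H (S.codedEdge H (S.ex H e p)) e p := by
  unfold codedEdge
  split_ifs
  · exact (pos_represents (S.ex H e p)).congr (exists_ex_eq e p).symm
  · have h1 := (pos_represents (S := S) (H := H) (S.flip H (S.ex H e p))).bar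
    have h2 :
        S.ex H e ((S.flip H (S.ex H e p)).2 * S.τ (S.flip H (S.ex H e p)).1) = S.ex H e p := by
      have := flip_flip (S := S) (H := H) e p
      rw [flip] at this
      simpa [flip, ex, S.rev_rev] using this
    have h3 : S.rev (S.flip H (S.ex H e p)).1 = e := S.rev_rev e
    rw [h3] at h1
    exact h1.congr h2.symm

/-- What a coded graph has to contain: the edges `FE` of the graph of `H`, and the elements `FB` in
its vertex groups. -/
structure Covers (S : Splitting V E G N) (H : Subgroup G) (FE : List (E × G))
    (FB : List ((V × ℕ) × G)) (D : GraphCode V E N) : Prop where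
  edges : ∀ x ∈ FE, (S.codedEdge H (S.ex H x.1 x.2)).1 ∈ D.2
  groups : ∀ q ∈ FB, q.2 ∈ S.B D q.1

/-- Elements that may be put into the vertex groups of the graph of `H`. -/
def Valid (S : Splitting V E G N) (H : Subgroup G) (q : (V × ℕ) × G) : Prop :=
  q.2 ∈ S.vert q.1.1 ∧ vrep q.1 * q.2 * (vrep q.1)⁻¹ ∈ H

/-- Reading a path in the graph of `H` takes finitely many edges and finitely many elements of the
vertex groups. -/
theorem exists_covers_rd {v v' : V} {l : List (E × G)} (hl : S.IsPath v l v') {p p' h : G}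
    {y y' : (V × ℕ) × G} (hy : S.IsState H v p y) (hy' : S.IsState H v' p' y') (hh : h ∈ H)
    (hp : p' = h * p * S.lval l) : ∃ FE : List (E × G), ∃ FB : List ((V × ℕ) × G),
      (∀ q ∈ FB, S.Valid H q) ∧ ∀ D : GraphCode V E N, S.Covers H FE FB D → S.Rd D y l y' := by
  induction l generalizing v p y h with
  | nil =>
    obtain rfl : v = v' := hl
    obtain ⟨hy1, hy2, k, hk, hy3⟩ := hy
    obtain ⟨hy1', hy2', k', hk', hy3'⟩ := hy'
    have hu : y.1 = y'.1 := by
      rw [hy1, hy1', vx_eq hh (one_mem (S.vert v)) (q := p') (p := p) (by simpa using hp)]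
    refine ⟨[], [(y.1, y.2 * y'.2⁻¹)], ?_, fun D hD => ⟨hu, hD.groups _ List.mem_cons_self⟩⟩
    intro q hq
    obtain rfl := List.mem_singleton.1 hq
    refine ⟨?_, ?_⟩
    · simp only [hy1, vx]
      exact mul_mem hy2 (inv_mem hy2')
    · have h1 : k * h⁻¹ * k'⁻¹ ∈ H := mul_mem (mul_mem hk (inv_mem hh)) (inv_mem hk')
      convert h1 using 1
      rw [lval_nil, mul_one] at hp
      have h2 : vrep y.1 = k * p * y.2⁻¹ := by rw [hy3]; group
      have h3 : y'.2 = (vrep y.1)⁻¹ * (k' * (h * p)) := by rw [← hp, hy3', hu]; group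
      rw [h3]
      nth_rewrite 1 [h2]
      group
  | cons x l ih =>
    obtain ⟨e, g⟩ := x
    obtain ⟨hsrc, hg, hl⟩ := hl
    dsimp only at hsrc hg hl
    subst hsrc
    have ht := codedEdge_represents (S := S) (H := H) e p
    generalize htt : S.codedEdge H (S.ex H e p) = t at ht
    obtain ⟨hy1, hy2, k, hk, hy3⟩ := hy
    obtain ⟨h₁, hh₁, z, hz, hpz⟩ := ht.label
    have hE := ht.eE
    subst hE
    have hO : S.eO t = y.1 := ht.eO.trans hy1.symm
    have hnext : S.IsState H (S.tgt (S.eE t)) (p * S.τ (S.eE t) * g) (S.nxt t z g) := by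
      refine ⟨?_, ?_, ?_⟩
      · exact ht.eT.trans (vx_eq (one_mem H) hg (by group)).symm
      · refine mul_mem (mul_mem (inv_mem (S.ω_mem t)) ?_) hg
        rw [← S.src_rev]
        exact S.edge_le _ (S.conj_mem _ _ hz)
      · have h2 := inv_mem (mul_mem hh₁ ht.link)
        refine ⟨_, h2, ?_⟩
        nth_rewrite 1 [hpz]
        simp only [nxt]
        group
    obtain ⟨FE, FB, hFB, hrd⟩ := ih hl hnext hh (by rw [hp, lval_cons]; group)
    refine ⟨(S.eE t, p) :: FE, (y.1, y.2 * z⁻¹ * (S.α t)⁻¹) :: FB, ?_, ?_⟩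
    · intro q hq
      rcases List.mem_cons.1 hq with rfl | hq
      · refine ⟨?_, ?_⟩
        · have h1 : y.1.1 = S.src (S.eE t) := by rw [← hO]; rfl
          simp only [h1]
          exact mul_mem (mul_mem hy2 (inv_mem (S.edge_le _ hz))) (inv_mem (S.ev_mem _ _))
        · have h1 : k * h₁ ∈ H := mul_mem hk hh₁
          convert h1 using 1
          have h2 : y.2 = (vrep y.1)⁻¹ * (k * p) := by rw [hy3]; group
          simp only
          rw [h2, ← hO]
          nth_rewrite 1 [hpz]
          group
      · exact hFB q hq
    · intro D hD
      refine ⟨t, ?_, hO, rfl, z, ⟨hz, ?_⟩,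
        hrd D ⟨fun x hx => hD.edges x (List.mem_cons_of_mem _ hx),
        fun q hq => hD.groups q (List.mem_cons_of_mem _ hq)⟩⟩
      · have := hD.edges _ List.mem_cons_self
        rwa [htt] at this
      · have := hD.groups _ List.mem_cons_self
        rwa [hO]

/-- Every finite part of the graph of `H` is contained in a folded coded graph within the graph of
`H`. The edge groups are put into the vertex groups, which therefore satisfy the second condition
for folded graphs without being the full stabilizers. -/
theorem exists_folded (hnoeth : ∀ e, ∀ K ≤ S.edge e, K.FG) (FE : List (E × G))
    (FB : List ((V × ℕ) × G)) (hFB : ∀ q ∈ FB, S.Valid H q) :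
    ∃ D : GraphCode V E N, S.Covers H FE FB D ∧ S.Within H D ∧ S.Folded D ∧ D.2.Nodup := by
  classical
  let num := numbering (E × G)
  let pick : E × G → E × G := fun x => if num (S.ex H x.1 x.2) < num (S.flip H (S.ex H x.1 x.2))
    then S.ex H x.1 x.2 else S.flip H (S.ex H x.1 x.2)
  let L := (FE.map pick).dedup
  -- The positive edges are pairwise neither equal nor inverse to each other.
  have hL : ∀ x ∈ L, S.ex H x.1 x.2 = x ∧ num x < num (S.flip H x) := by
    intro x hx
    obtain ⟨x₀, -, rfl⟩ := List.mem_map.1 (List.mem_dedup.1 hx)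
    simp only [pick]
    split_ifs with hlt
    · exact ⟨exists_ex_eq _ _, hlt⟩
    · rw [flip_flip]
      refine ⟨by rw [flip_ex]; exact exists_ex_eq _ _, ?_⟩
      refine lt_of_le_of_ne (not_lt.1 hlt) fun h => ?_
      have := congrArg Prod.fst (numbering_injective _ h)
      exact S.rev_ne _ this
  have hcls : ∀ x ∈ L, S.cls H (S.pos H x, true) = x ∧ S.cls H (S.pos H x, false) = S.flip H x := by
    intro x hx
    have h1 := pos_represents (S := S) (H := H) x
    refine ⟨h1.cls_eq.trans (hL x hx).1, h1.bar.cls_eq.trans ?_⟩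
    rw [← flip_ex, (hL x hx).1]
  let edges := L.map (S.pos H)
  have hrep : ∀ t : CodedEdge E N, t.1 ∈ edges → ∃ e p, S.Represents H t e p := by
    rintro ⟨f, b⟩ ht
    obtain ⟨x, hx, rfl⟩ := List.mem_map.1 ht
    cases b with
    | true => exact ⟨_, _, pos_represents x⟩
    | false => exact ⟨_, _, (pos_represents x).bar⟩
  have hfg : ∀ t : CodedEdge E N, ∃ s : Finset G, Subgroup.closure (s : Set G) = S.stab H t :=
    fun t => hnoeth _ _ inf_le_left
  choose sg hsg using hfg
  let extra : List ((V × ℕ) × G) := edges.flatMap fun f => [true, false].flatMap fun b =>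
    (sg (f, b)).toList.map fun k => (S.eO (f, b), S.α (f, b) * k * (S.α (f, b))⁻¹)
  have hextra : ∀ q, q ∈ extra ↔ ∃ t : CodedEdge E N, t.1 ∈ edges ∧ ∃ k ∈ sg t,
      q = (S.eO t, S.α t * k * (S.α t)⁻¹) := by
    intro q
    simp only [extra, List.mem_flatMap, List.mem_map, Finset.mem_toList]
    constructor
    · rintro ⟨f, hf, b, -, k, hk, rfl⟩
      exact ⟨(f, b), hf, k, hk, rfl⟩
    · rintro ⟨⟨f, b⟩, hf, k, hk, rfl⟩
      exact ⟨f, hf, b, by cases b <;> simp, k, hk, rfl⟩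
  let all := FB ++ extra
  have hvalid : ∀ q ∈ all, S.Valid H q := by
    intro q hq
    rcases List.mem_append.1 hq with hq | hq
    · exact hFB q hq
    · obtain ⟨t, -, k, hk, rfl⟩ := (hextra q).1 hq
      have hk' : k ∈ S.stab H t := by
        rw [← hsg]
        exact Subgroup.subset_closure hk
      obtain ⟨h1, h2⟩ := mem_stab.1 hk'
      refine ⟨mul_mem (mul_mem (S.α_mem t) (S.edge_le _ h1)) (inv_mem (S.α_mem t)), ?_⟩
      convert h2 using 1
      group
  have hword : ∀ q : (V × ℕ) × G, ∃ w, q.2 ∈ S.vert q.1.1 → S.ev q.1.1 w = q.2 := by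
    intro q
    by_cases hq : q.2 ∈ S.vert q.1.1
    · obtain ⟨w, hw⟩ := S.exists_ev hq
      exact ⟨w, fun _ => hw⟩
    · exact ⟨[], fun h => absurd h hq⟩
  choose word hword using hword
  let D : GraphCode V E N := (all.map fun q => (q.1, word q), edges)
  have hB : ∀ q ∈ all, q.2 ∈ S.B D q.1 := by
    intro q hq
    rw [← hword q (hvalid q hq).1]
    exact GroupWord.eval_mem_span _ (mem_gens.2 (List.mem_map.2 ⟨q, hq, rfl⟩))
  have hBle : ∀ u, ∀ b ∈ S.B D u, vrep u * b * (vrep u)⁻¹ ∈ H := by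
    intro u
    have h1 : S.B D u ≤ H.comap (MulAut.conj (vrep u)).toMonoidHom := by
      refine (GroupWord.span_le _).2 fun w hw => ?_
      obtain ⟨q, hq, hqw⟩ := List.mem_map.1 (mem_gens.1 hw)
      obtain ⟨rfl, rfl⟩ := Prod.mk.inj hqw
      have h2 : GroupWord.eval (S.gen q.1.1) (word q) = q.2 := hword q (hvalid q hq).1
      rw [h2]
      simpa using (hvalid q hq).2
    intro b hb
    simpa using h1 hb
  have hstab : ∀ t : CodedEdge E N, t.1 ∈ edges → ∀ z ∈ S.stab H t,
      S.α t * z * (S.α t)⁻¹ ∈ S.B D (S.eO t) := by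
    intro t ht
    have h1 : S.stab H t ≤ (S.B D (S.eO t)).comap (MulAut.conj (S.α t)).toMonoidHom := by
      rw [← hsg, Subgroup.closure_le]
      intro k hk
      have := hB (S.eO t, S.α t * k * (S.α t)⁻¹)
        (List.mem_append_right _ ((hextra _).2 ⟨t, ht, k, hk, rfl⟩))
      simpa using this
    intro z hz
    simpa using h1 hz
  refine ⟨D, ⟨?_, fun q hq => hB q (List.mem_append_left _ hq)⟩, ⟨hBle, hrep⟩, ⟨?_, ?_⟩, ?_⟩
  · intro x hx
    have h1 : pick x ∈ L := List.mem_dedup.2 (List.mem_map_of_mem hx)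
    refine List.mem_map.2 ⟨pick x, h1, ?_⟩
    simp only [pick, codedEdge, num]
    split_ifs <;> rfl
  · intro t t' ht ht' hne hO hE z hz
    have hc : S.cls H t = S.cls H t' := by
      have h1 := hBle _ _ hz.2
      rw [cls, cls, hE, hO]
      refine ex_eq h1 hz.1 ?_
      group
    obtain ⟨f, b⟩ := t
    obtain ⟨f', b'⟩ := t'
    obtain ⟨x, hx, rfl⟩ := List.mem_map.1 ht
    obtain ⟨x', hx', rfl⟩ := List.mem_map.1 ht'
    have h1 := hcls x hx
    have h2 := hcls x' hx'
    have hff : ∀ x ∈ L, S.flip H (S.flip H x) = x := by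
      intro x hx
      rw [← (hL x hx).1]
      exact flip_flip _ _
    have h3 := (hL x hx).2
    have h4 := (hL x' hx').2
    cases b <;> cases b'
    · rw [h1.2, h2.2] at hc
      have := congrArg (S.flip H) hc
      rw [hff x hx, hff x' hx'] at this
      exact hne (by rw [this])
    · rw [h1.2, h2.1] at hc
      rw [← hc, hff x hx, hc] at h4
      rw [hc] at h3
      omega
    · rw [h1.1, h2.2] at hc
      rw [hc, hff x' hx', ← hc] at h3
      rw [← hc] at h4
      omega
    · rw [h1.1, h2.1] at hc
      exact hne (by rw [hc])
  · intro t ht z hz hzB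
    have h1 : vrep (S.eO t) * S.α t * z * (vrep (S.eO t) * S.α t)⁻¹ ∈ H := by
      have := hBle _ _ hzB
      convert this using 1
      group
    obtain ⟨e, p, hr⟩ := hrep t ht
    have hlink := hr.link
    rw [← hr.eE] at hlink
    have h2 : (S.τ (S.eE t))⁻¹ * z * S.τ (S.eE t) ∈ S.stab H (bar t) := by
      refine mem_stab.2 ⟨by rw [eE_bar]; exact S.conj_mem _ _ hz, ?_⟩
      rw [eO_bar, α_bar]
      have := mul_mem (mul_mem (inv_mem hlink) h1) hlink
      convert this using 1
      group
    have h3 := hstab (bar t) ht _ h2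
    rw [α_bar, eO_bar, inv_inv] at h3
    exact h3
  · refine List.Nodup.map_on ?_ (List.nodup_dedup _)
    intro x hx x' hx' h
    rw [← (hcls x hx).1, h, (hcls x' hx').1]

/-- For a finite set `X ⊆ H` and elements `p₁`, `p₂`, some folded coded graph within the graph of
`H` carries the elements of `X` as loops, and `p₁` and `p₂` as paths. -/
theorem exists_frame (hS : S.IsFaithful) (hnoeth : ∀ e, ∀ K ≤ S.edge e, K.FG) (X : List G)
    (hX : ∀ x ∈ X, x ∈ H) (v₀ v : V) (x p₁ p₂ : G) (hx : x * p₁ = p₂) :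
    ∃ (D : GraphCode V E N) (y₀ y₁ y₂ : (V × ℕ) × G),
      S.Frame D {h | h ∈ X} x p₁ p₂ y₀ y₁ y₂ ∧ D.2.Nodup ∧ y₀.1.1 = v₀ ∧ y₁.1.1 = v ∧
      y₀.2 ∈ S.vert y₀.1.1 ∧ y₁.2 ∈ S.vert y₁.1.1 ∧ y₂.2 ∈ S.vert y₂.1.1 ∧
      ∀ h, S.Readable D y₁ h y₂ → p₁ * h * p₂⁻¹ ∈ H := by
  obtain ⟨y₀, hy₀⟩ := exists_isState (S := S) (H := H) v₀ 1
  obtain ⟨y₁, hy₁⟩ := exists_isState (S := S) (H := H) v p₁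
  obtain ⟨y₂, hy₂⟩ := exists_isState (S := S) (H := H) v p₂
  have key : ∀ (v' : V) (p p' h : G) (y' : (V × ℕ) × G), S.IsState H v' p' y' → h ∈ H →
      p' = h * p → ∃ FE : List (E × G), ∃ FB : List ((V × ℕ) × G), (∀ q ∈ FB, S.Valid H q) ∧
        ∀ D : GraphCode V E N, S.Covers H FE FB D → S.Readable D y₀ p y' := by
    intro v' p p' h y' hy' hh hp
    obtain ⟨g₀, hg₀, l, hl, rfl⟩ := hS.exists_path v₀ v' p
    obtain ⟨h1, h2, k, hk, h3⟩ := hy₀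
    have hst : S.IsState H v₀ g₀ (y₀.1, y₀.2 * g₀) := by
      refine ⟨h1.trans (vx_eq (one_mem H) hg₀ (by group)).symm, mul_mem h2 hg₀, k, hk, ?_⟩
      dsimp only
      rw [← mul_assoc, ← h3, mul_one]
    obtain ⟨FE, FB, hFB, hrd⟩ := exists_covers_rd hl hst hy' hh (by rw [hp, mul_assoc])
    refine ⟨FE, FB, hFB, fun D hD => ⟨g₀, ?_, l, ?_, hrd D hD, rfl⟩⟩
    · rw [h1]; exact hg₀
    · rw [h1, hy'.1]; exact hl
  have hcov : ∀ {FE FE' : List (E × G)} {FB FB' : List ((V × ℕ) × G)} {D : GraphCode V E N},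
      S.Covers H (FE ++ FE') (FB ++ FB') D → S.Covers H FE FB D ∧ S.Covers H FE' FB' D :=
    fun h => ⟨⟨fun x hx => h.edges x (List.mem_append_left _ hx),
      fun q hq => h.groups q (List.mem_append_left _ hq)⟩,
      ⟨fun x hx => h.edges x (List.mem_append_right _ hx),
      fun q hq => h.groups q (List.mem_append_right _ hq)⟩⟩
  have hloops : ∃ FE : List (E × G), ∃ FB : List ((V × ℕ) × G), (∀ q ∈ FB, S.Valid H q) ∧
      ∀ D : GraphCode V E N, S.Covers H FE FB D → ∀ h ∈ X, S.Readable D y₀ h y₀ := by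
    clear hx
    induction X with
    | nil => exact ⟨[], [], by simp, by simp⟩
    | cons a X ih =>
      obtain ⟨FE, FB, h1, h2⟩ := ih fun x hx => hX x (List.mem_cons_of_mem _ hx)
      obtain ⟨FE', FB', h1', h2'⟩ := key v₀ a 1 a⁻¹ y₀ hy₀ (inv_mem (hX a List.mem_cons_self))
        (by group)
      refine ⟨FE' ++ FE, FB' ++ FB, fun q hq => (List.mem_append.1 hq).elim (h1' q) (h1 q), ?_⟩
      intro D hD h hh
      obtain ⟨c1, c2⟩ := hcov hD
      rcases List.mem_cons.1 hh with rfl | hh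
      · exact h2' D c1
      · exact h2 D c2 h hh
  obtain ⟨FE, FB, h1, h2⟩ := hloops
  obtain ⟨FE₁, FB₁, h1₁, h2₁⟩ := key v p₁ p₁ 1 y₁ hy₁ (one_mem H) (by group)
  obtain ⟨FE₂, FB₂, h1₂, h2₂⟩ := key v p₂ p₂ 1 y₂ hy₂ (one_mem H) (by group)
  obtain ⟨D, hD, hW, hF, hN⟩ := exists_folded (S := S) (H := H) hnoeth (FE ++ (FE₁ ++ FE₂))
    (FB ++ (FB₁ ++ FB₂)) (fun q hq => (List.mem_append.1 hq).elim (h1 q) fun hq =>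
      (List.mem_append.1 hq).elim (h1₁ q) (h1₂ q))
  obtain ⟨c0, c⟩ := hcov hD
  obtain ⟨c1, c2⟩ := hcov c
  have hv₁ : y₁.1.1 = v := by rw [hy₁.1]; rfl
  have hv₂ : y₂.1.1 = v := by rw [hy₂.1]; rfl
  have hv₀ : y₀.1.1 = v₀ := by rw [hy₀.1]; rfl
  refine ⟨D, y₀, y₁, y₂, ⟨hF, h2 D c0, h2₁ D c1, h2₂ D c2, hx, hv₂.trans hv₁.symm⟩, hN, hv₀, hv₁,
    by rw [hv₀]; exact hy₀.2.1, by rw [hv₁]; exact hy₁.2.1, by rw [hv₂]; exact hy₂.2.1, ?_⟩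
  intro h hr
  obtain ⟨-, -, k₁, hk₁, e₁⟩ := hy₁
  obtain ⟨-, -, k₂, hk₂, e₂⟩ := hy₂
  have := mul_mem (mul_mem (inv_mem hk₁) (hW.readable hr)) hk₂
  rw [← e₁, ← e₂] at this
  convert this using 1
  group

end Splitting

/-! ### Normal forms of paths in a graph of groups -/

namespace GraphOfGroups

variable {V : Type u} [Quiver.{v} V] [Quiver.HasInvolutiveReverse V]
  {A : GraphOfGroups.{u, v, w, x} V}

theorem α_reverse_flip {a b : V} {e : a ⟶ b} {f : b ⟶ a} (hf : Quiver.reverse e = f)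
    (z : A.EG f) : ∃ y : A.EG e, A.α f z = A.ω e y ∧ A.ω f z = A.α e y := by
  subst hf
  obtain ⟨y, rfl⟩ := (A.flip e).surjective z
  exact ⟨y, A.α_flip e y, A.ω_flip e y⟩

namespace Path

variable {a b c : V}

/-- The edge `e` cancels with the first edge of `p`. -/
def Cancels (e : a ⟶ b) (p : A.Path b c) : Prop :=
  ∃ (z : A.EG e) (p' : A.Path a c), p = cons (A.ω e z) (Quiver.reverse e) p'

/-- Paths without subpaths `⟨e, ω_e(z), e⁻¹⟩`. -/
def IsReduced : {a b : V} → A.Path a b → Prop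
  | _, _, nil _ => True
  | _, _, cons _ e p => ¬ Cancels e p ∧ IsReduced p

open Classical in
/-- The path `⟨g, e⟩ p` after the cancellation at `e`, if there is one. -/
noncomputable def act (g : A.VG a) (e : a ⟶ b) (p : A.Path b c) : A.Path a c :=
  if h : Cancels e p then headMul (g * A.α e h.choose) h.choose_spec.choose else cons g e p

theorem act_cons (g : A.VG a) (e : a ⟶ b) (z : A.EG e) (p : A.Path a c) :
    act g e (cons (A.ω e z) (Quiver.reverse e) p) = headMul (g * A.α e z) p := by
  have h : Cancels e (cons (A.ω e z) (Quiver.reverse e) p) := ⟨z, p, rfl⟩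
  have key : ∀ (z' : A.EG e) (p' : A.Path a c), cons (A.ω e z) (Quiver.reverse e) p =
      cons (A.ω e z') (Quiver.reverse e) p' →
      headMul (g * A.α e z') p' = headMul (g * A.α e z) p := by
    intro z' p' h1
    simp only [cons.injEq, heq_eq_eq, true_and] at h1
    rw [← A.ω_injective e h1.1, ← h1.2]
  rw [act, dif_pos h]
  exact key _ _ h.choose_spec.choose_spec

theorem act_of_not_cancels (g : A.VG a) {e : a ⟶ b} {p : A.Path b c} (h : ¬ Cancels e p) :
    act g e p = cons g e p := dif_neg h

theorem headMul_act (g h : A.VG a) (e : a ⟶ b) (p : A.Path b c) :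
    headMul g (act h e p) = act (g * h) e p := by
  by_cases hc : Cancels e p
  · obtain ⟨z, p', rfl⟩ := hc
    rw [act_cons, act_cons, headMul_headMul, mul_assoc]
  · rw [act_of_not_cancels _ hc, act_of_not_cancels _ hc]
    rfl

/-- The normal form of a path: all cancellations are carried out, from the right to the left. -/
noncomputable def nf : {a b : V} → A.Path a b → A.Path a b
  | _, _, nil g => nil g
  | _, _, cons g e p => act g e (nf p)

theorem nf_headMul (g : A.VG a) (p : A.Path a b) : nf (headMul g p) = headMul g (nf p) := by
  cases p with
  | nil h => rfl
  | cons h e p => exact (headMul_act g h e (nf p)).symm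

theorem isReduced_headMul (g : A.VG a) {p : A.Path a b} (h : IsReduced p) :
    IsReduced (headMul g p) := by
  cases p with
  | nil => trivial
  | cons => exact h

theorem isReduced_act (g : A.VG a) (e : a ⟶ b) {p : A.Path b c} (h : IsReduced p) :
    IsReduced (act g e p) := by
  by_cases hc : Cancels e p
  · obtain ⟨z, p', rfl⟩ := hc
    rw [act_cons]
    exact isReduced_headMul _ h.2
  · rw [act_of_not_cancels _ hc]
    exact ⟨hc, h⟩

theorem isReduced_nf (p : A.Path a b) : IsReduced (nf p) := by
  induction p with
  | nil => trivial
  | cons g e p ih => exact isReduced_act g e ih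

theorem nf_of_isReduced {p : A.Path a b} (h : IsReduced p) : nf p = p := by
  induction p with
  | nil => rfl
  | cons g e p ih => rw [nf, ih h.2, act_of_not_cancels _ h.1]

/-- Two paths with the same edges that differ by elements of the edge groups. -/
inductive Slide : {a b : V} → A.Path a b → A.Path a b → Prop
  | nil {a : V} (g : A.VG a) : Slide (nil g) (nil g)
  | cons {a b c : V} (g : A.VG a) (e : a ⟶ b) (z : A.EG e) {p q : A.Path b c} : Slide p q →
      Slide (cons (g * A.α e z) e p) (cons g e (headMul (A.ω e z) q))

theorem Slide.cons' (g : A.VG a) (e : a ⟶ b) {p q : A.Path b c} (h : Slide p q) :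
    Slide (Path.cons g e p) (Path.cons g e q) := by
  have := Slide.cons g e 1 h
  rwa [map_one, map_one, mul_one, headMul_one] at this

theorem Slide.refl (p : A.Path a b) : Slide p p := by
  induction p with
  | nil g => exact Slide.nil g
  | cons g e p ih => exact ih.cons' g e

theorem Slide.headMul (g : A.VG a) {p q : A.Path a b} (h : Slide p q) :
    Slide (headMul g p) (headMul g q) := by
  cases h with
  | nil h => exact Slide.nil _
  | cons h e z hs =>
    have := Slide.cons (g * h) e z hs
    rwa [mul_assoc] at this

theorem Slide.symm {p q : A.Path a b} (h : Slide p q) : Slide q p := by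
  induction h with
  | nil g => exact Slide.nil g
  | cons g e z _ ih =>
    have := Slide.cons (g * A.α e z) e z⁻¹ (ih.headMul (A.ω e z))
    rw [map_inv, map_inv, mul_inv_cancel_right, headMul_headMul, inv_mul_cancel,
        headMul_one] at this
    exact this

theorem Slide.trans {p q r : A.Path a b} (h : Slide p q) (h' : Slide q r) : Slide p r := by
  induction h with
  | nil g => exact h'
  | @cons a b c g e z p q h1 ih =>
    generalize hs : Path.cons g e (Path.headMul (A.ω e z) q) = s at h'
    cases h' with
    | nil => cases hs
    | @cons _ b' _ g' e' z' p' q' h2 =>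
      cases hs
      have h3 := (h2.headMul (A.ω e z)⁻¹)
      rw [headMul_headMul, inv_mul_cancel, headMul_one] at h3
      have := Slide.cons g' e (z' * z) (ih h3)
      rw [headMul_headMul, map_mul, map_mul, mul_inv_cancel_right] at this
      rwa [mul_assoc]

theorem Slide.act (g : A.VG a) (e : a ⟶ b) {p q : A.Path b c} (h : Slide p q) :
    Slide (act g e p) (act g e q) := by
  have key : ∀ {p q : A.Path b c}, Slide p q → Cancels e p →
      Cancels e q ∧ Slide (Path.act g e p) (Path.act g e q) := by
    rintro p q h ⟨z, p', rfl⟩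
    rw [act_cons]
    generalize hs : Path.cons (A.ω e z) (Quiver.reverse e) p' = s at h
    cases h with
    | nil => cases hs
    | @cons _ _ _ g' _ y p q h1 =>
      simp only [Path.cons.injEq] at hs
      obtain ⟨rfl, h2, h3, h4⟩ := hs
      obtain rfl := eq_of_heq h3
      obtain rfl := eq_of_heq h4
      obtain ⟨y', h5, h6⟩ := α_reverse_flip (A := A) (e := e) rfl y
      have h7 : g' = A.ω e (z * y'⁻¹) := by rw [map_mul, h2, h5, map_inv, mul_inv_cancel_right]
      subst h7
      refine ⟨⟨_, _, rfl⟩, ?_⟩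
      rw [act_cons, headMul_headMul, h6, mul_assoc, ← map_mul, inv_mul_cancel_right]
      exact h1.headMul _
  by_cases hp : Cancels e p
  · exact (key h hp).2
  · by_cases hq : Cancels e q
    · exact absurd (key h.symm hq).1 hp
    · rw [act_of_not_cancels _ hp, act_of_not_cancels _ hq]
      exact h.cons' g e

/-- A cancellation inside a path does not change the normal form, up to slides. -/
theorem slide_act_act (g : A.VG a) {e : a ⟶ b} {f : b ⟶ a} (hf : Quiver.reverse e = f)
    (he : Quiver.reverse f = e) (z : A.EG e) {p : A.Path a c} (hp : IsReduced p) :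
    Slide (act g e (act (A.ω e z) f p)) (headMul (g * A.α e z) p) := by
  by_cases hc : Cancels f p
  · obtain ⟨y, p', rfl⟩ := hc
    rw [act_cons]
    obtain ⟨y', h1, h2⟩ := α_reverse_flip hf y
    rw [he] at hp ⊢
    rw [h1, h2, ← map_mul]
    have h3 : ¬ Cancels e (headMul (A.ω e (z * y')) p') := by
      rintro ⟨x, q, hq⟩
      refine hp.1 ⟨(z * y')⁻¹ * x, q, ?_⟩
      have := congrArg (headMul (A.ω e (z * y')⁻¹)) hq
      rw [headMul_headMul, ← map_mul, inv_mul_cancel, map_one, headMul_one] at this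
      rw [this, map_mul]
      rfl
    rw [act_of_not_cancels _ h3]
    have := (Slide.cons g e (z * y') (Slide.refl p')).symm
    rwa [map_mul (A.α e), ← mul_assoc] at this
  · rw [act_of_not_cancels _ hc]
    subst hf
    rw [act_cons]
    exact Slide.refl _

theorem Red.slide_nf {p q : A.Path a b} (h : Red p q) : Slide (nf p) (nf q) := by
  induction h with
  | head g e z p =>
    rw [nf_headMul]
    exact slide_act_act g rfl (Quiver.reverse_reverse e) z (isReduced_nf p)
  | tail g e _ ih => exact ih.act g e

theorem Equiv.slide_nf {p q : A.Path a b} (h : Equiv p q) : Slide (nf p) (nf q) := by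
  induction h with
  | rel p q h => exact h.slide_nf
  | refl p => exact Slide.refl _
  | symm p q _ ih => exact ih.symm
  | trans p q r _ _ ih ih' => exact ih.trans ih'

/-- Equivalent reduced paths have the same edges and differ by elements of the edge groups. -/
theorem Equiv.slide {p q : A.Path a b} (h : Equiv p q) (hp : IsReduced p) (hq : IsReduced q) :
    Slide p q := by
  have := h.slide_nf
  rwa [nf_of_isReduced hp, nf_of_isReduced hq] at this

/-- The first vertex group element of a path. -/
def head : {a b : V} → A.Path a b → A.VG a
  | _, _, nil g => g
  | _, _, cons g _ _ => g

theorem head_headMul (g : A.VG a) (p : A.Path a b) : head (headMul g p) = g * head p := by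
  cases p <;> rfl

end Path

/-! ### The splitting of the fundamental group -/

variable {v₀ : V}

/-- The element of the fundamental group represented by a path, when all vertices are connected
to the base point by the paths `t`. -/
def val (t : ∀ a, A.Path v₀ a) {a b : V} (p : A.Path a b) : A.FundamentalGroup v₀ :=
  Quotient.mk (Path.loopSetoid A v₀) ((t a).comp (p.comp (t b).inv))

variable (t : ∀ a, A.Path v₀ a) {a b c : V}

theorem val_comp (p : A.Path a b) (q : A.Path b c) : val t (p.comp q) = val t p * val t q := by
  refine Quotient.sound (s := Path.loopSetoid A v₀) ?_
  change Path.Equiv _ (Path.comp _ _)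
  rw [Path.comp_assoc, Path.comp_assoc, Path.comp_assoc]
  refine Path.Equiv.comp (Path.Equiv.refl _) (Path.Equiv.comp (Path.Equiv.refl _) ?_)
  rw [← Path.comp_assoc]
  have := Path.Equiv.comp (Path.inv_comp (t b)) (Path.Equiv.refl (q.comp (t c).inv))
  rw [Path.one_comp] at this
  exact this.symm

theorem val_eq_iff {p q : A.Path a b} : val t p = val t q ↔ Path.Equiv p q := by
  constructor
  · intro h
    have h1 : Path.Equiv ((t a).comp (p.comp (t b).inv)) ((t a).comp (q.comp (t b).inv)) :=
      Quotient.exact h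
    have h2 : ∀ p : A.Path a b, Path.Equiv
        ((t a).inv.comp (((t a).comp (p.comp (t b).inv)).comp (t b))) p := by
      intro p
      rw [Path.comp_assoc, Path.comp_assoc, ← Path.comp_assoc]
      have := Path.Equiv.comp (Path.inv_comp (t a))
        ((Path.Equiv.refl p).comp (Path.inv_comp (t b)))
      rwa [Path.comp_one, Path.one_comp] at this
    exact (h2 p).symm.trans
      ((Path.Equiv.comp (Path.Equiv.refl _) (h1.comp (Path.Equiv.refl _))).trans (h2 q))
  · intro h
    exact Quotient.sound (s := Path.loopSetoid A v₀)
      (Path.Equiv.comp (Path.Equiv.refl _) (h.comp (Path.Equiv.refl _)))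

theorem val_one (a : V) : val t (Path.nil (1 : A.VG a)) = 1 := by
  have := val_comp t (Path.nil (1 : A.VG a)) (Path.nil 1)
  rw [Path.comp_one] at this
  exact left_eq_mul.1 this

theorem exists_val_eq (a b : V) (g : A.FundamentalGroup v₀) : ∃ p : A.Path a b, val t p = g := by
  obtain ⟨p, rfl⟩ := Quotient.exists_rep g
  refine ⟨(t a).inv.comp (p.comp (t b)), Quotient.sound (s := Path.loopSetoid A v₀) ?_⟩
  change Path.Equiv _ _
  rw [Path.comp_assoc, Path.comp_assoc, ← Path.comp_assoc]
  have := Path.Equiv.comp (Path.comp_inv (t a)) ((Path.Equiv.refl p).comp (Path.comp_inv (t b)))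
  rwa [Path.comp_one, Path.one_comp] at this

/-- The embedding of a vertex group. -/
def ι (a : V) : A.VG a →* A.FundamentalGroup v₀ where
  toFun g := val t (Path.nil g)
  map_one' := val_one t a
  map_mul' g h := val_comp t (Path.nil g) (Path.nil h)

/-- The element of the fundamental group that corresponds to an edge. -/
def edgeVal (e : a ⟶ b) : A.FundamentalGroup v₀ := val t (Path.cons 1 e (Path.nil 1))

theorem val_cons (g : A.VG a) (e : a ⟶ b) (p : A.Path b c) :
    val t (Path.cons g e p) = ι t a g * edgeVal t e * val t p := by
  have h : Path.cons g e p = (Path.nil g).comp ((Path.cons 1 e (Path.nil 1)).comp p) := by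
    change _ = Path.headMul g (Path.cons 1 e (Path.headMul 1 p))
    rw [Path.headMul_one, Path.headMul, mul_one]
  rw [h, val_comp, val_comp, mul_assoc]
  rfl

theorem val_red (e : a ⟶ b) (z : A.EG e) :
    edgeVal t e * ι t b (A.ω e z) * edgeVal t (Quiver.reverse e) = ι t a (A.α e z) := by
  have h := (val_eq_iff t).2 (Relation.EqvGen.rel _ _ (Path.Red.head 1 e z (Path.nil 1)))
  rw [val_cons, val_cons, map_one, val_one, one_mul, mul_one] at h
  rw [mul_assoc, h, one_mul]
  change val t (Path.nil (_ * 1)) = _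
  rw [mul_one]
  rfl

theorem edgeVal_reverse (e : a ⟶ b) : edgeVal t (Quiver.reverse e) = (edgeVal t e)⁻¹ := by
  have := val_red t e 1
  rw [map_one, map_one, map_one, map_one, mul_one] at this
  exact (inv_eq_of_mul_eq_one_right this).symm

theorem conj_edgeVal (e : a ⟶ b) (z : A.EG e) :
    (edgeVal t e)⁻¹ * ι t a (A.α e z) * edgeVal t e = ι t b (A.ω e z) := by
  rw [← val_red, edgeVal_reverse]
  group

theorem ι_injective (a : V) : Function.Injective (ι t a) := by
  intro g h hgh
  have h1 := ((val_eq_iff t).1 hgh).slide (p := Path.nil g) (q := Path.nil h) trivial trivial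
  cases h1
  rfl

variable {N : ℕ}

/-- The splitting of the fundamental group that is given by a graph of groups. The group of an edge
is its image in the vertex group of the origin. -/
def splitting (t : ∀ a, A.Path v₀ a) (s : ∀ a, Fin N → A.VG a) (hs : ∀ a, Generates (s a)) :
    Splitting V (Σ a b : V, (a ⟶ b)) (A.FundamentalGroup v₀) N where
  src e := e.1
  tgt e := e.2.1
  rev e := ⟨e.2.1, e.1, Quiver.reverse e.2.2⟩
  rev_rev e := by simp
  src_rev _ := rfl
  rev_ne := by
    rintro ⟨a, b, e⟩ h
    have h1 : b = a := congrArg (fun q => q.1) h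
    subst h1
    simp only [Sigma.mk.injEq, heq_eq_eq, true_and] at h
    exact A.reverse_ne _ e h
  vert a := (ι t a).range
  gen a i := ι t a (s a i)
  closure_gen a := by
    have h1 : Set.range (fun i => ι t a (s a i)) = ι t a '' Set.range (s a) := by
      rw [← Set.range_comp]
      rfl
    rw [h1, ← MonoidHom.map_closure, hs a, ← MonoidHom.range_eq_map]
  edge e := (A.α e.2.2).range.map (ι t e.1)
  edge_le e := Subgroup.map_le_range _ _
  τ e := edgeVal t e.2.2
  τ_rev e := edgeVal_reverse t e.2.2
  conj_mem := by
    rintro ⟨a, b, e⟩ _ ⟨_, ⟨z, rfl⟩, rfl⟩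
    rw [conj_edgeVal, ← A.α_flip]
    exact ⟨_, ⟨_, rfl⟩, rfl⟩

variable (s : ∀ a, Fin N → A.VG a) (hs : ∀ a, Generates (s a))

theorem mem_edge_splitting {e : Σ a b : V, (a ⟶ b)} {g : A.FundamentalGroup v₀} :
    g ∈ (splitting t s hs).edge e ↔ ∃ z, ι t e.1 (A.α e.2.2 z) = g := by
  simp [splitting, Subgroup.mem_map]

theorem ev_splitting (a : V) (w : GroupWord N) :
    (splitting t s hs).ev a w = ι t a (GroupWord.eval (s a) w) :=
  GroupWord.eval_comp (s a) (ι t a) w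

/-- The list of the edges of a path with the vertex group elements that follow them. -/
def tail : {a b : V} → A.Path a b → List ((Σ a b : V, (a ⟶ b)) × A.FundamentalGroup v₀)
  | _, _, Path.nil _ => []
  | _, _, Path.cons _ e p => (⟨_, _, e⟩, ι t _ p.head) :: tail p

theorem tail_headMul (g : A.VG a) (p : A.Path a b) : tail t (p.headMul g) = tail t p := by
  cases p <;> rfl

theorem isPath_tail (p : A.Path a b) : (splitting t s hs).IsPath a (tail t p) b := by
  induction p with
  | nil g => rfl
  | cons g e p ih => exact ⟨rfl, ⟨_, rfl⟩, ih⟩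

theorem val_eq_lval (p : A.Path a b) :
    val t p = ι t a p.head * (splitting t s hs).lval (tail t p) := by
  induction p with
  | nil g => exact (mul_one _).symm
  | cons g e p ih =>
    rw [val_cons, ih, tail, Splitting.lval_cons]
    simp only [splitting, Path.head, mul_assoc]

theorem exists_tail_eq {l : List ((Σ a b : V, (a ⟶ b)) × A.FundamentalGroup v₀)}
    {g : A.FundamentalGroup v₀} (hg : g ∈ (splitting t s hs).vert a)
    (hl : (splitting t s hs).IsPath a l b) :
    ∃ p : A.Path a b, ι t a p.head = g ∧ tail t p = l := by
  induction l generalizing a g with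
  | nil =>
    obtain ⟨h, rfl⟩ := hg
    obtain rfl : a = b := hl
    exact ⟨Path.nil h, rfl, rfl⟩
  | cons q l ih =>
    obtain ⟨⟨a', b', e⟩, x⟩ := q
    obtain ⟨h1, h2, h3⟩ := hl
    obtain rfl : a' = a := h1
    change x ∈ (splitting t s hs).vert b' at h2
    obtain ⟨p, rfl, rfl⟩ := ih h2 h3
    obtain ⟨h, rfl⟩ := hg
    exact ⟨Path.cons h e p, rfl, rfl⟩

theorem isReduced_of_tail {p : A.Path a b} (h : (splitting t s hs).Reduced (tail t p)) :
    p.IsReduced := by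
  induction p with
  | nil => trivial
  | cons g e p ih =>
    obtain ⟨h1, h2⟩ := List.isChain_cons.1 h
    refine ⟨?_, ih h2⟩
    rintro ⟨z, p', rfl⟩
    refine h1 _ rfl ⟨rfl, ?_⟩
    rw [mem_edge_splitting]
    exact ⟨A.flip e z, by rw [A.α_flip]; rfl⟩

theorem slide_tail {p q : A.Path a b} (h : p.Slide q) :
    (splitting t s hs).Slide (ι t a p.head) (tail t p) (ι t a q.head) (tail t q) := by
  induction h with
  | nil g => exact Splitting.Slide.nil _
  | @cons a b c g e z p q _ ih =>
    have := Splitting.Slide.cons (ι t a g) (S := splitting t s hs) ⟨a, b, e⟩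
      (z := ι t a (A.α e z)) ((mem_edge_splitting t s hs).2 ⟨z, rfl⟩) ih
    have h1 : (splitting t s hs).τ ⟨a, b, e⟩ = edgeVal t e := rfl
    rw [h1, conj_edgeVal, ← map_mul, ← map_mul, ← Path.head_headMul] at this
    rw [tail, tail, tail_headMul]
    exact this

theorem isFaithful_splitting : (splitting t s hs).IsFaithful where
  exists_path a b g := by
    obtain ⟨p, rfl⟩ := exists_val_eq t a b g
    exact ⟨_, ⟨_, rfl⟩, _, isPath_tail t s hs p, (val_eq_lval t s hs p).symm⟩
  slide := by
    intro a b g h l l' hg hh hl hl' hred hred' heq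
    obtain ⟨p, rfl, rfl⟩ := exists_tail_eq t s hs hg hl
    obtain ⟨q, rfl, rfl⟩ := exists_tail_eq t s hs hh hl'
    rw [← val_eq_lval, ← val_eq_lval, val_eq_iff] at heq
    exact slide_tail t s hs
      (heq.slide (isReduced_of_tail t s hs hred) (isReduced_of_tail t s hs hred'))

theorem fg_of_le_edge (hA : A.IsBenign) {e : Σ a b : V, (a ⟶ b)}
    {K : Subgroup (A.FundamentalGroup v₀)} (hK : K ≤ (splitting t s hs).edge e) : K.FG := by
  have h1 : K = (K.comap ((ι t e.1).comp (A.α e.2.2))).map ((ι t e.1).comp (A.α e.2.2)) := by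
    rw [Subgroup.map_comap_eq_self]
    intro g hg
    obtain ⟨z, rfl⟩ := (mem_edge_splitting t s hs).1 (hK hg)
    exact ⟨z, rfl⟩
  rw [h1]
  obtain ⟨F, hF⟩ := hA.noetherian e.2.2 (K.comap ((ι t e.1).comp (A.α e.2.2)))
  classical
  exact ⟨F.image _, by rw [Finset.coe_image, ← MonoidHom.map_closure, hF]⟩

end GraphOfGroups

/-! ### Coded graphs as graphs over the graph of groups -/

theorem mem_conjSubgroup {G : Type*} [Group G] {C : Subgroup G} {x y : G} :
    y ∈ conjSubgroup C x ↔ x * y * x⁻¹ ∈ C := by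
  constructor
  · rintro ⟨c, hc, rfl⟩
    simpa [mul_assoc] using hc
  · intro h
    exact ⟨_, h, by simp [mul_assoc]⟩

theorem GroupWord.span_fg {G : Type*} [Group G] {n : ℕ} (s : Fin n → G) (X : List (GroupWord n)) :
    (GroupWord.span s X).FG := by
  refine (Subgroup.fg_iff _).2 ⟨_, rfl, ?_⟩
  exact ((List.finite_toSet X).image (GroupWord.eval s)).subset fun g ⟨l, hl, h⟩ => ⟨l, hl, h⟩

namespace Splitting

variable {V E G : Type*} [Group G] {N : ℕ}

/-- The edges of a coded graph from `u` to `u'`, by their positions in the list. -/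
structure Arrow (S : Splitting V E G N) (D : GraphCode V E N) (u u' : V × ℕ) where
  idx : Fin D.2.length
  dir : Bool
  eO : S.eO (D.2[idx], dir) = u
  eT : S.eT (D.2[idx], dir) = u'

variable {S : Splitting V E G N} {D : GraphCode V E N} {u u' : V × ℕ}

/-- The coded edge of an arrow. -/
def Arrow.ed (f : S.Arrow D u u') : CodedEdge E N := (D.2[f.idx], f.dir)

/-- The inverse arrow. -/
def Arrow.rev (f : S.Arrow D u u') : S.Arrow D u' u :=
  ⟨f.idx, !f.dir, (S.eO_bar f.ed).trans f.eT, (S.eT_bar f.ed).trans f.eO⟩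

theorem Arrow.ed_rev (f : S.Arrow D u u') : f.rev.ed = bar f.ed := rfl

theorem Arrow.rev_rev (f : S.Arrow D u u') : f.rev.rev = f := by
  obtain ⟨i, b, h1, h2⟩ := f
  simp [Arrow.rev]

theorem Arrow.mem (f : S.Arrow D u u') : f.ed.1 ∈ D.2 := List.getElem_mem _

theorem Arrow.eO_ed (f : S.Arrow D u u') : S.eO f.ed = u := f.eO

theorem Arrow.eT_ed (f : S.Arrow D u u') : S.eT f.ed = u' := f.eT

theorem Arrow.ext_ed (hD : D.2.Nodup) {f g : S.Arrow D u u'} (h : f.ed = g.ed) : f = g := by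
  obtain ⟨i, b, h1, h2⟩ := f
  obtain ⟨j, c, h3, h4⟩ := g
  obtain ⟨h5, h6⟩ := Prod.ext_iff.1 h
  obtain rfl : b = c := h6
  obtain rfl : i = j := Fin.ext ((hD.getElem_inj_iff).1 h5)
  rfl

theorem exists_arrow {t : CodedEdge E N} (ht : t.1 ∈ D.2) (hO : S.eO t = u) (hT : S.eT t = u') :
    ∃ f : S.Arrow D u u', f.ed = t := by
  obtain ⟨i, hi, h⟩ := List.getElem_of_mem ht
  have h1 : (D.2[i], t.2) = t := by rw [h]
  exact ⟨⟨⟨i, hi⟩, t.2, by simpa [h1] using hO, by simpa [h1] using hT⟩, h1⟩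

/-- The vertices of a coded graph, enumerated by `en`. -/
structure CodeVertex (S : Splitting V E G N) (D : GraphCode V E N) {k : ℕ}
    (en : Fin k → V × ℕ) where
  idx : Fin k

/-- The arrows are the edges of the code in both directions. -/
instance {k : ℕ} {en : Fin k → V × ℕ} : Quiver (S.CodeVertex D en) :=
  ⟨fun a b => S.Arrow D (en a.idx) (en b.idx)⟩

instance {k : ℕ} {en : Fin k → V × ℕ} : Quiver.HasInvolutiveReverse (S.CodeVertex D en) where
  reverse' := fun f => Arrow.rev f
  inv' := fun f => Arrow.rev_rev f

end Splitting

namespace GraphOfGroups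

variable {V : Type u} [Quiver.{v} V] [Quiver.HasInvolutiveReverse V]
  {A : GraphOfGroups.{u, v, w, x} V} {v₀ : V} {N : ℕ} (t : ∀ a, A.Path v₀ a)
  (s : ∀ a, Fin N → A.VG a) (hs : ∀ a, Generates (s a))
  (D : GraphCode V (Σ a b : V, (a ⟶ b)) N)

section Labels

variable {t s hs D} {u u' : V × ℕ} (f : (splitting t s hs).Arrow D u u')

theorem exists_type : ∃ e : u.1 ⟶ u'.1, (splitting t s hs).eE f.ed = ⟨u.1, u'.1, e⟩ := by
  obtain ⟨i, b, rfl, rfl⟩ := f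
  exact ⟨_, rfl⟩

theorem exists_α : ∃ g : A.VG u.1, ι t _ g = (splitting t s hs).α f.ed := by
  have := (splitting t s hs).α_mem f.ed
  rwa [f.eO_ed] at this

theorem exists_ω : ∃ g : A.VG u'.1, ι t _ g = (splitting t s hs).ω f.ed := by
  have := (splitting t s hs).ω_mem f.ed
  rwa [f.eT_ed] at this

end Labels

/-- The graph over a graph of groups that is given by a code, on the vertices enumerated by `en`. -/
noncomputable abbrev codeGraph {k : ℕ} (en : Fin k → V × ℕ) : A.AGraph where
  B := (splitting t s hs).CodeVertex D en
  reverse_ne a f h := by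
    have h1 := congrArg Splitting.Arrow.dir h
    revert h1
    change (!f.dir) = f.dir → False
    cases f.dir <;> simp
  type :=
    { obj := fun i => (en i.idx).1
      map := fun f => (exists_type f).choose }
  type_reverse {a b} f := by
    have h1 := (exists_type f).choose_spec
    have h2 := (exists_type (Splitting.Arrow.rev f)).choose_spec
    have h3 := h2.symm.trans ((Splitting.eE_bar _ _).trans (congrArg (splitting t s hs).rev h1))
    simp only [splitting, Sigma.mk.injEq, heq_eq_eq, true_and] at h3
    exact h3
  grp a := ((splitting t s hs).B D (en a.idx)).comap (ι t (en a.idx).1)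
  fα f := (exists_α f).choose
  fω f := (exists_ω f).choose
  fα_reverse {a b} f := by
    refine ι_injective t _ ?_
    rw [map_inv]
    change ι t _ (exists_α (Splitting.Arrow.rev f)).choose = _
    rw [(exists_α (Splitting.Arrow.rev f)).choose_spec, (exists_ω f).choose_spec,
      Splitting.Arrow.ed_rev, Splitting.α_bar]

section CodeGraph

variable {t s hs D} {k : ℕ} {en : Fin k → V × ℕ}

/-- The coded edge of an edge of the graph given by a code. -/
def codedEdge {a b : (splitting t s hs).CodeVertex D en} (f : a ⟶ b) :
    CodedEdge (Σ a b : V, (a ⟶ b)) N := Splitting.Arrow.ed (S := splitting t s hs) (D := D) f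

variable {a b c : (splitting t s hs).CodeVertex D en} (f : a ⟶ b)

theorem codedEdge_mem : (codedEdge f).1 ∈ D.2 := Splitting.Arrow.mem _

theorem eO_codedEdge : (splitting t s hs).eO (codedEdge f) = en a.idx := Splitting.Arrow.eO_ed _

theorem eT_codedEdge : (splitting t s hs).eT (codedEdge f) = en b.idx := Splitting.Arrow.eT_ed _

theorem eE_codedEdge : (splitting t s hs).eE (codedEdge f) =
    ⟨_, _, (codeGraph t s hs D en).type.map f⟩ := (exists_type _).choose_spec

theorem codedEdge_reverse : codedEdge (Quiver.reverse f) = Splitting.bar (codedEdge f) := rfl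

theorem ι_fα : ι t _ ((codeGraph t s hs D en).fα f) = (splitting t s hs).α (codedEdge f) :=
  (exists_α _).choose_spec

theorem ι_fω : ι t _ ((codeGraph t s hs D en).fω f) = (splitting t s hs).ω (codedEdge f) :=
  (exists_ω _).choose_spec

theorem mem_grp {g : A.VG ((codeGraph t s hs D en).type.obj a)} :
    g ∈ (codeGraph t s hs D en).grp a ↔ ι t _ g ∈ (splitting t s hs).B D (en a.idx) := Iff.rfl

theorem mem_edgeGroupα {z : A.EG ((codeGraph t s hs D en).type.map f)} :
    z ∈ (codeGraph t s hs D en).edgeGroupα f ↔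
      (splitting t s hs).α (codedEdge f) * ι t _ (A.α _ z) *
        ((splitting t s hs).α (codedEdge f))⁻¹ ∈ (splitting t s hs).B D (en a.idx) := by
  rw [AGraph.edgeGroupα, Subgroup.mem_comap, mem_conjSubgroup, mem_grp, map_mul, map_mul, map_inv,
    ι_fα]

theorem mem_edgeGroupω {z : A.EG ((codeGraph t s hs D en).type.map f)} :
    z ∈ (codeGraph t s hs D en).edgeGroupω f ↔
      ((splitting t s hs).ω (codedEdge f))⁻¹ * ι t _ (A.ω _ z) *
        (splitting t s hs).ω (codedEdge f) ∈ (splitting t s hs).B D (en b.idx) := by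
  rw [AGraph.edgeGroupω, Subgroup.mem_comap, mem_conjSubgroup, mem_grp, map_mul, map_mul, map_inv,
    map_inv, map_inv, ι_fω, inv_inv]

theorem τ_codedEdge : (splitting t s hs).τ ((splitting t s hs).eE (codedEdge f)) =
    edgeVal t ((codeGraph t s hs D en).type.map f) := by
  rw [eE_codedEdge]
  rfl

theorem ι_α_mem (z : A.EG ((codeGraph t s hs D en).type.map f)) :
    ι t _ (A.α _ z) ∈ (splitting t s hs).edge ((splitting t s hs).eE (codedEdge f)) := by
  rw [eE_codedEdge, mem_edge_splitting]
  exact ⟨z, rfl⟩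

theorem edgeGroupα_eq (hD : (splitting t s hs).Folded D) :
    (codeGraph t s hs D en).edgeGroupα f = (codeGraph t s hs D en).edgeGroupω f := by
  ext z
  rw [mem_edgeGroupα, mem_edgeGroupω, ← eO_codedEdge f, ← eT_codedEdge f,
    hD.edge_group_iff (codedEdge_mem f) (ι_α_mem f z), τ_codedEdge, conj_edgeVal]

/-- Each positive edge has to be listed only once: two copies of one edge could be folded. -/
theorem isFolded_codeGraph (hD : (splitting t s hs).Folded D) (hN : D.2.Nodup)
    (hen : Function.Injective en) : (codeGraph t s hs D en).IsFolded where
  no_fold {a b c} f₁ f₂ hne heq g hg z h := by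
    have hE : (splitting t s hs).eE (codedEdge f₂) =
        (splitting t s hs).eE (Splitting.bar (codedEdge f₁)) := by
      rw [Splitting.eE_bar, eE_codedEdge, eE_codedEdge]
      exact congrArg (fun q : Quiver.Star _ => (⟨_, q.1, q.2⟩ : Σ a b : V, (a ⟶ b))) heq
    refine hD.no_fold (Splitting.bar (codedEdge f₁)) (codedEdge f₂) (codedEdge_mem f₁)
      (codedEdge_mem f₂) ?_ ?_ hE.symm (ι t _ (A.ω _ z))⁻¹ ⟨?_, ?_⟩
    · intro h1
      apply hne
      have hc : en c.idx = en a.idx := by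
        rw [← eT_codedEdge f₂, ← h1, Splitting.eT_bar, eO_codedEdge]
      obtain rfl : c = a := by cases a; cases c; congr; exact hen hc
      congr 1
      exact Splitting.Arrow.ext_ed hN h1.symm
    · rw [Splitting.eO_bar, eT_codedEdge, eO_codedEdge]
    · rw [hE, Splitting.eE_bar, eE_codedEdge]
      exact inv_mem ((mem_edge_splitting t s hs).2 ⟨A.flip _ z, congrArg (ι t _) (A.α_flip _ z)⟩)
    · rw [mem_grp] at hg
      rw [eO_codedEdge, Splitting.α_bar]
      convert hg using 1
      have := congrArg (ι t _) h
      rw [map_mul, map_mul, ι_fα, ι_fω] at this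
      rw [← this]
      group
  edgeGroup_eq f := edgeGroupα_eq f hD

theorem isFinitelyDescribed_codeGraph : (codeGraph t s hs D en).IsFinitelyDescribed where
  finite_vertices := Finite.of_injective (β := Fin k) (fun a => a.idx) (by
    rintro ⟨i⟩ ⟨j⟩ h
    exact congrArg _ h)
  finite_edges a b := by
    refine Finite.of_injective (β := Fin D.2.length × Bool)
      (fun f : (splitting t s hs).Arrow D (en a.idx) (en b.idx) => (f.idx, f.dir)) ?_
    rintro ⟨i, b, h1, h2⟩ ⟨j, c, h3, h4⟩ h
    simp only [Prod.mk.injEq] at h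
    obtain ⟨rfl, rfl⟩ := h
    rfl
  grp_fg a := by
    have h1 : (codeGraph t s hs D en).grp a =
        GroupWord.span (s (en a.idx).1) (Splitting.gens D (en a.idx)) := by
      change (GroupWord.span (fun i => ι t _ (s _ i)) _).comap (ι t (en a.idx).1) = _
      rw [GroupWord.span_comp, Subgroup.comap_map_eq_self_of_injective (ι_injective t _)]
    rw [h1]
    exact GroupWord.span_fg _ _

/-- In a folded graph, the two conditions that define the edge group agree, so that it is the group
defined by the origin alone. -/
theorem edgeStab_codedEdge (hD : (splitting t s hs).Folded D) :
    (splitting t s hs).edgeStab D (codedEdge f) =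
      ((codeGraph t s hs D en).edgeGroup f).map
        ((ι t _).comp (A.α ((codeGraph t s hs D en).type.map f))) := by
  have h1 : (codeGraph t s hs D en).edgeGroup f = (codeGraph t s hs D en).edgeGroupα f := by
    rw [AGraph.edgeGroup, ← edgeGroupα_eq f hD, inf_idem]
  rw [h1]
  ext g
  rw [Splitting.mem_edgeStab, eO_codedEdge]
  constructor
  · rintro ⟨h2, h3⟩
    rw [eE_codedEdge, mem_edge_splitting] at h2
    obtain ⟨z, rfl⟩ := h2
    exact ⟨z, (mem_edgeGroupα f).2 h3, rfl⟩
  · rintro ⟨z, hz, rfl⟩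
    exact ⟨ι_α_mem f z, (mem_edgeGroupα f).1 hz⟩

theorem ι_comp_α_injective {a b : V} (e : a ⟶ b) :
    Function.Injective ((ι t a).comp (A.α e)) :=
  (ι_injective t a).comp (A.α_injective e)

theorem finite_edgeGroup_iff (hD : (splitting t s hs).Folded D) :
    Finite ((codeGraph t s hs D en).edgeGroup f) ↔
      Finite ((splitting t s hs).edgeStab D (codedEdge f)) := by
  rw [edgeStab_codedEdge f hD]
  exact ((Subgroup.equivMapOfInjective _ _ (ι_comp_α_injective _)).toEquiv).finite_iff

theorem range_α_eq_of_star_eq {a b c : V} {e : a ⟶ b} {e' : a ⟶ c}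
    (h : Quiver.Star.mk e = Quiver.Star.mk e') : (A.α e).range = (A.α e').range := by
  cases h
  rfl

theorem range_α_reverse {a b : V} (e : a ⟶ b) :
    (A.α (Quiver.reverse e)).range = (A.ω e).range := by
  ext g
  constructor
  · rintro ⟨z, rfl⟩
    obtain ⟨y, h, -⟩ := α_reverse_flip (A := A) (e := e) rfl z
    exact ⟨y, h.symm⟩
  · rintro ⟨z, rfl⟩
    exact ⟨A.flip e z, A.α_flip e z⟩

/-- The double coset property at the vertex between two consecutive edges with finite groups,
transported to `G`: if `g` is allowed between the two edges in a reduced path, it can be read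
between them in finitely many ways only. -/
theorem finite_of_doubleCoset (hD : (splitting t s hs).Folded D)
    {a b c : (splitting t s hs).CodeVertex D en} (f₁ : a ⟶ b) (f₂ : b ⟶ c)
    (hfin₁ : Finite ((codeGraph t s hs D en).edgeGroup f₁))
    (hfin₂ : Finite ((codeGraph t s hs D en).edgeGroup f₂))
    (hpair : Quiver.Star.mk ((codeGraph t s hs D en).type.map f₂)
          ≠ Quiver.Star.mk (Quiver.reverse ((codeGraph t s hs D en).type.map f₁)) →
        DoubleCosetPairProperty
          (conjSubgroup (A.ω ((codeGraph t s hs D en).type.map f₁)).range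
            ((codeGraph t s hs D en).fω f₁))
          (conjSubgroup (A.α ((codeGraph t s hs D en).type.map f₂)).range
            ((codeGraph t s hs D en).fα f₂)⁻¹))
    (hone : Quiver.Star.mk ((codeGraph t s hs D en).type.map f₂)
          = Quiver.Star.mk (Quiver.reverse ((codeGraph t s hs D en).type.map f₁)) →
        DoubleCosetProperty
          (conjSubgroup (A.ω ((codeGraph t s hs D en).type.map f₁)).range
            ((codeGraph t s hs D en).fω f₁)))
    {g : A.VG ((codeGraph t s hs D en).type.obj b)}
    (hgood : (splitting t s hs).Good ((splitting t s hs).eE (codedEdge f₁), ι t _ g)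
      ((splitting t s hs).eE (codedEdge f₂), 1)) :
    {p : A.FundamentalGroup v₀ × A.FundamentalGroup v₀ |
      p.1 ∈ (splitting t s hs).edge ((splitting t s hs).rev
        ((splitting t s hs).eE (codedEdge f₁))) ∧
      p.2 ∈ (splitting t s hs).edge ((splitting t s hs).eE (codedEdge f₂)) ∧
      ((splitting t s hs).ω (codedEdge f₁))⁻¹ * p.1 * ι t _ g * p.2 *
        ((splitting t s hs).α (codedEdge f₂))⁻¹ ∈
          (splitting t s hs).B D ((splitting t s hs).eT (codedEdge f₁))}.Finite := by
  have hG₁ : (codeGraph t s hs D en).edgeGroup f₁ = (codeGraph t s hs D en).edgeGroupω f₁ := by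
    rw [AGraph.edgeGroup, edgeGroupα_eq f₁ hD, inf_idem]
  have hG₂ : (codeGraph t s hs D en).edgeGroup f₂ = (codeGraph t s hs D en).edgeGroupα f₂ := by
    rw [AGraph.edgeGroup, ← edgeGroupα_eq f₂ hD, inf_idem]
  have hC₁ : Finite ↥((codeGraph t s hs D en).grp b ⊓
      conjSubgroup (A.ω ((codeGraph t s hs D en).type.map f₁)).range
        ((codeGraph t s hs D en).fω f₁)) := by
    have h1 : ((codeGraph t s hs D en).edgeGroupω f₁ :
        Set (A.EG ((codeGraph t s hs D en).type.map f₁))).Finite :=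
      Set.finite_coe_iff.1 (by rw [hG₁] at hfin₁; exact hfin₁)
    refine ((h1.image fun z => ((codeGraph t s hs D en).fω f₁)⁻¹ *
      A.ω ((codeGraph t s hs D en).type.map f₁) z *
        (codeGraph t s hs D en).fω f₁).subset ?_).to_subtype
    rintro h ⟨hh1, hh2⟩
    obtain ⟨z, hz⟩ := mem_conjSubgroup.1 hh2
    have h2 : ((codeGraph t s hs D en).fω f₁)⁻¹ * A.ω ((codeGraph t s hs D en).type.map f₁) z *
        (codeGraph t s hs D en).fω f₁ = h := by
      rw [hz]
      group
    refine ⟨z, ?_, h2⟩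
    change z ∈ (codeGraph t s hs D en).edgeGroupω f₁
    rw [AGraph.edgeGroupω, Subgroup.mem_comap, mem_conjSubgroup, inv_inv, h2]
    exact hh1
  have hC₂ : Finite ↥((codeGraph t s hs D en).grp b ⊓
      conjSubgroup (A.α ((codeGraph t s hs D en).type.map f₂)).range
        ((codeGraph t s hs D en).fα f₂)⁻¹) := by
    have h1 : ((codeGraph t s hs D en).edgeGroupα f₂ :
        Set (A.EG ((codeGraph t s hs D en).type.map f₂))).Finite :=
      Set.finite_coe_iff.1 (by rw [hG₂] at hfin₂; exact hfin₂)
    refine ((h1.image fun z => (codeGraph t s hs D en).fα f₂ *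
      A.α ((codeGraph t s hs D en).type.map f₂) z *
        ((codeGraph t s hs D en).fα f₂)⁻¹).subset ?_).to_subtype
    rintro h ⟨hh1, hh2⟩
    obtain ⟨z, hz⟩ := mem_conjSubgroup.1 hh2
    have h2 : (codeGraph t s hs D en).fα f₂ * A.α ((codeGraph t s hs D en).type.map f₂) z *
        ((codeGraph t s hs D en).fα f₂)⁻¹ = h := by
      rw [hz]
      group
    refine ⟨z, ?_, h2⟩
    change z ∈ (codeGraph t s hs D en).edgeGroupα f₂
    rw [AGraph.edgeGroupα, Subgroup.mem_comap, mem_conjSubgroup, h2]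
    exact hh1
  have hfg := isFinitelyDescribed_codeGraph.grp_fg b
  have hP : {p : A.VG ((codeGraph t s hs D en).type.obj b) ×
      A.VG ((codeGraph t s hs D en).type.obj b) |
      p.1 ∈ conjSubgroup (A.ω ((codeGraph t s hs D en).type.map f₁)).range
        ((codeGraph t s hs D en).fω f₁) ∧
      p.2 ∈ conjSubgroup (A.α ((codeGraph t s hs D en).type.map f₂)).range
        ((codeGraph t s hs D en).fα f₂)⁻¹ ∧
      p.1 * (((codeGraph t s hs D en).fω f₁)⁻¹ * g * ((codeGraph t s hs D en).fα f₂)⁻¹) * p.2 ∈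
        (codeGraph t s hs D en).grp b}.Finite := by
    by_cases hst : Quiver.Star.mk ((codeGraph t s hs D en).type.map f₂)
        = Quiver.Star.mk (Quiver.reverse ((codeGraph t s hs D en).type.map f₁))
    · have hr := (range_α_eq_of_star_eq hst).trans (range_α_reverse (A := A) _)
      -- The second subgroup is the conjugate of the first one by this element.
      have hx : conjSubgroup (conjSubgroup (A.ω ((codeGraph t s hs D en).type.map f₁)).range
          ((codeGraph t s hs D en).fω f₁))
            (((codeGraph t s hs D en).fω f₁)⁻¹ * ((codeGraph t s hs D en).fα f₂)⁻¹) =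
          conjSubgroup (A.α ((codeGraph t s hs D en).type.map f₂)).range
            ((codeGraph t s hs D en).fα f₂)⁻¹ := by
        ext y
        rw [mem_conjSubgroup, mem_conjSubgroup, mem_conjSubgroup, hr]
        congr! 1
        group
      have := hone hst _ hfg
        (((codeGraph t s hs D en).fω f₁)⁻¹ * ((codeGraph t s hs D en).fα f₂)⁻¹)
        (((codeGraph t s hs D en).fω f₁)⁻¹ * g * ((codeGraph t s hs D en).fα f₂)⁻¹) ?_ hC₁
        (by rw [hx]; exact hC₂)
      · rwa [hx] at this
      -- The element is outside of the subgroup because the path does not backtrack at `g`.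
      · intro h
        rw [mem_conjSubgroup] at h
        apply hgood
        rw [eE_codedEdge, eE_codedEdge]
        refine ⟨congrArg (fun q : Quiver.Star _ => (⟨_, q.1, q.2⟩ : Σ a b : V, (a ⟶ b))) hst, ?_⟩
        have h2 : g ∈ (A.α ((codeGraph t s hs D en).type.map f₂)).range := by
          rw [hr]
          convert h using 1
          group
        obtain ⟨z, rfl⟩ := h2
        exact (mem_edge_splitting t s hs).2 ⟨z, rfl⟩
    · exact hpair hst _ hfg _ hC₁ hC₂
  refine (hP.image fun p => ((splitting t s hs).ω (codedEdge f₁) * ι t _ p.1 *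
      ((splitting t s hs).ω (codedEdge f₁))⁻¹, ((splitting t s hs).α (codedEdge f₂))⁻¹ * ι t _ p.2 *
      (splitting t s hs).α (codedEdge f₂))).subset ?_
  rintro ⟨p₁, p₂⟩ ⟨h1, h2, h3⟩
  dsimp only at h1 h2 h3
  rw [← Splitting.eE_bar, ← codedEdge_reverse, eE_codedEdge, mem_edge_splitting] at h1
  rw [eE_codedEdge, mem_edge_splitting] at h2
  obtain ⟨z₁, rfl⟩ := h1
  obtain ⟨z₂, rfl⟩ := h2
  have hz : A.α ((codeGraph t s hs D en).type.map (Quiver.reverse f₁)) z₁ ∈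
      (A.ω ((codeGraph t s hs D en).type.map f₁)).range := by
    rw [← range_α_reverse, ← AGraph.type_reverse]
    exact ⟨z₁, rfl⟩
  refine ⟨(((codeGraph t s hs D en).fω f₁)⁻¹ * A.α _ z₁ * (codeGraph t s hs D en).fω f₁,
    (codeGraph t s hs D en).fα f₂ * A.α _ z₂ * ((codeGraph t s hs D en).fα f₂)⁻¹),
    ⟨?_, ?_, ?_⟩, ?_⟩
  · rw [mem_conjSubgroup]
    convert hz using 1
    group
  · rw [mem_conjSubgroup]
    exact ⟨z₂, by group⟩
  · rw [mem_grp]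
    rw [eT_codedEdge, ← ι_fα, ← ι_fω] at h3
    convert h3 using 1
    simp only [map_mul, map_inv]
    group
  · rw [← ι_fα, ← ι_fω]
    simp only [map_mul, map_inv]
    refine Prod.ext ?_ ?_ <;> simp only <;> group

/-- The conditions on the graphs over a graph of groups, in terms of codes. -/
theorem tame_of_powerReadingConditions (hread : ∀ 𝔹 : A.AGraph, 𝔹.IsFinitelyDescribed → 𝔹.IsFolded →
    𝔹.PowerReadingConditions) (hD : (splitting t s hs).Folded D) (hN : D.2.Nodup) :
    (splitting t s hs).Tame D := by
  classical
  obtain ⟨k, en, hen, hO⟩ : ∃ (k : ℕ) (en : Fin k → V × ℕ), Function.Injective en ∧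
      ∀ t' : CodedEdge (Σ a b : V, (a ⟶ b)) N, t'.1 ∈ D.2 →
        ∃ i, en i = (splitting t s hs).eO t' := by
    let L : List (V × ℕ) := (D.2.flatMap fun q =>
      [(splitting t s hs).eO (q, true), (splitting t s hs).eO (q, false)]).dedup
    refine ⟨L.length, fun i => L[i], fun i j h => Fin.ext
      (((List.nodup_dedup _).getElem_inj_iff).1 h), ?_⟩
    rintro ⟨q, b⟩ hq
    have h1 : (splitting t s hs).eO (q, b) ∈ L := by
      refine List.mem_dedup.2 (List.mem_flatMap.2 ⟨q, hq, ?_⟩)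
      cases b <;> simp
    obtain ⟨i, hi, h⟩ := List.getElem_of_mem h1
    exact ⟨⟨i, hi⟩, h⟩
  have hP := hread (codeGraph t s hs D en) isFinitelyDescribed_codeGraph
    (isFolded_codeGraph hD hN hen)
  have harrow : ∀ t' : CodedEdge (Σ a b : V, (a ⟶ b)) N, t'.1 ∈ D.2 →
      ∀ a b : (splitting t s hs).CodeVertex D en, (splitting t s hs).eO t' = en a.idx →
        (splitting t s hs).eT t' = en b.idx → ∃ f : a ⟶ b, codedEdge f = t' :=
    fun t' ht a b h1 h2 => Splitting.exists_arrow ht h1 h2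
  refine ⟨?_, ?_⟩
  · intro t' ht hinf
    obtain ⟨i, hi⟩ := hO t' ht
    obtain ⟨j, hj⟩ := hO (Splitting.bar t') ht
    rw [Splitting.eO_bar] at hj
    obtain ⟨f, rfl⟩ := harrow t' ht ⟨i⟩ ⟨j⟩ hi.symm hj.symm
    have h1 : Infinite ((codeGraph t s hs D en).edgeGroup f) := by
      rw [← not_finite_iff_infinite, finite_edgeGroup_iff f hD, not_finite_iff_infinite]
      exact hinf
    have h2 := (hP.finiteIndex f h1).index_ne_zero
    have h3 : (splitting t s hs).edge ((splitting t s hs).eE (codedEdge f)) =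
        (⊤ : Subgroup (A.EG ((codeGraph t s hs D en).type.map f))).map
          ((ι t _).comp (A.α ((codeGraph t s hs D en).type.map f))) := by
      rw [eE_codedEdge, ← Subgroup.map_map, ← MonoidHom.range_eq_map]
      rfl
    rw [h3, edgeStab_codedEdge f hD, Subgroup.relIndex_map_map_of_injective _ _
      (ι_comp_α_injective _), Subgroup.relIndex_top_right]
    exact h2
  · intro m _ f hf hlink hfin
    choose p hp using fun i => hO (f i) (hf i)
    have hex : ∀ i, ∃ F : (⟨p i⟩ : (splitting t s hs).CodeVertex D en) ⟶
        (⟨p (i + 1)⟩ : (splitting t s hs).CodeVertex D en), codedEdge F = f i := fun i =>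
      harrow (f i) (hf i) _ _ (hp i).symm (by rw [hlink, hp])
    choose F hF using hex
    obtain ⟨i, hi1, hi2⟩ := hP.doubleCoset m (fun i => ⟨p i⟩) F fun i => by
      rw [finite_edgeGroup_iff (F i) hD, hF]
      exact hfin i
    refine ⟨i, fun g hg hgood => ?_⟩
    rw [← hF i, ← hF (i + 1)] at hgood ⊢
    have hfin1 := hfin i
    have hfin2 := hfin (i + 1)
    rw [← hF, ← finite_edgeGroup_iff _ hD] at hfin1 hfin2
    rw [← hF, eT_codedEdge] at hg
    obtain ⟨g, rfl⟩ := hg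
    exact finite_of_doubleCoset hD (F i) (F (i + 1)) hfin1 hfin2 hi1 hi2 hgood

end CodeGraph

end GraphOfGroups

/-! ### Effective splittings -/

section Words

variable {α : Type*} [Primcodable α] {n : ℕ}

/-- The words of a list, conjugated by the word `c`. -/
def GroupWord.conjList (c : GroupWord n) (X : List (GroupWord n)) : List (GroupWord n) :=
  X.map fun w => c ++ w ++ c.inv

theorem Computable.conjList {f : α → GroupWord n} {g : α → List (GroupWord n)} (hf : Computable f)
    (hg : Computable g) : Computable fun a => GroupWord.conjList (f a) (g a) := by
  have h : Primrec fun q : GroupWord n × List (GroupWord n) => GroupWord.conjList q.1 q.2 := by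
    refine Primrec.list_map Primrec.snd ?_
    exact Primrec.to₂ <| Primrec.list_append.comp
      (Primrec.list_append.comp (Primrec.fst.comp Primrec.fst)
      Primrec.snd) (GroupWord.primrec_inv.comp (Primrec.fst.comp Primrec.fst))
  exact h.to_comp.comp (hf.pair hg)

theorem GroupWord.mem_span_conjList {G : Type*} [Group G] (s : Fin n → G) (c : GroupWord n)
    (X : List (GroupWord n)) (g : G) : g ∈ GroupWord.span s (GroupWord.conjList c X) ↔
      (GroupWord.eval s c)⁻¹ * g * GroupWord.eval s c ∈ GroupWord.span s X := by
  have h : GroupWord.span s (GroupWord.conjList c X) =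
      (GroupWord.span s X).map (MulAut.conj (GroupWord.eval s c)).toMonoidHom := by
    rw [GroupWord.span, GroupWord.span, MonoidHom.map_closure]
    congr 1
    ext g
    simp [GroupWord.conjList, mul_assoc]
  rw [h]
  constructor
  · rintro ⟨y, hy, rfl⟩
    simpa [mul_assoc] using hy
  · intro h
    exact ⟨_, h, by simp [mul_assoc]⟩

theorem GroupWord.mem_span_nil {G : Type*} [Group G] (s : Fin n → G) (g : G) :
    g ∈ GroupWord.span s [] ↔ g = 1 := by
  simp [GroupWord.span, Subgroup.mem_bot]

attribute [fun_prop] Computable.conjList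

end Words

namespace Splitting

variable {V E G : Type*} [Group G] {N : ℕ} {S : Splitting V E G N}

/-- The algorithms in the vertex groups and for the edge groups of a splitting. Elements of the
vertex groups are given by words in their generators. -/
structure Effective (S : Splitting V E G N) : Prop where
  membership : ∀ v, ComputablePred fun i : GroupWord N × List (GroupWord N) =>
    S.ev v i.1 ∈ GroupWord.span (S.gen v) i.2
  powerCoset : ∀ v, ComputablePred fun i : GroupWord N × GroupWord N × List (GroupWord N) =>
    ∃ m : ℤ, m ≠ 0 ∧ ∃ h ∈ GroupWord.span (S.gen v) i.2.2, S.ev v i.2.1 ^ m = S.ev v i.1 * h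
  meets : ∀ e, ComputablePred fun i : GroupWord N × List (GroupWord N) =>
    ∃ z ∈ S.edge e, S.ev (S.src e) i.1 * z ∈ GroupWord.span (S.gen (S.src e)) i.2
  inter : ∀ e, ∃ F : List (GroupWord N) → List (GroupWord N), Computable F ∧
    ∀ X, GroupWord.span (S.gen (S.src e)) (F X) = GroupWord.span (S.gen (S.src e)) X ⊓ S.edge e
  transport : ∀ e, REPred fun i : GroupWord N × GroupWord N => S.ev (S.src e) i.1 ∈ S.edge e ∧
    (S.τ e)⁻¹ * S.ev (S.src e) i.1 * S.τ e = S.ev (S.tgt e) i.2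

set_option linter.unusedSectionVars false

variable [Primcodable V] [Primcodable E] [Finite V] [Finite E] {α : Type*} [Primcodable α]

section Computable

variable (S)

theorem computable_src {f : α → E} (hf : Computable f) : Computable fun a => S.src (f a) :=
  (Primrec.dom_finite S.src).to_comp.comp hf

theorem computable_tgt {f : α → E} (hf : Computable f) : Computable fun a => S.tgt (f a) :=
  (Primrec.dom_finite S.tgt).to_comp.comp hf

theorem computable_rev {f : α → E} (hf : Computable f) : Computable fun a => S.rev (f a) :=
  (Primrec.dom_finite S.rev).to_comp.comp hf

attribute [fun_prop] computable_src computable_tgt computable_rev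

theorem computable_eE {f : α → CodedEdge E N} (hf : Computable f) :
    Computable fun a => S.eE (f a) := by
  unfold eE
  fun_prop

theorem computable_eα {f : α → CodedEdge E N} (hf : Computable f) :
    Computable fun a => eα (f a) := by
  unfold eα
  fun_prop

theorem computable_eω {f : α → CodedEdge E N} (hf : Computable f) :
    Computable fun a => eω (f a) := by
  unfold eω
  fun_prop

attribute [fun_prop] computable_eE computable_eα computable_eω

theorem computable_eO {f : α → CodedEdge E N} (hf : Computable f) :
    Computable fun a => S.eO (f a) := by
  unfold eO
  fun_prop

theorem computable_eT {f : α → CodedEdge E N} (hf : Computable f) :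
    Computable fun a => S.eT (f a) := by
  unfold eT
  fun_prop

attribute [fun_prop] computable_eO computable_eT

theorem computable_gens {f : α → GraphCode V E N} {g : α → V × ℕ} (hf : Computable f)
    (hg : Computable g) : Computable fun a => gens (f a) (g a) := by
  classical
  have h : Primrec fun q : GraphCode V E N × (V × ℕ) =>
      q.1.1.flatMap fun p => if p.1 = q.2 then [p.2] else [] := by
    refine Primrec.list_flatMap (Primrec.fst.comp Primrec.fst) ?_
    exact Primrec.to₂ <| Primrec.ite (PrimrecRel.comp Primrec.eq (Primrec.fst.comp Primrec.snd)
      (Primrec.snd.comp Primrec.fst))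
      (Primrec.list_cons.comp (Primrec.snd.comp Primrec.snd) (Primrec.const []))
      (Primrec.const [])
  refine (h.to_comp.comp (hf.pair hg)).of_eq fun a => ?_
  rw [gens]
  dsimp only
  induction (f a).1 with
  | nil => rfl
  | cons p l ih =>
    rw [List.flatMap_cons, ih, List.filterMap_cons]
    split_ifs <;> rfl

attribute [fun_prop] computable_gens

end Computable

/-- The state that is given by a vertex and a word. -/
def st (S : Splitting V E G N) (y : (V × ℕ) × GroupWord N) : (V × ℕ) × G := (y.1, S.ev y.1.1 y.2)

/-- The path that is given by a list of edges and words. -/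
def dp (S : Splitting V E G N) (l : List (E × GroupWord N)) : List (E × G) :=
  l.map fun p => (p.1, S.ev (S.tgt p.1) p.2)

namespace Effective

theorem re_mem (hE : S.Effective) : REPred fun q : V × GroupWord N × List (GroupWord N) =>
    S.ev q.1 q.2.1 ∈ GroupWord.span (S.gen q.1) q.2.2 :=
  REPred.of_finite fun v => (hE.membership v).to_re

theorem re_not_mem (hE : S.Effective) : REPred fun q : V × GroupWord N × List (GroupWord N) =>
    S.ev q.1 q.2.1 ∉ GroupWord.span (S.gen q.1) q.2.2 :=
  REPred.of_finite (p := fun v (i : GroupWord N × List (GroupWord N)) =>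
    S.ev v i.1 ∉ GroupWord.span (S.gen v) i.2) fun v => (hE.membership v).not.to_re

theorem re_transport (hE : S.Effective) : REPred fun q : E × GroupWord N × GroupWord N =>
    S.ev (S.src q.1) q.2.1 ∈ S.edge q.1 ∧
      (S.τ q.1)⁻¹ * S.ev (S.src q.1) q.2.1 * S.τ q.1 = S.ev (S.tgt q.1) q.2.2 :=
  REPred.of_finite hE.transport

theorem re_mem_B (hE : S.Effective) : REPred fun q : GraphCode V E N × (V × ℕ) × GroupWord N =>
    S.ev q.2.1.1 q.2.2 ∈ S.B q.1 q.2.1 :=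
  hE.re_mem.comp (f := fun q : GraphCode V E N × (V × ℕ) × GroupWord N =>
    (q.2.1.1, q.2.2, gens q.1 q.2.1)) (by fun_prop)

theorem re_not_mem_B (hE : S.Effective) : REPred fun q : GraphCode V E N × (V × ℕ) × GroupWord N =>
    S.ev q.2.1.1 q.2.2 ∉ S.B q.1 q.2.1 :=
  hE.re_not_mem.comp (f := fun q : GraphCode V E N × (V × ℕ) × GroupWord N =>
    (q.2.1.1, q.2.2, gens q.1 q.2.1)) (by fun_prop)

theorem re_same (hE : S.Effective) : REPred fun q : GraphCode V E N × ((V × ℕ) × GroupWord N) ×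
    ((V × ℕ) × GroupWord N) => S.Same q.1 (S.st q.2.1) (S.st q.2.2) := by
  have h := (REPred.eq (f := fun q : GraphCode V E N × ((V × ℕ) × GroupWord N) ×
    ((V × ℕ) × GroupWord N) => q.2.1.1) (g := fun q => q.2.2.1) (by fun_prop) (by fun_prop)).and
    (hE.re_mem_B.comp (f := fun q : GraphCode V E N × ((V × ℕ) × GroupWord N) ×
    ((V × ℕ) × GroupWord N) => (q.1, q.2.1.1, q.2.1.2 ++ q.2.2.2.inv)) (by fun_prop))
  refine h.of_eq fun q => ?_
  refine and_congr_right fun h1 => ?_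
  simp only [st, ev_append, ev_inv, h1]

theorem re_not_same (hE : S.Effective) : REPred fun q : GraphCode V E N × ((V × ℕ) × GroupWord N) ×
    ((V × ℕ) × GroupWord N) => ¬ S.Same q.1 (S.st q.2.1) (S.st q.2.2) := by
  have h := (REPred.ne (f := fun q : GraphCode V E N × ((V × ℕ) × GroupWord N) ×
    ((V × ℕ) × GroupWord N) => q.2.1.1) (g := fun q => q.2.2.1) (by fun_prop) (by fun_prop)).or
    (hE.re_not_mem_B.comp (f := fun q : GraphCode V E N × ((V × ℕ) × GroupWord N) ×
    ((V × ℕ) × GroupWord N) => (q.1, q.2.1.1, q.2.1.2 ++ q.2.2.2.inv)) (by fun_prop))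
  refine h.of_eq fun q => ?_
  rw [Same, not_and_or]
  refine or_congr_right' fun h1 => not_congr ?_
  have h2 := not_not.1 h1
  simp only [st, ev_append, ev_inv, h2]

/-- Whether an edge can be read from a state is a question about the intersection of a conjugate of
a vertex group with a coset of an edge group. -/
theorem exists_meets_iff {D : GraphCode V E N} {t : CodedEdge E N} {w : GroupWord N} :
    (∃ z, S.Meets D t (S.ev (S.src (S.eE t)) w) z) ↔ ∃ z ∈ S.edge (S.eE t),
      S.ev (S.src (S.eE t)) ((eα t).inv ++ w) * z ∈ GroupWord.span (S.gen (S.src (S.eE t)))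
        (GroupWord.conjList (eα t).inv (gens D (S.eO t))) := by
  have key : ∀ z, S.ev (S.src (S.eE t)) w * z * (S.α t)⁻¹ ∈ S.B D (S.eO t) ↔
      S.ev (S.src (S.eE t)) ((eα t).inv ++ w) * z ∈ GroupWord.span (S.gen (S.src (S.eE t)))
        (GroupWord.conjList (eα t).inv (gens D (S.eO t))) := by
    intro z
    rw [GroupWord.mem_span_conjList]
    refine iff_of_eq (congrArg (· ∈ S.B D (S.eO t)) ?_)
    change _ = (S.ev (S.src (S.eE t)) (eα t).inv)⁻¹ * _ * S.ev (S.src (S.eE t)) (eα t).inv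
    simp only [ev_append, ev_inv, α]
    group
  constructor
  · rintro ⟨z, hz, h⟩
    exact ⟨z⁻¹, inv_mem hz, (key _).1 h⟩
  · rintro ⟨z, hz, h⟩
    exact ⟨z⁻¹, inv_mem hz, by rw [inv_inv]; exact (key _).2 h⟩

theorem re_not_meets (hE : S.Effective) :
    REPred fun q : GraphCode V E N × CodedEdge E N × GroupWord N =>
    ¬ ∃ z, S.Meets q.1 q.2.1 (S.ev (S.src (S.eE q.2.1)) q.2.2) z := by
  have h : REPred fun q : E × GroupWord N × List (GroupWord N) => ¬ ∃ z ∈ S.edge q.1,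
      S.ev (S.src q.1) q.2.1 * z ∈ GroupWord.span (S.gen (S.src q.1)) q.2.2 :=
    REPred.of_finite (p := fun e (i : GroupWord N × List (GroupWord N)) => ¬ ∃ z ∈ S.edge e,
      S.ev (S.src e) i.1 * z ∈ GroupWord.span (S.gen (S.src e)) i.2)
      fun e => (hE.meets e).not.to_re
  refine (h.comp (f := fun q : GraphCode V E N × CodedEdge E N × GroupWord N => (S.eE q.2.1,
    (eα q.2.1).inv ++ q.2.2, GroupWord.conjList (eα q.2.1).inv (gens q.1 (S.eO q.2.1))))
    (by fun_prop)).of_eq fun q => not_congr exists_meets_iff.symm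

theorem re_not_mem_edge (hE : S.Effective) :
    REPred fun q : E × GroupWord N => S.ev (S.src q.1) q.2 ∉ S.edge q.1 := by
  refine REPred.of_finite (p := fun e (w : GroupWord N) => S.ev (S.src e) w ∉ S.edge e) fun e => ?_
  refine ((hE.meets e).not.to_re.comp (f := fun w : GroupWord N => (w, [])) (by fun_prop)).of_eq
    fun w => not_congr ?_
  simp only [GroupWord.mem_span_nil]
  constructor
  · rintro ⟨z, hz, h⟩
    rw [eq_inv_of_mul_eq_one_left h]
    exact inv_mem hz
  · intro h
    exact ⟨_, inv_mem h, mul_inv_cancel _⟩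

/-- The edge groups being Noetherian, that the conjugate by an edge of a subgroup of its edge group
is contained in another subgroup can be confirmed on generators. -/
theorem re_conj_le (hE : S.Effective) :
    REPred fun q : E × List (GroupWord N) × List (GroupWord N) =>
    ∀ z ∈ GroupWord.span (S.gen (S.src q.1)) q.2.1 ⊓ S.edge q.1,
      (S.τ q.1)⁻¹ * z * S.τ q.1 ∈ GroupWord.span (S.gen (S.tgt q.1)) q.2.2 := by
  refine REPred.of_finite (p := fun e (i : List (GroupWord N) × List (GroupWord N)) =>
    ∀ z ∈ GroupWord.span (S.gen (S.src e)) i.1 ⊓ S.edge e,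
      (S.τ e)⁻¹ * z * S.τ e ∈ GroupWord.span (S.gen (S.tgt e)) i.2) fun e => ?_
  obtain ⟨F, hF, h⟩ := hE.inter e
  have h1 : REPred fun q : (List (GroupWord N) × List (GroupWord N)) × GroupWord N =>
      ∃ w', (S.ev (S.src e) q.2 ∈ S.edge e ∧
        (S.τ e)⁻¹ * S.ev (S.src e) q.2 * S.τ e = S.ev (S.tgt e) w') ∧
        S.ev (S.tgt e) w' ∈ GroupWord.span (S.gen (S.tgt e)) q.1.2 :=
    REPred.ex (p := fun (q : (List (GroupWord N) × List (GroupWord N)) × GroupWord N) w' =>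
      (S.ev (S.src e) q.2 ∈ S.edge e ∧
        (S.τ e)⁻¹ * S.ev (S.src e) q.2 * S.τ e = S.ev (S.tgt e) w') ∧
        S.ev (S.tgt e) w' ∈ GroupWord.span (S.gen (S.tgt e)) q.1.2)
      (((hE.transport e).comp (f := fun q : ((List (GroupWord N) × List (GroupWord N)) ×
        GroupWord N) × GroupWord N => (q.1.2, q.2)) (by fun_prop)).and
      ((hE.membership (S.tgt e)).to_re.comp (f := fun q : ((List (GroupWord N) ×
        List (GroupWord N)) × GroupWord N) × GroupWord N => (q.2, q.1.1.2)) (by fun_prop)))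
  refine (REPred.forall_mem (p := fun (q : List (GroupWord N) × List (GroupWord N)) w =>
    ∃ w', (S.ev (S.src e) w ∈ S.edge e ∧
        (S.τ e)⁻¹ * S.ev (S.src e) w * S.τ e = S.ev (S.tgt e) w') ∧
        S.ev (S.tgt e) w' ∈ GroupWord.span (S.gen (S.tgt e)) q.2) h1
        (l := fun q => F q.1) (hF.comp (by fun_prop))).of_eq fun q => ?_
  constructor
  · intro hq
    rw [← h]
    have h2 : GroupWord.span (S.gen (S.src e)) (F q.1) ≤
        (GroupWord.span (S.gen (S.tgt e)) q.2).comap (MulAut.conj (S.τ e)⁻¹).toMonoidHom := by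
      rw [GroupWord.span_le]
      intro w hw
      obtain ⟨w', ⟨-, h3⟩, h4⟩ := hq w hw
      rw [← h3] at h4
      rw [Subgroup.mem_comap]
      simpa [ev] using h4
    intro z hz
    simpa using h2 hz
  · intro hq w hw
    have h2 : S.ev (S.src e) w ∈ GroupWord.span (S.gen (S.src e)) q.1 ⊓ S.edge e := by
      rw [← h]
      exact GroupWord.eval_mem_span _ hw
    have h3 : (S.τ e)⁻¹ * S.ev (S.src e) w * S.τ e ∈ S.vert (S.tgt e) := by
      rw [← S.src_rev]
      exact S.edge_le _ (S.conj_mem _ _ h2.2)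
    obtain ⟨w', hw'⟩ := S.exists_ev h3
    exact ⟨w', ⟨h2.2, hw'.symm⟩, by rw [hw']; exact hq _ h2⟩

theorem re_folded (hE : S.Effective) : REPred fun D : GraphCode V E N => S.Folded D := by
  have hedges : ∀ {P : GraphCode V E N → CodedEdge E N → Prop},
      (REPred fun q : GraphCode V E N × CodedEdge E N => P q.1 q.2) →
      REPred fun D => ∀ t : CodedEdge E N, t.1 ∈ D.2 → P D t := by
    intro P hP
    refine (REPred.forall_mem (p := fun (D : GraphCode V E N) f => ∀ b : Bool, P D (f, b))
      (REPred.forall_bool (p := fun (q : GraphCode V E N × _) b => P q.1 (q.2, b))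
      (hP.comp (f := fun q : (GraphCode V E N × _) × Bool => (q.1.1, q.1.2, q.2)) (by fun_prop)))
      (l := fun D => D.2) (by fun_prop)).of_eq fun D => ?_
    exact ⟨fun h t ht => h t.1 ht t.2, fun h f hf b => h (f, b) hf⟩
  have hedges' : ∀ {P : GraphCode V E N → CodedEdge E N → CodedEdge E N → Prop},
      (REPred fun q : GraphCode V E N × CodedEdge E N × CodedEdge E N => P q.1 q.2.1 q.2.2) →
      REPred fun D => ∀ t t' : CodedEdge E N, t.1 ∈ D.2 → t'.1 ∈ D.2 → P D t t' := by
    intro P hP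
    refine (hedges (P := fun D t => ∀ f ∈ D.2, ∀ b : Bool, P D t (f, b))
      (REPred.forall_mem (p := fun (q : GraphCode V E N × CodedEdge E N) f =>
        ∀ b : Bool, P q.1 q.2 (f, b))
      (REPred.forall_bool (p := fun (q : (GraphCode V E N × CodedEdge E N) × _) b =>
        P q.1.1 q.1.2 (q.2, b))
      (hP.comp (f := fun q : ((GraphCode V E N × CodedEdge E N) × _) × Bool =>
        (q.1.1.1, q.1.1.2, q.1.2, q.2)) (by fun_prop)))
      (l := fun q => q.1.2) (by fun_prop))).of_eq fun D => ?_
    exact ⟨fun h t t' ht ht' => h t ht t'.1 ht' t'.2, fun h t ht f hf b => h t (f, b) ht hf⟩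
  have h1 := hedges' (P := fun D t t' => t = t' ∨ S.eO t ≠ S.eO t' ∨ S.eE t ≠ S.eE t' ∨
      ¬ ∃ z, S.Meets D t' (S.ev (S.src (S.eE t')) (eα t)) z)
    ((REPred.eq (by fun_prop) (by fun_prop)).or ((REPred.ne (by fun_prop) (by fun_prop)).or
      ((REPred.ne (by fun_prop) (by fun_prop)).or
      (hE.re_not_meets.comp (f := fun q : GraphCode V E N × CodedEdge E N × CodedEdge E N =>
        (q.1, q.2.2, eα q.2.1)) (by fun_prop)))))
  have h2 := hedges (P := fun D t => ∀ z ∈ GroupWord.span (S.gen (S.src (S.eE t)))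
      (GroupWord.conjList (eα t).inv (gens D (S.eO t))) ⊓ S.edge (S.eE t),
        (S.τ (S.eE t))⁻¹ * z * S.τ (S.eE t) ∈ GroupWord.span (S.gen (S.tgt (S.eE t)))
          (GroupWord.conjList (eω t) (gens D (S.eT t))))
    (hE.re_conj_le.comp (f := fun q : GraphCode V E N × CodedEdge E N => (S.eE q.2,
      GroupWord.conjList (eα q.2).inv (gens q.1 (S.eO q.2)),
      GroupWord.conjList (eω q.2) (gens q.1 (S.eT q.2)))) (by fun_prop))
  refine (h1.and h2).of_eq fun D => ?_
  have key : ∀ t : CodedEdge E N, (∀ z ∈ GroupWord.span (S.gen (S.src (S.eE t)))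
      (GroupWord.conjList (eα t).inv (gens D (S.eO t))) ⊓ S.edge (S.eE t),
        (S.τ (S.eE t))⁻¹ * z * S.τ (S.eE t) ∈ GroupWord.span (S.gen (S.tgt (S.eE t)))
          (GroupWord.conjList (eω t) (gens D (S.eT t)))) ↔
      ∀ z ∈ S.edge (S.eE t), S.α t * z * (S.α t)⁻¹ ∈ S.B D (S.eO t) →
        (S.ω t)⁻¹ * ((S.τ (S.eE t))⁻¹ * z * S.τ (S.eE t)) * S.ω t ∈ S.B D (S.eT t) := by
    intro t
    have h3 : S.α t = (GroupWord.eval (S.gen (S.src (S.eE t))) (eα t).inv)⁻¹ := by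
      rw [GroupWord.eval_inv, inv_inv]
      rfl
    simp only [Subgroup.mem_inf, GroupWord.mem_span_conjList, ← h3]
    constructor
    · intro h z hz hz'
      refine h z ⟨?_, hz⟩
      rw [h3, inv_inv] at hz'
      rw [h3]
      exact hz'
    · rintro h z ⟨hz, hz'⟩
      refine h z hz' ?_
      rw [h3] at hz ⊢
      rw [inv_inv]
      exact hz
  constructor
  · rintro ⟨h3, h4⟩
    refine ⟨fun t t' ht ht' hne hO hE z hz => ?_, fun t ht => (key t).1 (h4 t ht)⟩
    rcases h3 t t' ht ht' with h | h | h | h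
    · exact hne h
    · exact h hO
    · exact h hE
    · exact h ⟨z, by rw [← hE]; exact hz⟩
  · rintro ⟨h3, h4⟩
    refine ⟨fun t t' ht ht' => ?_, fun t ht => (key t).2 (h4 t ht)⟩
    by_contra hc
    push Not at hc
    obtain ⟨hne, hO, hE, z, hz⟩ := hc
    refine h3 t t' ht ht' hne hO hE z ?_
    rw [← hE] at hz
    exact hz

end Effective

end Splitting

/-! ### Effective reading of paths -/

namespace Splitting

variable {V E G : Type*} [Group G] {N : ℕ} {S : Splitting V E G N}

/-- A state of the reading process, given by a vertex of a coded graph and a word. -/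
abbrev CodedState (V : Type*) (N : ℕ) : Type _ := (V × ℕ) × GroupWord N

/-- A path without its first vertex group element, given by edges and words. -/
abbrev CodedPath (E : Type*) (N : ℕ) : Type _ := List (E × GroupWord N)

/-- One letter of a coded path is read, by an edge of the coded graph and two words for the element
of the edge group that is carried over. -/
def RdStep (S : Splitting V E G N) (D : GraphCode V E N)
    (x y : CodedState V N × CodedPath E N) : Prop :=
  ∃ (t : CodedEdge E N) (g w w' : GroupWord N), t.1 ∈ D.2 ∧ S.eO t = x.1.1 ∧
    x.2 = (S.eE t, g) :: y.2 ∧ y.1 = (S.eT t, (eω t).inv ++ w' ++ g) ∧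
    (S.ev (S.src (S.eE t)) w ∈ S.edge (S.eE t) ∧
      (S.τ (S.eE t))⁻¹ * S.ev (S.src (S.eE t)) w * S.τ (S.eE t) = S.ev (S.tgt (S.eE t)) w') ∧
    S.ev (S.eO t).1 (x.1.2 ++ w.inv ++ (eα t).inv) ∈ S.B D (S.eO t)

theorem rd_of_rdStep {D : GraphCode V E N} {y z : CodedState V N}
    {l : CodedPath E N} (h : Relation.ReflTransGen (S.RdStep D) (y, l) (z, [])) :
    S.Rd D (S.st y) (S.dp l) (S.st z) := by
  generalize hx : (y, l) = x at h
  induction h using Relation.ReflTransGen.head_induction_on generalizing y l with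
  | refl =>
    obtain ⟨rfl, rfl⟩ := Prod.mk.inj hx
    exact Same.refl _
  | @head x x' h _ ih =>
    subst hx
    obtain ⟨t, g, w, w', ht, hO, h1, h2, ⟨h3, h4⟩, h5⟩ := h
    obtain ⟨u, a⟩ := y
    obtain ⟨y', l'⟩ := x'
    dsimp only at hO h1 h2 h5
    subst hO h1 h2
    refine ⟨t, ht, rfl, rfl, S.ev (S.src (S.eE t)) w, ⟨h3, ?_⟩, ?_⟩
    · rw [ev_append, ev_append, ev_inv, ev_inv] at h5
      exact h5
    · have h6 := ih rfl
      have h7 : S.nxt t (S.ev (S.src (S.eE t)) w) (S.ev (S.tgt (S.eE t)) g) =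
          S.st (S.eT t, (eω t).inv ++ w' ++ g) := by
        simp only [nxt, st, ev_append, ev_inv, h4]
        rfl
      dsimp only
      rw [h7]
      exact h6

theorem Rd.exists_rdStep {D : GraphCode V E N} {y : CodedState V N} {z : (V × ℕ) × G}
    {l : CodedPath E N} (h : S.Rd D (S.st y) (S.dp l) z) :
    ∃ y', Relation.ReflTransGen (S.RdStep D) (y, l) (y', []) ∧ S.Same D (S.st y') z := by
  induction l generalizing y with
  | nil => exact ⟨y, Relation.ReflTransGen.refl, h⟩
  | cons p l ih =>
    obtain ⟨e, g⟩ := p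
    obtain ⟨t, ht, hO, hE, x, ⟨hx1, hx2⟩, h⟩ := h
    dsimp only at hE h
    subst hE
    obtain ⟨u, a⟩ := y
    obtain rfl : S.eO t = u := hO
    obtain ⟨w, rfl⟩ := S.exists_ev (S.edge_le _ hx1)
    have h3 :
        (S.τ (S.eE t))⁻¹ * S.ev (S.src (S.eE t)) w * S.τ (S.eE t) ∈ S.vert (S.tgt (S.eE t)) := by
      rw [← S.src_rev]
      exact S.edge_le _ (S.conj_mem _ _ hx1)
    obtain ⟨w', hw'⟩ := S.exists_ev h3
    have h7 : S.nxt t (S.ev (S.src (S.eE t)) w) (S.ev (S.tgt (S.eE t)) g) =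
        S.st (S.eT t, (eω t).inv ++ w' ++ g) := by
      simp only [nxt, st, ev_append, ev_inv, ← hw']
      rfl
    rw [h7] at h
    obtain ⟨y', hy', hs⟩ := ih h
    refine ⟨y', Relation.ReflTransGen.head ?_ hy', hs⟩
    refine ⟨t, g, w, w', ht, rfl, rfl, rfl, ⟨hx1, hw'.symm⟩, ?_⟩
    rw [ev_append, ev_append, ev_inv, ev_inv]
    exact hx2

set_option linter.unusedSectionVars false

variable [Primcodable V] [Primcodable E] [Finite V] [Finite E] {α : Type*} [Primcodable α]

theorem re_isPath : REPred fun q : V × CodedPath E N × V =>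
    S.IsPath q.1 (S.dp q.2.1) q.2.2 := by
  let R : Unit → V × CodedPath E N → V × CodedPath E N → Prop := fun _ x y =>
    ∃ p, x.2 = p :: y.2 ∧ S.src p.1 = x.1 ∧ y.1 = S.tgt p.1
  have hR : REPred fun q : Unit × (V × CodedPath E N) × V × CodedPath E N =>
      R q.1 q.2.1 q.2.2 :=
    REPred.ex (p := fun (q : Unit × (V × CodedPath E N) × V × CodedPath E N) p =>
      q.2.1.2 = p :: q.2.2.2 ∧ S.src p.1 = q.2.1.1 ∧ q.2.2.1 = S.tgt p.1)
      ((REPred.eq (by fun_prop) (by fun_prop)).and ((REPred.eq (by fun_prop) (by fun_prop)).and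
        (REPred.eq (by fun_prop) (by fun_prop))))
  refine ((REPred.reflTransGen hR).comp (f := fun q : V × CodedPath E N × V =>
    ((), (q.1, q.2.1), q.2.2, [])) (by fun_prop)).of_eq fun q => ?_
  obtain ⟨a, l, b⟩ := q
  dsimp only
  constructor
  · intro h
    generalize hx : (a, l) = x at h
    induction h using Relation.ReflTransGen.head_induction_on generalizing a l with
    | refl =>
      obtain ⟨rfl, rfl⟩ := Prod.mk.inj hx
      rfl
    | head h _ ih =>
      subst hx
      obtain ⟨p, h1, h2, h3⟩ := h
      dsimp only at h1
      subst h1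
      have := ih _ _ rfl
      rw [h3] at this
      exact ⟨h2, S.ev_mem _ _, this⟩
  · intro h
    induction l generalizing a with
    | nil =>
      obtain rfl : a = b := h
      exact Relation.ReflTransGen.refl
    | cons p l ih =>
      exact Relation.ReflTransGen.head (b := (S.tgt p.1, l)) ⟨p, rfl, h.1, rfl⟩ (ih _ h.2.2)

namespace Effective

theorem re_reduced (hE : S.Effective) : REPred fun l : CodedPath E N =>
    S.Reduced (S.dp l) := by
  let Q : E × GroupWord N → E × GroupWord N → Prop := fun p q =>
    q.1 ≠ S.rev p.1 ∨ S.ev (S.src q.1) p.2 ∉ S.edge q.1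
  have hQ : ∀ p q, Q p q ↔ S.Good (p.1, S.ev (S.tgt p.1) p.2) (q.1, S.ev (S.tgt q.1) q.2) := by
    intro p q
    rw [Good, not_and_or]
    refine or_congr_right' fun h => ?_
    rw [not_not.1 h, S.src_rev]
  let R : Unit → CodedPath E N → CodedPath E N → Prop := fun _ x y =>
    ∃ p q l, x = p :: q :: l ∧ y = q :: l ∧ Q p q
  have hR : REPred fun q : Unit × CodedPath E N × CodedPath E N =>
      R q.1 q.2.1 q.2.2 := by
    refine REPred.ex (p := fun (q : Unit × CodedPath E N × CodedPath E N) p =>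
      ∃ p' l, q.2.1 = p :: p' :: l ∧ q.2.2 = p' :: l ∧ Q p p') ?_
    refine REPred.ex (p := fun (q : (Unit × CodedPath E N × CodedPath E N) ×
      E × GroupWord N) p' => ∃ l, q.1.2.1 = q.2 :: p' :: l ∧ q.1.2.2 = p' :: l ∧ Q q.2 p') ?_
    refine REPred.ex (p := fun (q : ((Unit × CodedPath E N × CodedPath E N) ×
      E × GroupWord N) × E × GroupWord N) l => q.1.1.2.1 = q.1.2 :: q.2 :: l ∧
      q.1.1.2.2 = q.2 :: l ∧ Q q.1.2 q.2) ?_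
    exact (REPred.eq (by fun_prop) (by fun_prop)).and ((REPred.eq (by fun_prop) (by fun_prop)).and
      ((REPred.ne (by fun_prop) (by fun_prop)).or (hE.re_not_mem_edge.comp
        (f := fun q : (((Unit × CodedPath E N × CodedPath E N) ×
          E × GroupWord N) × E × GroupWord N) × CodedPath E N => (q.1.2.1, q.1.1.2.2))
        (by fun_prop))))
  have h0 : REPred fun l : CodedPath E N => ∃ p, Relation.ReflTransGen (R ()) l [p] :=
    REPred.ex (p := fun l p => Relation.ReflTransGen (R ()) l [p])
      ((REPred.reflTransGen hR).comp (f := fun q : CodedPath E N × E × GroupWord N =>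
        ((), q.1, [q.2])) (by fun_prop))
  refine ((REPred.eq (f := fun l : CodedPath E N => l) (g := fun _ => [])
    (by fun_prop) (by fun_prop)).or h0).of_eq fun l => ?_
  constructor
  · rintro (rfl | ⟨p, h⟩)
    · exact List.isChain_nil (R := S.Good)
    · induction h using Relation.ReflTransGen.head_induction_on with
      | refl => exact List.isChain_singleton _
      | head h _ ih =>
        obtain ⟨p, q, l, rfl, rfl, h1⟩ := h
        exact List.isChain_cons_cons.2 ⟨(hQ _ _).1 h1, ih⟩
  · intro h
    cases l with
    | nil => exact Or.inl rfl
    | cons p l =>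
      right
      induction l generalizing p with
      | nil => exact ⟨p, Relation.ReflTransGen.refl⟩
      | cons q l ih =>
        obtain ⟨h1, h2⟩ := List.isChain_cons_cons.1 h
        obtain ⟨r, hr⟩ := ih q h2
        exact ⟨r, Relation.ReflTransGen.head ⟨p, q, l, rfl, rfl, (hQ _ _).2 h1⟩ hr⟩

theorem re_cycRed (hE : S.Effective) : REPred fun q : V × CodedPath E N =>
    S.CycRed q.1 (S.dp q.2) := by
  refine (((re_isPath (S := S)).comp (f := fun q : V × CodedPath E N => (q.1, q.2, q.1))
    (by fun_prop)).and (hE.re_reduced.comp (f := fun q : V × CodedPath E N => q.2 ++ q.2)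
    (by fun_prop))).of_eq fun q => ?_
  simp [CycRed, dp]

theorem re_rdStep (hE : S.Effective) : REPred fun q : GraphCode V E N ×
    (CodedState V N × CodedPath E N) ×
    (CodedState V N × CodedPath E N) => S.RdStep q.1 q.2.1 q.2.2 := by
  refine (REPred.ex (p := fun (q : (GraphCode V E N × (CodedState V N × CodedPath E N) ×
      (CodedState V N × CodedPath E N))) (c : CodedEdge E N × GroupWord N × GroupWord N × GroupWord
      N) =>
    c.1.1 ∈ q.1.2 ∧ S.eO c.1 = q.2.1.1.1 ∧
    q.2.1.2 = (S.eE c.1, c.2.1) :: q.2.2.2 ∧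
    q.2.2.1 = (S.eT c.1, (eω c.1).inv ++ c.2.2.2 ++ c.2.1) ∧
    (S.ev (S.src (S.eE c.1)) c.2.2.1 ∈ S.edge (S.eE c.1) ∧
      (S.τ (S.eE c.1))⁻¹ * S.ev (S.src (S.eE c.1)) c.2.2.1 * S.τ (S.eE c.1) =
        S.ev (S.tgt (S.eE c.1)) c.2.2.2) ∧
    S.ev (S.eO c.1).1 (q.2.1.1.2 ++ c.2.2.1.inv ++ (eα c.1).inv) ∈ S.B q.1 (S.eO c.1)) ?_).of_eq
      fun q => ?_
  · exact (REPred.mem (by fun_prop) (by fun_prop)).and ((REPred.eq (by fun_prop) (by fun_prop)).and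
      ((REPred.eq (by fun_prop) (by fun_prop)).and ((REPred.eq (by fun_prop) (by fun_prop)).and
      ((hE.re_transport.comp (f := fun q : (GraphCode V E N × (CodedState V N × CodedPath E N) ×
          (CodedState V N × CodedPath E N)) × CodedEdge E N × GroupWord N × GroupWord N ×
        GroupWord N => (S.eE q.2.1, q.2.2.2.1, q.2.2.2.2)) (by fun_prop)).and
      (hE.re_mem_B.comp (f := fun q : (GraphCode V E N × (CodedState V N × CodedPath E N) ×
          (CodedState V N × CodedPath E N)) × CodedEdge E N × GroupWord N × GroupWord N ×
        GroupWord N => (q.1.1, S.eO q.2.1, q.1.2.1.1.2 ++ q.2.2.2.1.inv ++ (eα q.2.1).inv))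
        (by fun_prop))))))
  · constructor
    · rintro ⟨⟨t, g, w, w'⟩, h⟩
      exact ⟨t, g, w, w', h⟩
    · rintro ⟨t, g, w, w', h⟩
      exact ⟨⟨t, g, w, w'⟩, h⟩

theorem re_rd (hE : S.Effective) : REPred fun q : GraphCode V E N × CodedState V N ×
    CodedPath E N × CodedState V N =>
    S.Rd q.1 (S.st q.2.1) (S.dp q.2.2.1) (S.st q.2.2.2) := by
  refine (REPred.ex (p := fun (q : (GraphCode V E N × CodedState V N × CodedPath E N × CodedState V
      N)) (y : CodedState V N) =>
    Relation.ReflTransGen (S.RdStep q.1) (q.2.1, q.2.2.1) (y, []) ∧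
      S.Same q.1 (S.st y) (S.st q.2.2.2)) ?_).of_eq fun q => ?_
  · exact ((REPred.reflTransGen (R := fun D => S.RdStep D) hE.re_rdStep).comp
      (f := fun q : (GraphCode V E N × CodedState V N × CodedPath E N × CodedState V N) ×
          CodedState V N => (q.1.1, (q.1.2.1, q.1.2.2.1), (q.2, [])))
      (by fun_prop)).and (hE.re_same.comp (f := fun q : (GraphCode V E N × CodedState V N ×
          CodedPath E N × CodedState V N) × CodedState V N =>
      (q.1.1, q.2, q.1.2.2.2)) (by fun_prop))
  · constructor
    · rintro ⟨y, h1, h2⟩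
      exact (rd_of_rdStep h1).same_right h2
    · exact fun h => h.exists_rdStep

theorem re_stuck (hE : S.Effective) : REPred fun q : GraphCode V E N × CodedState V N ×
    E × GroupWord N => S.Stuck q.1 (S.st q.2.1) (q.2.2.1, S.ev (S.tgt q.2.2.1) q.2.2.2) := by
  let P : (GraphCode V E N × CodedState V N × E × GroupWord N) → CodedEdge E N → Prop := fun q t =>
      S.eO t ≠ q.2.1.1 ∨ S.eE t ≠ q.2.2.1 ∨
    ¬ ∃ z, S.Meets q.1 t (S.ev (S.src (S.eE t)) q.2.1.2) z
  have hP : REPred fun q : (GraphCode V E N × CodedState V N × E × GroupWord N) × CodedEdge E N =>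
      P q.1 q.2 :=
    (REPred.ne (by fun_prop) (by fun_prop)).or ((REPred.ne (by fun_prop) (by fun_prop)).or
      (hE.re_not_meets.comp (f := fun q : (GraphCode V E N × CodedState V N × E × GroupWord N) ×
          CodedEdge E N => (q.1.1, q.2, q.1.2.1.2))
        (by fun_prop)))
  refine (REPred.forall_mem
    (p := fun (q : (GraphCode V E N × CodedState V N × E × GroupWord N)) f =>
      ∀ b : Bool, P q (f, b))
    (REPred.forall_bool
      (p := fun (q : (GraphCode V E N × CodedState V N × E × GroupWord N) × _) b =>
        P q.1 (q.2, b))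
    (hP.comp (f := fun q : ((GraphCode V E N × CodedState V N × E × GroupWord N) × _) × Bool =>
        (q.1.1, q.1.2, q.2)) (by fun_prop)))
    (l := fun q => q.1.2) (by fun_prop)).of_eq fun q => ?_
  have h1 : ∀ t, P q t ↔ (S.eO t = q.2.1.1 → S.eE t = q.2.2.1 →
      ∀ z, ¬ S.Meets q.1 t (S.ev q.2.1.1.1 q.2.1.2) z) := by
    intro t
    simp only [P, ← imp_iff_not_or, ne_eq, not_exists]
    refine forall_congr' fun hO => ?_
    rw [← hO]
    rfl
  constructor
  · intro h t ht
    exact (h1 t).1 (h t.1 ht t.2)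
  · intro h f hf b
    exact (h1 (f, b)).2 (h (f, b) hf)

theorem re_fails (hE : S.Effective) : REPred fun q : GraphCode V E N × CodedState V N ×
    CodedPath E N => S.Fails q.1 (S.st q.2.1) (S.dp q.2.2) := by
  refine (REPred.ex (p := fun (q : (GraphCode V E N × CodedState V N × CodedPath E N)) (c :
      (CodedPath E N × (E × GroupWord N) × CodedPath E N × CodedState V N)) =>
      q.2.2 = c.1 ++ c.2.1 :: c.2.2.1 ∧
    S.Rd q.1 (S.st q.2.1) (S.dp c.1) (S.st c.2.2.2) ∧
    S.Stuck q.1 (S.st c.2.2.2) (c.2.1.1, S.ev (S.tgt c.2.1.1) c.2.1.2)) ?_).of_eq fun q => ?_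
  · exact (REPred.eq (by fun_prop) (by fun_prop)).and ((hE.re_rd.comp
      (f := fun q : (GraphCode V E N × CodedState V N × CodedPath E N) × (CodedPath E N × (E ×
          GroupWord N) × CodedPath E N × CodedState V N) => (q.1.1, q.1.2.1, q.2.1,
          q.2.2.2.2)) (by fun_prop)).and
      (hE.re_stuck.comp (f := fun q : (GraphCode V E N × CodedState V N × CodedPath E N) ×
          (CodedPath E N × (E × GroupWord N) × CodedPath E N × CodedState V N) => (q.1.1, q.2.2.2.2,
          q.2.2.1)) (by fun_prop)))
  · constructor
    · rintro ⟨⟨l₁, p, l₂, y⟩, h1, h2, h3⟩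
      exact ⟨S.dp l₁, _, S.dp l₂, S.st y, by rw [h1]; simp [dp], h2, h3⟩
    · rintro ⟨l₁, p, l₂, y, h1, h2, h3⟩
      obtain ⟨c₁, c₂, h4, rfl, h5⟩ := List.map_eq_append_iff.1 h1
      obtain ⟨c, c₃, rfl, rfl, rfl⟩ := List.map_eq_cons_iff.1 h5
      obtain ⟨y', h6, h7⟩ := Rd.exists_rdStep h2
      refine ⟨⟨c₁, c, c₃, y'⟩, h4, rd_of_rdStep h6, ?_⟩
      intro t ht hO hE' z hz
      refine h3 t ht (hO.trans h7.1) hE' z ⟨hz.1, ?_⟩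
      have h8 := inv_mem h7.2
      rw [← hO] at h8
      have := mul_mem h8 hz.2
      convert this using 1
      group

theorem re_trap (hE : S.Effective) : REPred fun q : GraphCode V E N × CodedState V N ×
    CodedState V N × CodedPath E N × List (CodedState V N) =>
    S.Trap q.1 (S.st q.2.1) (S.st q.2.2.1) (S.dp q.2.2.2.1) (q.2.2.2.2.map S.st) := by
  have h1 : REPred fun q : (GraphCode V E N × CodedState V N × CodedState V N × CodedPath E N ×
      List (CodedState V N)) => ∀ y ∈ q.2.1 :: q.2.2.2.2,
      S.Fails q.1 (S.st y) (S.dp q.2.2.2.1) ∨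
        ∃ y' ∈ q.2.2.2.2, S.Rd q.1 (S.st y) (S.dp q.2.2.2.1) (S.st y') := by
    refine REPred.forall_mem (p := fun (q : (GraphCode V E N × CodedState V N × CodedState V N ×
        CodedPath E N × List (CodedState V N))) y => S.Fails q.1 (S.st y) (S.dp q.2.2.2.1) ∨
        ∃ y' ∈ q.2.2.2.2, S.Rd q.1 (S.st y) (S.dp q.2.2.2.1) (S.st y')) ?_
      (l := fun q => q.2.1 :: q.2.2.2.2) (by fun_prop)
    refine (hE.re_fails.comp (f := fun q : (GraphCode V E N × CodedState V N × CodedState V N ×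
        CodedPath E N × List (CodedState V N)) × CodedState V N => (q.1.1, q.2,
        q.1.2.2.2.1)) (by fun_prop)).or ?_
    exact REPred.exists_mem (p := fun (q : (GraphCode V E N × CodedState V N × CodedState V N ×
        CodedPath E N × List (CodedState V N)) × CodedState V N) y' =>
      S.Rd q.1.1 (S.st q.2) (S.dp q.1.2.2.2.1) (S.st y')) (hE.re_rd.comp
      (f := fun q : ((GraphCode V E N × CodedState V N × CodedState V N × CodedPath E N × List
          (CodedState V N)) × CodedState V N) × CodedState V N => (q.1.1.1, q.1.2, q.1.1.2.2.2.1,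
          q.2)) (by fun_prop))
      (l := fun q => q.1.2.2.2.2) (by fun_prop)
  have h2 : REPred fun q : (GraphCode V E N × CodedState V N × CodedState V N × CodedPath E N ×
      List (CodedState V N)) => ∀ y ∈ q.2.2.2.2, ¬ S.Same q.1 (S.st y) (S.st q.2.2.1) :=
    REPred.forall_mem (p := fun (q : (GraphCode V E N × CodedState V N × CodedState V N × CodedPath
        E N × List (CodedState V N))) y => ¬ S.Same q.1 (S.st y) (S.st q.2.2.1))
      (hE.re_not_same.comp (f := fun q : (GraphCode V E N × CodedState V N × CodedState V N ×
          CodedPath E N × List (CodedState V N)) × CodedState V N => (q.1.1, q.2,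
          q.1.2.2.1)) (by fun_prop))
      (l := fun q => q.2.2.2.2) (by fun_prop)
  refine (h1.and h2).of_eq fun q => ?_
  simp only [Trap, List.mem_cons, List.mem_map, forall_eq_or_imp, exists_exists_and_eq_and,
    forall_exists_index, and_imp, forall_apply_eq_imp_iff₂]

/-- The negative answers in the case of an element of a vertex group are decided by power coset
membership in that group. -/
theorem re_not_power_same (hE : S.Effective) : REPred fun q : GraphCode V E N ×
    CodedState V N × CodedState V N × GroupWord N =>
    ¬ ∃ m : ℤ, m ≠ 0 ∧ S.Same q.1 (q.2.1.1, S.ev q.2.1.1.1 q.2.1.2 * S.ev q.2.1.1.1 q.2.2.2 ^ m)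
      (S.st q.2.2.1) := by
  have h : REPred fun q : V × GroupWord N × GroupWord N × List (GroupWord N) =>
      ¬ ∃ m : ℤ, m ≠ 0 ∧ ∃ h ∈ GroupWord.span (S.gen q.1) q.2.2.2,
        S.ev q.1 q.2.2.1 ^ m = S.ev q.1 q.2.1 * h :=
    REPred.of_finite (p := fun v (i : GroupWord N × GroupWord N × List (GroupWord N)) =>
      ¬ ∃ m : ℤ, m ≠ 0 ∧ ∃ h ∈ GroupWord.span (S.gen v) i.2.2,
        S.ev v i.2.1 ^ m = S.ev v i.1 * h) fun v => (hE.powerCoset v).not.to_re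
  refine ((REPred.ne (f := fun q : (GraphCode V E N × CodedState V N × CodedState V N × GroupWord
      N) => q.2.1.1) (g := fun q : (GraphCode V E N × CodedState V N × CodedState V N × GroupWord
      N) => q.2.2.1.1) (by fun_prop)
    (by fun_prop)).or (h.comp (f := fun q : (GraphCode V E N × CodedState V N × CodedState V N ×
        GroupWord N) => (q.2.1.1.1, q.2.1.2.inv ++ q.2.2.1.2, q.2.2.2,
      GroupWord.conjList q.2.2.1.2.inv (gens q.1 q.2.1.1))) (by fun_prop))).of_eq fun q => ?_
  obtain ⟨D, ⟨u, a⟩, ⟨u', a'⟩, c⟩ := q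
  dsimp only
  by_cases hu : u = u'
  · subst hu
    simp only [ne_eq, not_true_eq_false, false_or]
    refine not_congr (exists_congr fun m => and_congr_right fun _ => ?_)
    simp only [Same, st, true_and, GroupWord.mem_span_conjList]
    change _ ↔ _ ∈ GroupWord.span (S.gen u.1) (gens D u)
    have h1 : ∀ w, GroupWord.eval (S.gen u.1) w = S.ev u.1 w := fun _ => rfl
    simp only [h1, ev_append, ev_inv, inv_inv]
    constructor
    · rintro ⟨h, hh, hc⟩
      rw [hc]
      convert hh using 1
      group
    · intro hh
      refine ⟨(S.ev u.1 a')⁻¹ * (S.ev u.1 a * S.ev u.1 c ^ m), ?_, by group⟩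
      convert hh using 1
      group
  · simp only [ne_eq, hu, not_false_eq_true, true_or, true_iff]
    rintro ⟨m, -, h, -⟩
    exact hu h

end Effective

end Splitting

/-! ### The word problem -/

namespace Splitting

variable {V E G : Type*} [Group G] {N : ℕ} {S : Splitting V E G N}

/-- A letter is a word for an element of a vertex group or an edge. -/
abbrev Letter (V E : Type*) (N : ℕ) : Type _ := (V × GroupWord N) ⊕ E

/-- The element of `G` that is represented by a letter. -/
def letterVal (S : Splitting V E G N) : Letter V E N → G
  | Sum.inl p => S.ev p.1 p.2
  | Sum.inr e => S.τ e

/-- The element of `G` that is represented by a list of letters. -/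
def lv (S : Splitting V E G N) (L : List (Letter V E N)) : G := (L.map S.letterVal).prod

@[simp] theorem lv_nil : S.lv [] = 1 := rfl

@[simp] theorem lv_cons (x : Letter V E N) (L : List (Letter V E N)) :
    S.lv (x :: L) = S.letterVal x * S.lv L := List.prod_cons

@[simp] theorem lv_append (L L' : List (Letter V E N)) : S.lv (L ++ L') = S.lv L * S.lv L' := by
  simp [lv]

/-- The list of letters is a path from `a` to `b`. -/
def IsLPath (S : Splitting V E G N) : V → List (Letter V E N) → V → Prop
  | a, [], b => a = b
  | a, Sum.inl p :: L, b => p.1 = a ∧ IsLPath S a L b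
  | a, Sum.inr e :: L, b => S.src e = a ∧ IsLPath S (S.tgt e) L b

theorem IsLPath.append {a b c : V} {L L' : List (Letter V E N)} (h : S.IsLPath a L b)
    (h' : S.IsLPath b L' c) : S.IsLPath a (L ++ L') c := by
  induction L generalizing a with
  | nil =>
    obtain rfl : a = b := h
    exact h'
  | cons x L ih =>
    cases x with
    | inl p => exact ⟨h.1, ih h.2⟩
    | inr e => exact ⟨h.1, ih h.2⟩

/-- The letters of a path. -/
def flat (S : Splitting V E G N) (l : CodedPath E N) : List (Letter V E N) :=
  l.flatMap fun p => [Sum.inr p.1, Sum.inl (S.tgt p.1, p.2)]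

theorem flat_cons (p : E × GroupWord N) (l : CodedPath E N) :
    S.flat (p :: l) = Sum.inr p.1 :: Sum.inl (S.tgt p.1, p.2) :: S.flat l := rfl

theorem lv_flat (l : CodedPath E N) : S.lv (S.flat l) = S.lval (S.dp l) := by
  induction l with
  | nil => rfl
  | cons p l ih =>
    rw [flat_cons, lv_cons, lv_cons, ih]
    simp [dp, letterVal, mul_assoc]

theorem isLPath_flat {a b : V} {l : CodedPath E N} (h : S.IsPath a (S.dp l) b) :
    S.IsLPath a (S.flat l) b := by
  induction l generalizing a with
  | nil => exact h
  | cons p l ih => exact ⟨h.1, rfl, ih h.2.2⟩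

theorem isLPath_cons_flat {a b : V} {w : GroupWord N} {l : CodedPath E N}
    (h : S.IsPath a (S.dp l) b) : S.IsLPath a (Sum.inl (a, w) :: S.flat l) b :=
  ⟨rfl, isLPath_flat h⟩

/-- The rules of the rewriting system for the word problem. -/
inductive Rule (S : Splitting V E G N) : List (Letter V E N) → List (Letter V E N) → Prop
  | insert (v : V) : Rule S [] [Sum.inl (v, [])]
  | merge (v : V) (w w' : GroupWord N) :
      Rule S [Sum.inl (v, w), Sum.inl (v, w')] [Sum.inl (v, w ++ w')]
  | trivial (v : V) (w : GroupWord N) (hw : S.ev v w = 1) : Rule S [Sum.inl (v, w)] []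
  | cancel (e : E) (w w' : GroupWord N) (hw : S.ev (S.src e) w ∈ S.edge e)
      (hw' : (S.τ e)⁻¹ * S.ev (S.src e) w * S.τ e = S.ev (S.tgt e) w') :
      Rule S [Sum.inr (S.rev e), Sum.inl (S.src e, w), Sum.inr e] [Sum.inl (S.tgt e, w')]

theorem Rule.lv_eq {L L' : List (Letter V E N)} (h : S.Rule L L') : S.lv L = S.lv L' := by
  cases h with
  | insert v => simp [letterVal]
  | merge v w w' => simp [letterVal]
  | trivial v w hw => simp [letterVal, hw]
  | cancel e w w' hw hw' => simp [letterVal, S.τ_rev, ← hw', mul_assoc]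

/-- A rewriting step. -/
def Step (S : Splitting V E G N) (L L' : List (Letter V E N)) : Prop :=
  ∃ p M M' q, L = p ++ M ++ q ∧ L' = p ++ M' ++ q ∧ S.Rule M M'

theorem lv_eq_of_steps {L L' : List (Letter V E N)} (h : Relation.ReflTransGen S.Step L L') :
    S.lv L = S.lv L' := by
  induction h with
  | refl => rfl
  | tail _ h ih =>
    obtain ⟨p, M, M', q, rfl, rfl, hr⟩ := h
    rw [ih]
    simp [hr.lv_eq]

theorem Rule.steps {L L' : List (Letter V E N)} (h : S.Rule L L') (q : List (Letter V E N)) :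
    Relation.ReflTransGen S.Step (L ++ q) (L' ++ q) :=
  Relation.ReflTransGen.single ⟨[], L, L', q, rfl, rfl, h⟩

theorem steps_append_left (p : List (Letter V E N)) {L L' : List (Letter V E N)}
    (h : Relation.ReflTransGen S.Step L L') :
    Relation.ReflTransGen S.Step (p ++ L) (p ++ L') := by
  induction h with
  | refl => exact Relation.ReflTransGen.refl
  | tail _ h ih =>
    obtain ⟨p', M, M', q, rfl, rfl, hr⟩ := h
    exact ih.tail ⟨p ++ p', M, M', q, by simp, by simp, hr⟩

/-- Every path of letters can be rewritten to a reduced path. -/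
theorem IsLPath.exists_reduced {a b : V} {L : List (Letter V E N)} (h : S.IsLPath a L b) :
    ∃ w l, S.IsPath a (S.dp l) b ∧ S.Reduced (S.dp l) ∧
      Relation.ReflTransGen S.Step L (Sum.inl (a, w) :: S.flat l) := by
  induction L generalizing a with
  | nil => exact ⟨[], [], h, List.isChain_nil, (Rule.insert a).steps []⟩
  | cons x L ih =>
    cases x with
    | inl p =>
      obtain ⟨v, w'⟩ := p
      obtain ⟨rfl, h⟩ := h
      dsimp only at h ⊢
      obtain ⟨w, l, h1, h2, h3⟩ := ih h
      exact ⟨w' ++ w, l, h1, h2, (steps_append_left [Sum.inl (v, w')] h3).trans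
        ((Rule.merge v w' w).steps (S.flat l))⟩
    | inr e =>
      obtain ⟨rfl, h⟩ := h
      obtain ⟨w, l, h1, h2, h3⟩ := ih h
      have h4 := steps_append_left [Sum.inr e] h3
      have hno : (∀ p ∈ (S.dp l).head?, S.Good (e, S.ev (S.tgt e) w) p) → ∃ w l,
          S.IsPath (S.src e) (S.dp l) b ∧ S.Reduced (S.dp l) ∧
            Relation.ReflTransGen S.Step (Sum.inr e :: L) (Sum.inl (S.src e, w) :: S.flat l) := by
        intro hgood
        exact ⟨[], (e, w) :: l, ⟨rfl, S.ev_mem _ _, h1⟩, List.isChain_cons.2 ⟨hgood, h2⟩,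
          h4.trans ((Rule.insert (S.src e)).steps _)⟩
      cases l with
      | nil => exact hno (by simp [dp])
      | cons p l =>
        obtain ⟨e', w'⟩ := p
        by_cases hp : S.Good (e, S.ev (S.tgt e) w) (e', S.ev (S.tgt e') w')
        · exact hno (by simpa [dp] using hp)
        · obtain ⟨hp1, hp2⟩ := not_not.1 hp
          dsimp only at hp1 hp2
          have hp3 : e = S.rev e' := by rw [hp1, S.rev_rev]
          subst hp3
          rw [S.tgt_rev] at hp2 h3 h4
          have h5 : (S.τ e')⁻¹ * S.ev (S.src e') w * S.τ e' ∈ S.vert (S.tgt e') := by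
            rw [← S.src_rev]
            exact S.edge_le _ (S.conj_mem _ _ hp2)
          obtain ⟨w₂, hw₂⟩ := S.exists_ev h5
          rw [S.src_rev]
          refine ⟨w₂ ++ w', l, h1.2.2, (List.isChain_cons.1 h2).2, h4.trans ?_⟩
          exact ((Rule.cancel e' w w₂ hp2 hw₂.symm).steps
              (Sum.inl (S.tgt e', w') :: S.flat l)).trans
            ((Rule.merge (S.tgt e') w₂ w').steps (S.flat l))

/-- Closed paths of letters that represent `1` can be rewritten to the empty path: the reduced path
that they are rewritten to has no edges, by the normal form theorem. -/
theorem IsLPath.steps_nil (hS : S.IsFaithful) {a : V} {L : List (Letter V E N)}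
    (h : S.IsLPath a L a) (hv : S.lv L = 1) : Relation.ReflTransGen S.Step L [] := by
  obtain ⟨w, l, h1, h2, h3⟩ := h.exists_reduced
  have h4 := lv_eq_of_steps h3
  rw [hv, lv_cons, lv_flat] at h4
  have h5 := hS.slide (S.ev_mem a w) (one_mem (S.vert a)) h1 (l' := []) rfl h2 List.isChain_nil
    (by rw [lval_nil, mul_one]; exact h4.symm)
  generalize hl : S.dp l = l' at h5
  generalize hw : S.ev a w = g at h5
  generalize hl₀ : ([] : List (E × G)) = l₀ at h5
  cases h5 with
  | nil =>
    obtain rfl := List.map_eq_nil_iff.1 hl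
    exact h3.trans ((Rule.trivial a w hw).steps [])
  | cons => cases hl₀

/-- Two parallel paths of letters represent the same element of `G`. -/
def Parallel (S : Splitting V E G N) (a : V) (L L' : List (Letter V E N)) (b : V) : Prop :=
  S.IsLPath a L b ∧ S.IsLPath a L' b ∧ S.lv L = S.lv L'

theorem exists_dp {a b : V} {l : List (E × G)} (h : S.IsPath a l b) : ∃ l', S.dp l' = l := by
  induction l generalizing a with
  | nil => exact ⟨[], rfl⟩
  | cons p l ih =>
    obtain ⟨l', rfl⟩ := ih h.2.2
    obtain ⟨w, hw⟩ := S.exists_ev h.2.1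
    exact ⟨(p.1, w) :: l', by rw [dp, List.map_cons, hw]; rfl⟩

theorem exists_path_word (hS : S.IsFaithful) (a b : V) (g : G) : ∃ w l,
    S.IsPath a (S.dp l) b ∧ S.ev a w * S.lval (S.dp l) = g := by
  obtain ⟨g₀, hg₀, l, hl, rfl⟩ := hS.exists_path a b g
  obtain ⟨w, rfl⟩ := S.exists_ev hg₀
  obtain ⟨l', rfl⟩ := exists_dp hl
  exact ⟨w, l', hl, rfl⟩

end Splitting

namespace Splitting

variable {V E G : Type*} [Group G] {N : ℕ} {S : Splitting V E G N}

set_option linter.unusedSectionVars false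

variable [Primcodable V] [Primcodable E] [Finite V] [Finite E] {α : Type*} [Primcodable α]

theorem computable_inl {f : α → V × GroupWord N} (hf : Computable f) :
    Computable fun a => (Sum.inl (f a) : Letter V E N) := Computable.sumInl.comp hf

theorem computable_inr {f : α → E} (hf : Computable f) :
    Computable fun a => (Sum.inr (f a) : Letter V E N) := Computable.sumInr.comp hf

theorem computable_flat {f : α → CodedPath E N} (hf : Computable f) :
    Computable fun a => S.flat (f a) := by
  have h : Primrec fun l : CodedPath E N => S.flat l := by
    refine Primrec.list_flatMap Primrec.id ?_
    exact Primrec.to₂ <| Primrec.list_cons.comp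
      (Primrec.sumInr.comp (Primrec.fst.comp Primrec.snd))
      (Primrec.list_cons.comp (Primrec.sumInl.comp
        (((Primrec.dom_finite S.tgt).comp (Primrec.fst.comp Primrec.snd)).pair
          (Primrec.snd.comp Primrec.snd))) (Primrec.const []))
  exact h.to_comp.comp hf

attribute [fun_prop] computable_inl computable_inr computable_flat

namespace Effective

theorem re_rule (hE : S.Effective) : REPred fun q : List (Letter V E N) × List (Letter V E N) =>
    S.Rule q.1 q.2 := by
  have h1 : REPred fun q : List (Letter V E N) × List (Letter V E N) =>
      ∃ v : V, q.1 = [] ∧ q.2 = [Sum.inl (v, [])] :=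
    REPred.ex (p := fun (q : List (Letter V E N) × List (Letter V E N)) (v : V) =>
      q.1 = [] ∧ q.2 = [Sum.inl (v, [])])
      ((REPred.eq (by fun_prop) (by fun_prop)).and (REPred.eq (by fun_prop) (by fun_prop)))
  have h2 : REPred fun q : List (Letter V E N) × List (Letter V E N) =>
      ∃ c : V × GroupWord N × GroupWord N,
        q.1 = [Sum.inl (c.1, c.2.1), Sum.inl (c.1, c.2.2)] ∧
        q.2 = [Sum.inl (c.1, c.2.1 ++ c.2.2)] :=
    REPred.ex (p := fun (q : List (Letter V E N) × List (Letter V E N))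
      (c : V × GroupWord N × GroupWord N) =>
        q.1 = [Sum.inl (c.1, c.2.1), Sum.inl (c.1, c.2.2)] ∧
        q.2 = [Sum.inl (c.1, c.2.1 ++ c.2.2)])
      ((REPred.eq (by fun_prop) (by fun_prop)).and (REPred.eq (by fun_prop) (by fun_prop)))
  have h3 : REPred fun q : List (Letter V E N) × List (Letter V E N) =>
      ∃ c : V × GroupWord N, q.1 = [Sum.inl c] ∧ q.2 = [] ∧
        S.ev c.1 c.2 ∈ GroupWord.span (S.gen c.1) [] :=
    REPred.ex (p := fun (q : List (Letter V E N) × List (Letter V E N)) (c : V × GroupWord N) =>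
      q.1 = [Sum.inl c] ∧ q.2 = [] ∧ S.ev c.1 c.2 ∈ GroupWord.span (S.gen c.1) [])
      ((REPred.eq (by fun_prop) (by fun_prop)).and ((REPred.eq (by fun_prop) (by fun_prop)).and
        (hE.re_mem.comp (f := fun q : (List (Letter V E N) × List (Letter V E N)) ×
          V × GroupWord N => (q.2.1, q.2.2, [])) (by fun_prop))))
  have h4 : REPred fun q : List (Letter V E N) × List (Letter V E N) =>
      ∃ c : E × GroupWord N × GroupWord N,
        q.1 = [Sum.inr (S.rev c.1), Sum.inl (S.src c.1, c.2.1), Sum.inr c.1] ∧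
        q.2 = [Sum.inl (S.tgt c.1, c.2.2)] ∧ S.ev (S.src c.1) c.2.1 ∈ S.edge c.1 ∧
        (S.τ c.1)⁻¹ * S.ev (S.src c.1) c.2.1 * S.τ c.1 = S.ev (S.tgt c.1) c.2.2 :=
    REPred.ex (p := fun (q : List (Letter V E N) × List (Letter V E N))
      (c : E × GroupWord N × GroupWord N) =>
        q.1 = [Sum.inr (S.rev c.1), Sum.inl (S.src c.1, c.2.1), Sum.inr c.1] ∧
        q.2 = [Sum.inl (S.tgt c.1, c.2.2)] ∧ S.ev (S.src c.1) c.2.1 ∈ S.edge c.1 ∧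
        (S.τ c.1)⁻¹ * S.ev (S.src c.1) c.2.1 * S.τ c.1 = S.ev (S.tgt c.1) c.2.2)
      ((REPred.eq (by fun_prop) (by fun_prop)).and ((REPred.eq (by fun_prop) (by fun_prop)).and
        (hE.re_transport.comp (f := fun q : (List (Letter V E N) × List (Letter V E N)) ×
          E × GroupWord N × GroupWord N => q.2) (by fun_prop))))
  refine (h1.or (h2.or (h3.or h4))).of_eq fun q => ?_
  obtain ⟨L, L'⟩ := q
  simp only [GroupWord.mem_span_nil]
  constructor
  · rintro (⟨v, rfl, rfl⟩ | ⟨⟨v, w, w'⟩, rfl, rfl⟩ | ⟨⟨v, w⟩, rfl, rfl, h⟩ |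
      ⟨⟨e, w, w'⟩, rfl, rfl, h, h'⟩)
    · exact Rule.insert v
    · exact Rule.merge v w w'
    · exact Rule.trivial v w h
    · exact Rule.cancel e w w' h h'
  · intro h
    cases h with
    | insert v => exact Or.inl ⟨v, rfl, rfl⟩
    | merge v w w' => exact Or.inr (Or.inl ⟨(v, w, w'), rfl, rfl⟩)
    | trivial v w h => exact Or.inr (Or.inr (Or.inl ⟨(v, w), rfl, rfl, h⟩))
    | cancel e w w' h h' => exact Or.inr (Or.inr (Or.inr ⟨(e, w, w'), rfl, rfl, h, h'⟩))

theorem re_steps_nil (hE : S.Effective) : REPred fun L : List (Letter V E N) =>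
    Relation.ReflTransGen S.Step L [] := by
  have h : REPred fun q : Unit × List (Letter V E N) × List (Letter V E N) =>
      S.Step q.2.1 q.2.2 := by
    refine (REPred.ex (p := fun (q : Unit × List (Letter V E N) × List (Letter V E N))
      (c : List (Letter V E N) × List (Letter V E N) × List (Letter V E N) ×
        List (Letter V E N)) =>
      q.2.1 = c.1 ++ c.2.1 ++ c.2.2.2 ∧ q.2.2 = c.1 ++ c.2.2.1 ++ c.2.2.2 ∧
        S.Rule c.2.1 c.2.2.1) ?_).of_eq fun q => ?_
    · exact (REPred.eq (by fun_prop) (by fun_prop)).and ((REPred.eq (by fun_prop)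
        (by fun_prop)).and (hE.re_rule.comp (f := fun q : (Unit × List (Letter V E N) ×
        List (Letter V E N)) × List (Letter V E N) × List (Letter V E N) ×
        List (Letter V E N) × List (Letter V E N) => (q.2.2.1, q.2.2.2.1)) (by fun_prop)))
    · constructor
      · rintro ⟨⟨p, M, M', r⟩, h⟩
        exact ⟨p, M, M', r, h⟩
      · rintro ⟨p, M, M', r, h⟩
        exact ⟨⟨p, M, M', r⟩, h⟩
  exact (REPred.reflTransGen (R := fun _ : Unit => S.Step) h).comp
    (f := fun L : List (Letter V E N) => ((), L, [])) (by fun_prop)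

end Effective

theorem re_isLPath : REPred fun q : V × List (Letter V E N) × V => S.IsLPath q.1 q.2.1 q.2.2 := by
  let R : Unit → V × List (Letter V E N) → V × List (Letter V E N) → Prop := fun _ x y =>
    (∃ w, x.2 = Sum.inl (x.1, w) :: y.2 ∧ y.1 = x.1) ∨
      ∃ e, x.2 = Sum.inr e :: y.2 ∧ S.src e = x.1 ∧ y.1 = S.tgt e
  have hR : REPred fun q : Unit × (V × List (Letter V E N)) × V × List (Letter V E N) =>
      R q.1 q.2.1 q.2.2 := by
    refine (REPred.ex
      (p := fun (q : Unit × (V × List (Letter V E N)) × V × List (Letter V E N)) w =>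
      q.2.1.2 = Sum.inl (q.2.1.1, w) :: q.2.2.2 ∧ q.2.2.1 = q.2.1.1) ?_).or
      (REPred.ex (p := fun (q : Unit × (V × List (Letter V E N)) × V × List (Letter V E N)) e =>
      q.2.1.2 = Sum.inr e :: q.2.2.2 ∧ S.src e = q.2.1.1 ∧ q.2.2.1 = S.tgt e) ?_)
    · exact (REPred.eq (by fun_prop) (by fun_prop)).and (REPred.eq (by fun_prop) (by fun_prop))
    · exact (REPred.eq (by fun_prop) (by fun_prop)).and ((REPred.eq (by fun_prop)
        (by fun_prop)).and (REPred.eq (by fun_prop) (by fun_prop)))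
  refine ((REPred.reflTransGen hR).comp (f := fun q : V × List (Letter V E N) × V =>
    ((), (q.1, q.2.1), q.2.2, [])) (by fun_prop)).of_eq fun q => ?_
  obtain ⟨a, L, b⟩ := q
  dsimp only
  constructor
  · intro h
    generalize hx : (a, L) = x at h
    induction h using Relation.ReflTransGen.head_induction_on generalizing a L with
    | refl =>
      obtain ⟨rfl, rfl⟩ := Prod.mk.inj hx
      rfl
    | head h _ ih =>
      subst hx
      rcases h with ⟨w, h1, h2⟩ | ⟨e, h1, h2, h3⟩
      · dsimp only at h1 h2
        subst h1 h2
        exact ⟨rfl, ih _ _ rfl⟩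
      · dsimp only at h1
        subst h1
        have := ih _ _ rfl
        rw [h3] at this
        exact ⟨h2, this⟩
  · intro h
    induction L generalizing a with
    | nil =>
      obtain rfl : a = b := h
      exact Relation.ReflTransGen.refl
    | cons x L ih =>
      cases x with
      | inl p =>
        obtain ⟨v, w⟩ := p
        obtain ⟨rfl, h⟩ := h
        exact Relation.ReflTransGen.head (b := (v, L)) (Or.inl ⟨w, rfl, rfl⟩) (ih _ h)
      | inr e =>
        obtain ⟨rfl, h⟩ := h
        exact Relation.ReflTransGen.head (b := (S.tgt e, L)) (Or.inr ⟨e, rfl, rfl, rfl⟩) (ih _ h)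

/-- It can be confirmed that two parallel paths of letters represent the same element: both become
trivial after composition with the same path. -/
theorem Effective.re_parallel (hE : S.Effective) (hS : S.IsFaithful) :
    REPred fun q : V × List (Letter V E N) × List (Letter V E N) × V =>
      S.Parallel q.1 q.2.1 q.2.2.1 q.2.2.2 := by
  have h : REPred fun q : V × List (Letter V E N) × List (Letter V E N) × V =>
      ∃ L, Relation.ReflTransGen S.Step (q.2.1 ++ L) [] ∧
        Relation.ReflTransGen S.Step (q.2.2.1 ++ L) [] :=
    REPred.ex (p := fun (q : V × List (Letter V E N) × List (Letter V E N) × V) L =>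
      Relation.ReflTransGen S.Step (q.2.1 ++ L) [] ∧
        Relation.ReflTransGen S.Step (q.2.2.1 ++ L) [])
      ((hE.re_steps_nil.comp (f := fun q : (V × List (Letter V E N) × List (Letter V E N) × V) ×
        List (Letter V E N) => q.1.2.1 ++ q.2) (by fun_prop)).and
      (hE.re_steps_nil.comp (f := fun q : (V × List (Letter V E N) × List (Letter V E N) × V) ×
        List (Letter V E N) => q.1.2.2.1 ++ q.2) (by fun_prop)))
  refine (((re_isLPath (S := S)).comp (f := fun q : V × List (Letter V E N) ×
    List (Letter V E N) × V => (q.1, q.2.1, q.2.2.2)) (by fun_prop)).and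
    (((re_isLPath (S := S)).comp (f := fun q : V × List (Letter V E N) × List (Letter V E N) × V =>
    (q.1, q.2.2.1, q.2.2.2)) (by fun_prop)).and h)).of_eq fun q => ?_
  obtain ⟨a, L, L', b⟩ := q
  refine and_congr_right fun h1 => and_congr_right fun h2 => ?_
  dsimp only at h1 h2 ⊢
  constructor
  · rintro ⟨M, h3, h4⟩
    have h5 := (lv_eq_of_steps h3).trans (lv_eq_of_steps h4).symm
    rw [lv_append, lv_append] at h5
    exact mul_right_cancel h5
  · intro h3
    obtain ⟨w, l, h4, h5⟩ := exists_path_word hS b a (S.lv L)⁻¹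
    have h6 : S.lv (Sum.inl (b, w) :: S.flat l) = (S.lv L)⁻¹ := by
      rw [lv_cons, lv_flat]
      exact h5
    refine ⟨Sum.inl (b, w) :: S.flat l, ?_, ?_⟩
    · exact (h1.append (isLPath_cons_flat h4)).steps_nil hS (by rw [lv_append, h6, mul_inv_cancel])
    · exact (h2.append (isLPath_cons_flat h4)).steps_nil hS
        (by rw [lv_append, h6, ← h3, mul_inv_cancel])

end Splitting

/-! ### The power coset membership problem for a splitting -/

section Words

variable {α : Type*} [Primcodable α] {n : ℕ}

/-- The word `u'` arises from `u` by multiplication with a word of the list or with its inverse. -/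
def GroupWord.MulStep (X : List (GroupWord n)) (u u' : GroupWord n) : Prop :=
  ∃ w ∈ X, u' = w ++ u ∨ u' = w.inv ++ u

theorem GroupWord.mem_span_iff {G : Type*} [Group G] {s : Fin n → G} {X : List (GroupWord n)}
    {h : G} : h ∈ GroupWord.span s X ↔
      ∃ u, Relation.ReflTransGen (GroupWord.MulStep X) [] u ∧ GroupWord.eval s u = h := by
  constructor
  · intro hh
    induction hh using Subgroup.closure_induction_left with
    | one => exact ⟨[], Relation.ReflTransGen.refl, rfl⟩
    | mul_left x hx y _ ih =>
      obtain ⟨w, hw, rfl⟩ := hx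
      obtain ⟨u, hu, rfl⟩ := ih
      exact ⟨w ++ u, hu.tail ⟨w, hw, Or.inl rfl⟩, GroupWord.eval_append _ _ _⟩
    | inv_mul_cancel x hx y _ ih =>
      obtain ⟨w, hw, rfl⟩ := hx
      obtain ⟨u, hu, rfl⟩ := ih
      exact ⟨w.inv ++ u, hu.tail ⟨w, hw, Or.inr rfl⟩, by simp⟩
  · rintro ⟨u, hu, rfl⟩
    induction hu with
    | refl => exact one_mem _
    | tail _ h ih =>
      obtain ⟨w, hw, rfl | rfl⟩ := h
      · rw [GroupWord.eval_append]
        exact mul_mem (GroupWord.eval_mem_span s hw) ih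
      · rw [GroupWord.eval_append, GroupWord.eval_inv]
        exact mul_mem (inv_mem (GroupWord.eval_mem_span s hw)) ih

/-- The word `u'` arises from `u` by multiplication with `g`. -/
def GroupWord.PowStep (g u u' : GroupWord n) : Prop := u' = g ++ u

theorem GroupWord.exists_pow_iff {G : Type*} [Group G] {s : Fin n → G} {g : GroupWord n} {h : G} :
    (∃ m : ℕ, m ≠ 0 ∧ GroupWord.eval s g ^ m = h) ↔
      ∃ u, Relation.ReflTransGen (GroupWord.PowStep g) g u ∧ GroupWord.eval s u = h := by
  constructor
  · rintro ⟨m, hm, rfl⟩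
    obtain ⟨m, rfl⟩ := Nat.exists_eq_succ_of_ne_zero hm
    clear hm
    induction m with
    | zero => exact ⟨g, Relation.ReflTransGen.refl, by simp⟩
    | succ m ih =>
      obtain ⟨u, hu, h⟩ := ih
      exact ⟨g ++ u, hu.tail rfl, by rw [GroupWord.eval_append, h, pow_succ' _ m.succ]⟩
  · rintro ⟨u, hu, rfl⟩
    induction hu with
    | refl => exact ⟨1, one_ne_zero, pow_one _⟩
    | tail _ h ih =>
      obtain ⟨m, -, hm⟩ := ih
      obtain rfl := h
      exact ⟨m + 1, m.succ_ne_zero, by rw [GroupWord.eval_append, ← hm, pow_succ']⟩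

theorem exists_zpow_iff {G : Type*} [Group G] {g : G} {P : G → Prop} :
    (∃ m : ℤ, m ≠ 0 ∧ P (g ^ m)) ↔
      (∃ m : ℕ, m ≠ 0 ∧ P (g ^ m)) ∨ ∃ m : ℕ, m ≠ 0 ∧ P (g⁻¹ ^ m) := by
  constructor
  · rintro ⟨m, hm, h⟩
    obtain ⟨k, rfl | rfl⟩ := m.eq_nat_or_neg
    · exact Or.inl ⟨k, by simpa using hm, by simpa using h⟩
    · exact Or.inr ⟨k, by simpa using hm, by simpa using h⟩
  · rintro (⟨m, hm, h⟩ | ⟨m, hm, h⟩)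
    · exact ⟨m, by simpa using hm, by simpa using h⟩
    · exact ⟨-m, by simpa using hm, by simpa using h⟩

/-- If the word problem can be confirmed, then so can power coset membership. -/
theorem GroupWord.re_powerCoset {G : Type*} [Group G] {s : Fin n → G}
    (heq : REPred fun q : GroupWord n × GroupWord n =>
      GroupWord.eval s q.1 = GroupWord.eval s q.2) :
    REPred fun i : GroupWord n × GroupWord n × List (GroupWord n) =>
      ∃ m : ℤ, m ≠ 0 ∧ ∃ h ∈ GroupWord.span s i.2.2,
        GroupWord.eval s i.2.1 ^ m = GroupWord.eval s i.1 * h := by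
  have h1 : REPred fun q : List (GroupWord n) × GroupWord n × GroupWord n =>
      GroupWord.MulStep q.1 q.2.1 q.2.2 :=
    REPred.exists_mem (p := fun (q : List (GroupWord n) × GroupWord n × GroupWord n) w =>
      q.2.2 = w ++ q.2.1 ∨ q.2.2 = w.inv ++ q.2.1)
      ((REPred.eq (by fun_prop) (by fun_prop)).or (REPred.eq (by fun_prop) (by fun_prop)))
      (l := fun q => q.1) (by fun_prop)
  have h2 : REPred fun q : GroupWord n × GroupWord n × GroupWord n =>
      GroupWord.PowStep q.1 q.2.1 q.2.2 := REPred.eq (by fun_prop) (by fun_prop)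
  have h3 : REPred fun q : GroupWord n × GroupWord n × List (GroupWord n) =>
      ∃ c : GroupWord n × GroupWord n, Relation.ReflTransGen (GroupWord.PowStep q.2.1) q.2.1 c.1 ∧
        Relation.ReflTransGen (GroupWord.MulStep q.2.2) [] c.2 ∧
        GroupWord.eval s c.1 = GroupWord.eval s (q.1 ++ c.2) :=
    REPred.ex (p := fun (q : GroupWord n × GroupWord n × List (GroupWord n))
      (c : GroupWord n × GroupWord n) => Relation.ReflTransGen (GroupWord.PowStep q.2.1) q.2.1 c.1 ∧
        Relation.ReflTransGen (GroupWord.MulStep q.2.2) [] c.2 ∧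
        GroupWord.eval s c.1 = GroupWord.eval s (q.1 ++ c.2))
      (((REPred.reflTransGen h2).comp (f := fun q : (GroupWord n × GroupWord n ×
        List (GroupWord n)) × GroupWord n × GroupWord n => (q.1.2.1, q.1.2.1, q.2.1))
        (by fun_prop)).and (((REPred.reflTransGen h1).comp (f := fun q : (GroupWord n ×
        GroupWord n × List (GroupWord n)) × GroupWord n × GroupWord n => (q.1.2.2, [], q.2.2))
        (by fun_prop)).and (heq.comp (f := fun q : (GroupWord n × GroupWord n ×
        List (GroupWord n)) × GroupWord n × GroupWord n => (q.2.1, q.1.1 ++ q.2.2))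
        (by fun_prop))))
  have h4 : ∀ q : GroupWord n × GroupWord n × List (GroupWord n),
      (∃ c : GroupWord n × GroupWord n, Relation.ReflTransGen (GroupWord.PowStep q.2.1) q.2.1 c.1 ∧
        Relation.ReflTransGen (GroupWord.MulStep q.2.2) [] c.2 ∧
        GroupWord.eval s c.1 = GroupWord.eval s (q.1 ++ c.2)) ↔
      ∃ m : ℕ, m ≠ 0 ∧ ∃ h ∈ GroupWord.span s q.2.2,
        GroupWord.eval s q.2.1 ^ m = GroupWord.eval s q.1 * h := by
    rintro ⟨x, g, X⟩
    constructor
    · rintro ⟨⟨u, u'⟩, hu, hu', h⟩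
      obtain ⟨m, hm, h'⟩ := GroupWord.exists_pow_iff (s := s).2 ⟨u, hu, rfl⟩
      exact ⟨m, hm, _, GroupWord.mem_span_iff.2 ⟨u', hu', rfl⟩,
        h'.trans (h.trans (GroupWord.eval_append _ _ _))⟩
    · rintro ⟨m, hm, h, hh, h'⟩
      obtain ⟨u, hu, h1⟩ := GroupWord.exists_pow_iff (s := s).1 ⟨m, hm, rfl⟩
      obtain ⟨u', hu', rfl⟩ := GroupWord.mem_span_iff.1 hh
      exact ⟨(u, u'), hu, hu', h1.trans (h'.trans (GroupWord.eval_append _ _ _).symm)⟩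
  refine (h3.or (h3.comp (f := fun q : GroupWord n × GroupWord n × List (GroupWord n) =>
    (q.1, q.2.1.inv, q.2.2)) (by fun_prop))).of_eq fun q => ?_
  rw [h4, h4, exists_zpow_iff (P := fun g : G => ∃ h ∈ GroupWord.span s q.2.2,
    g = GroupWord.eval s q.1 * h)]
  simp only [GroupWord.eval_inv]

end Words

namespace Splitting

variable {V E G : Type*} [Group G] {N : ℕ} {S : Splitting V E G N}

set_option linter.unusedSectionVars false

/-- A path whose elements are given by words. -/
abbrev CodedArc (E : Type*) (N : ℕ) : Type _ := GroupWord N × CodedPath E N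

/-- The letters of a path that starts at `a`. -/
def arcLetters (S : Splitting V E G N) (a : V) (P : CodedArc E N) : List (Letter V E N) :=
  Sum.inl (a, P.1) :: S.flat P.2

/-- The path `P` can be read from the state `y` to the state `y'`. -/
def ReadsArc (S : Splitting V E G N) (D : GraphCode V E N) (y : CodedState V N) (P : CodedArc E N)
    (y' : CodedState V N) : Prop :=
  S.IsPath y.1.1 (S.dp P.2) y'.1.1 ∧ S.Rd D (S.st (y.1, y.2 ++ P.1)) (S.dp P.2) (S.st y')

theorem ReadsArc.readable {D : GraphCode V E N} {y y' : CodedState V N} {P : CodedArc E N}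
    (h : S.ReadsArc D y P y') :
    S.Readable D (S.st y) (S.lv (S.arcLetters y.1.1 P)) (S.st y') := by
  refine ⟨S.ev y.1.1 P.1, S.ev_mem _ _, S.dp P.2, h.1, ?_, ?_⟩
  · have := h.2
    simpa only [st, ev_append] using this
  · rw [arcLetters, lv_cons, lv_flat]
    rfl

theorem Readable.exists_readsArc {D : GraphCode V E N} {y y' : CodedState V N} {h : G}
    (hr : S.Readable D (S.st y) h (S.st y')) :
    ∃ P, S.ReadsArc D y P y' ∧ S.lv (S.arcLetters y.1.1 P) = h := by
  obtain ⟨g₀, hg₀, l, hl, hr, rfl⟩ := hr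
  obtain ⟨w, rfl⟩ := S.exists_ev hg₀
  obtain ⟨l', rfl⟩ := exists_dp hl
  refine ⟨(w, l'), ⟨hl, ?_⟩, ?_⟩
  · simpa only [st, ev_append] using hr
  · rw [arcLetters, lv_cons, lv_flat]
    rfl

theorem ReadsArc.isLPath {D : GraphCode V E N} {y y' : CodedState V N} {P : CodedArc E N}
    (h : S.ReadsArc D y P y') : S.IsLPath y.1.1 (S.arcLetters y.1.1 P) y'.1.1 :=
  isLPath_cons_flat h.1

/-- The data of a frame, that is, the folded graph, the three states and the two paths. -/
abbrev FrameCode (V E : Type*) (N : ℕ) : Type _ :=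
  GraphCode V E N × (CodedState V N × CodedState V N × CodedState V N) × CodedArc E N × CodedArc E N

/-- `φ` translates words in a generating tuple `s` of `G` to loops of letters. -/
def Translates (S : Splitting V E G N) (v₀ : V) {n : ℕ} (s : Fin n → G)
    (φ : GroupWord n → List (Letter V E N)) : Prop :=
  ∀ w, S.IsLPath v₀ (φ w) v₀ ∧ S.lv (φ w) = GroupWord.eval s w

/-- The data of a frame are correct. -/
def IsFrameCode (S : Splitting V E G N) (v₀ : V) {n : ℕ} (φ : GroupWord n → List (Letter V E N))
    (i : GroupWord n × List (GroupWord n)) (F : FrameCode V E N) : Prop :=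
  S.Folded F.1 ∧ F.2.1.1.1.1 = v₀ ∧ F.2.1.2.2.1.1 = F.2.1.2.1.1.1 ∧
    S.ReadsArc F.1 F.2.1.1 F.2.2.1 F.2.1.2.1 ∧ S.ReadsArc F.1 F.2.1.1 F.2.2.2 F.2.1.2.2 ∧
    (∀ w ∈ i.2, ∃ P, S.ReadsArc F.1 F.2.1.1 P F.2.1.1 ∧
      S.Parallel v₀ (φ w) (S.arcLetters v₀ P) v₀) ∧
    S.Parallel v₀ (φ i.1 ++ S.arcLetters v₀ F.2.2.1) (S.arcLetters v₀ F.2.2.2) F.2.1.2.1.1.1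

theorem IsFrameCode.frame {v₀ : V} {n : ℕ} {s : Fin n → G} {φ : GroupWord n → List (Letter V E N)}
    (hφ : S.Translates v₀ s φ) {x : GroupWord n} {X : List (GroupWord n)} {D : GraphCode V E N}
    {y₀ y₁ y₂ : CodedState V N} {P₁ P₂ : CodedArc E N}
    (h : S.IsFrameCode v₀ φ (x, X) (D, (y₀, y₁, y₂), P₁, P₂)) :
    S.Frame D {h | ∃ w ∈ X, GroupWord.eval s w = h} (GroupWord.eval s x)
      (S.lv (S.arcLetters v₀ P₁)) (S.lv (S.arcLetters v₀ P₂)) (S.st y₀) (S.st y₁) (S.st y₂) := by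
  obtain ⟨h1, rfl, h3, h4, h5, h6, h7⟩ := h
  refine ⟨h1, ?_, h4.readable, h5.readable, ?_, h3⟩
  · rintro _ ⟨w, hw, rfl⟩
    obtain ⟨P, hP, -, -, h8⟩ := h6 w hw
    rw [← (hφ w).2, h8]
    exact hP.readable
  · have := h7.2.2
    rwa [lv_append, (hφ x).2] at this

/-- A certificate for `g ^ m ∉ x H` for all `m > 0`, when `g` acts as a translation. -/
def HyperbolicCertificate (S : Splitting V E G N) (v₀ : V) {n : ℕ}
    (φ : GroupWord n → List (Letter V E N)) (i : GroupWord n × GroupWord n × List (GroupWord n))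
    (c : FrameCode V E N × CodedPath E N × List (CodedState V N)) : Prop :=
  S.IsFrameCode v₀ φ (i.1, i.2.2) c.1 ∧
    S.Parallel v₀ (φ i.2.1 ++ S.arcLetters v₀ c.1.2.2.2)
      (S.arcLetters v₀ c.1.2.2.2 ++ S.flat c.2.1) c.1.2.1.2.1.1.1 ∧
    S.CycRed c.1.2.1.2.1.1.1 (S.dp c.2.1) ∧
    S.Trap c.1.1 (S.st c.1.2.1.2.1) (S.st c.1.2.1.2.2) (S.dp c.2.1) (c.2.2.map S.st)

/-- A certificate for `g ^ m ∉ x H` for all `m ≠ 0`, when `g` is conjugate into a vertex group. -/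
def EllipticCertificate (S : Splitting V E G N) (v₀ : V) {n : ℕ}
    (φ : GroupWord n → List (Letter V E N)) (i : GroupWord n × GroupWord n × List (GroupWord n))
    (c : FrameCode V E N × GroupWord N) : Prop :=
  S.IsFrameCode v₀ φ (i.1, i.2.2) c.1 ∧
    S.Parallel v₀ (φ i.2.1 ++ S.arcLetters v₀ c.1.2.2.2)
      (S.arcLetters v₀ c.1.2.2.2 ++ [Sum.inl (c.1.2.1.2.1.1.1, c.2)]) c.1.2.1.2.1.1.1 ∧
    ¬ ∃ m : ℤ, m ≠ 0 ∧ S.Same c.1.1 (c.1.2.1.2.1.1, S.ev c.1.2.1.2.1.1.1 c.1.2.1.2.1.2 *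
      S.ev c.1.2.1.2.1.1.1 c.2 ^ m) (S.st c.1.2.1.2.2)

section Correctness

variable {v₀ : V} {n : ℕ} {s : Fin n → G} {φ : GroupWord n → List (Letter V E N)}
  {x g : GroupWord n} {X : List (GroupWord n)}

theorem HyperbolicCertificate.ne (hS : S.IsFaithful) (hφ : S.Translates v₀ s φ)
    {c : FrameCode V E N × CodedPath E N × List (CodedState V N)}
    (hc : S.HyperbolicCertificate v₀ φ (x, g, X) c) {m : ℕ} (hm : m ≠ 0) {h : G}
    (hh : h ∈ GroupWord.span s X) : GroupWord.eval s g ^ m ≠ GroupWord.eval s x * h := by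
  obtain ⟨⟨D, ⟨y₀, y₁, y₂⟩, P₁, P₂⟩, l, Q⟩ := c
  obtain ⟨hF, hg, hl, hQ⟩ := hc
  have h1 := hg.2.2
  rw [lv_append, lv_append, (hφ g).2, lv_flat] at h1
  exact (hF.frame hφ).ne_of_trap hS h1 hl hQ hm hh

theorem EllipticCertificate.ne (hS : S.IsFaithful) (hφ : S.Translates v₀ s φ)
    {c : FrameCode V E N × GroupWord N} (hc : S.EllipticCertificate v₀ φ (x, g, X) c) {m : ℤ}
    (hm : m ≠ 0) {h : G} (hh : h ∈ GroupWord.span s X) :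
    GroupWord.eval s g ^ m ≠ GroupWord.eval s x * h := by
  obtain ⟨⟨D, ⟨y₀, y₁, y₂⟩, P₁, P₂⟩, c⟩ := c
  obtain ⟨hF, hg, hc⟩ := hc
  intro hgm
  have h1 := hg.2.2
  rw [lv_append, lv_append, (hφ g).2, lv_cons, lv_nil, mul_one] at h1
  exact hc ⟨m, hm, (hF.frame hφ).same_of_eq hS (S.ev_mem _ _) h1 hh hgm⟩

theorem exists_map_st {Q : List ((V × ℕ) × G)} (hQ : ∀ q ∈ Q, q.2 ∈ S.vert q.1.1) :
    ∃ Q' : List (CodedState V N), Q'.map S.st = Q := by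
  induction Q with
  | nil => exact ⟨[], rfl⟩
  | cons q Q ih =>
    obtain ⟨Q', hQ'⟩ := ih fun q hq => hQ q (List.mem_cons_of_mem _ hq)
    obtain ⟨w, hw⟩ := S.exists_ev (hQ q List.mem_cons_self)
    exact ⟨(q.1, w) :: Q', by rw [List.map_cons, hQ', st, hw]⟩

theorem B_le_vert (D : GraphCode V E N) (u : V × ℕ) : S.B D u ≤ S.vert u.1 := by
  rw [B, GroupWord.span_le]
  exact fun w _ => S.ev_mem _ w

/-- The states of a trap can be given by words: those that cannot are not reached. -/
theorem Trap.exists_coded {D : GraphCode V E N} {y₁ : CodedState V N} {y₂ : (V × ℕ) × G}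
    {l : CodedPath E N} {Q : List ((V × ℕ) × G)} (hQ : S.Trap D (S.st y₁) y₂ (S.dp l) Q) :
    ∃ Q' : List (CodedState V N), S.Trap D (S.st y₁) y₂ (S.dp l) (Q'.map S.st) := by
  classical
  obtain ⟨Q', hQ'⟩ := exists_map_st (S := S) (Q := Q.filter fun q => q.2 ∈ S.vert q.1.1)
    (by simp)
  refine ⟨Q', ?_, ?_⟩
  · intro q hq
    obtain ⟨y, rfl⟩ : ∃ y, S.st y = q := by
      rcases List.mem_cons.1 hq with rfl | hq
      · exact ⟨y₁, rfl⟩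
      · obtain ⟨y, -, rfl⟩ := List.mem_map.1 hq
        exact ⟨y, rfl⟩
    rw [hQ'] at hq ⊢
    have hq' : S.st y ∈ S.st y₁ :: Q := by
      rcases List.mem_cons.1 hq with h | h
      · exact h ▸ List.mem_cons_self
      · exact List.mem_cons_of_mem _ (List.mem_filter.1 h).1
    rcases hQ.1 _ hq' with h | ⟨q', hq', h⟩
    · exact Or.inl h
    · refine Or.inr ⟨q', List.mem_filter.2 ⟨hq', ?_⟩, h⟩
      obtain ⟨y', -, h1, h2⟩ := h.exists_rdStep
      have h3 := B_le_vert D _ h2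
      have h4 := mul_mem (inv_mem h3) (S.ev_mem y'.1.1 y'.2)
      rw [decide_eq_true_iff, ← h1]
      simpa [st] using h4
  · intro q hq
    rw [hQ'] at hq
    exact hQ.2 q (List.mem_filter.1 hq).1

/-- A code for the piece of the graph of `H` that serves for the conjugating element `κ`. In
addition to being sound, it is complete: what can be read from `y₁` to `y₂` comes from elements
of `x H`. -/
theorem exists_frameCode [Countable G] [Countable E] (hS : S.IsFaithful)
    (hnoeth : ∀ e, ∀ K ≤ S.edge e, K.FG) (hφ : S.Translates v₀ s φ) (x : GroupWord n)
    (X : List (GroupWord n)) (v : V) (κ : G) : ∃ F : FrameCode V E N,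
      S.IsFrameCode v₀ φ (x, X) F ∧ F.1.2.Nodup ∧ F.2.1.2.1.1.1 = v ∧
      S.lv (S.arcLetters v₀ F.2.2.2) = κ ∧ ∀ h, S.Readable F.1 (S.st F.2.1.2.1) h
        (S.st F.2.1.2.2) → (GroupWord.eval s x)⁻¹ * (κ * h * κ⁻¹) ∈ GroupWord.span s X := by
  obtain ⟨D, y₀, y₁, y₂, F, h1, h2, h3, h4, h5, h6, h7⟩ := exists_frame (S := S)
    (H := GroupWord.span s X) hS hnoeth (X.map (GroupWord.eval s))
    (by simpa using fun w hw => GroupWord.eval_mem_span s hw) v₀ v (GroupWord.eval s x)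
    ((GroupWord.eval s x)⁻¹ * κ) κ (by group)
  obtain ⟨u₀, a₀⟩ := y₀
  obtain ⟨u₁, a₁⟩ := y₁
  obtain ⟨u₂, a₂⟩ := y₂
  dsimp only at h2 h3 h4 h5 h6
  obtain ⟨w₀, rfl⟩ := S.exists_ev h4
  obtain ⟨w₁, rfl⟩ := S.exists_ev h5
  obtain ⟨w₂, rfl⟩ := S.exists_ev h6
  obtain ⟨P₁, hP₁, h8⟩ := Readable.exists_readsArc (y := (u₀, w₀)) (y' := (u₁, w₁)) F.path₁
  obtain ⟨P₂, hP₂, h9⟩ := Readable.exists_readsArc (y := (u₀, w₀)) (y' := (u₂, w₂)) F.path₂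
  dsimp only at h8 h9
  subst h2 h3
  have hl₁ := hP₁.isLPath
  have hl₂ := hP₂.isLPath
  have hv : u₂.1 = u₁.1 := F.vertex
  dsimp only at hl₁ hl₂
  refine ⟨(D, ((u₀, w₀), (u₁, w₁), (u₂, w₂)), P₁, P₂), ⟨F.folded, rfl, F.vertex, hP₁, hP₂, ?_, ?_⟩,
    h1, rfl, h9, ?_⟩
  · intro w hw
    obtain ⟨P, hP, h10⟩ := Readable.exists_readsArc (y := (u₀, w₀)) (y' := (u₀, w₀))
      (F.loops (GroupWord.eval s w) (List.mem_map.2 ⟨w, hw, rfl⟩))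
    exact ⟨P, hP, (hφ w).1, hP.isLPath, (hφ w).2.trans h10.symm⟩
  · refine ⟨(hφ x).1.append hl₁, hv ▸ hl₂, ?_⟩
    rw [lv_append, (hφ x).2, h8, h9]
    group
  · intro h hh
    have := h7 h hh
    simpa [mul_assoc] using this

/-- If no non-trivial power of `g` is in the coset, then there is a certificate. -/
theorem exists_certificate [Countable G] [Countable E] (hS : S.IsFaithful)
    (hnoeth : ∀ e, ∀ K ≤ S.edge e, K.FG)
    (htame : ∀ D : GraphCode V E N, S.Folded D → D.2.Nodup → S.Tame D)
    (hφ : S.Translates v₀ s φ) (hno : ∀ m : ℤ, m ≠ 0 → ∀ h ∈ GroupWord.span s X,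
      GroupWord.eval s g ^ m ≠ GroupWord.eval s x * h) :
    (∃ c, S.EllipticCertificate v₀ φ (x, g, X) c) ∨
      ∃ c, S.HyperbolicCertificate v₀ φ (x, g, X) c := by
  obtain ⟨v, κ, ⟨c, hc, h1⟩ | ⟨l, hl0, hl, h1⟩⟩ := hS.exists_conj v₀ (GroupWord.eval s g)
  · left
    obtain ⟨⟨D, ⟨y₀, y₁, y₂⟩, P₁, P₂⟩, hF, hN, hv, hκ, hread⟩ :=
      exists_frameCode hS hnoeth hφ x X v κ
    dsimp only at hN hv hκ hread
    subst hv hκ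
    obtain ⟨w, rfl⟩ := S.exists_ev hc
    have hP := hF.2.2.2.2.2.2
    refine ⟨(⟨D, ⟨y₀, y₁, y₂⟩, P₁, P₂⟩, w), hF,
      ⟨(hφ g).1.append hP.2.1, hP.2.1.append ⟨rfl, rfl⟩, ?_⟩, ?_⟩
    · rw [lv_append, lv_append, (hφ g).2, h1, lv_cons, lv_nil]
      simp [letterVal]
    · rintro ⟨m, hm, hsame⟩
      refine hno m hm _ (hread (S.ev y₁.1.1 w ^ m) ⟨_, zpow_mem (S.ev_mem _ _) m, [],
        (hF.2.2.1).symm, rd_nil.2 hsame, by rw [lval_nil, mul_one]; rfl⟩) ?_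
      rw [h1, conj_zpow, mul_inv_cancel_left]
  · right
    obtain ⟨⟨D, ⟨y₀, y₁, y₂⟩, P₁, P₂⟩, hF, hN, hv, hκ, hread⟩ :=
      exists_frameCode hS hnoeth hφ x X v κ
    dsimp only at hN hv hκ hread
    subst hv hκ
    obtain ⟨l, rfl⟩ := exists_dp hl.1
    have hP := hF.2.2.2.2.2.2
    obtain ⟨Q, hQ⟩ := exists_trap hF.1 (htame D hF.1 hN) (y₁ := S.st y₁) (y₂ := S.st y₂) hl0 hl (by
      intro m hm
      refine hno (m + 1 : ℕ) (by exact_mod_cast m.succ_ne_zero) _ (hread (S.lval (S.dp l) ^ (m + 1))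
        ⟨1, one_mem _, lpow (S.dp l) (m + 1), ?_, by rwa [mul_one], by rw [lval_lpow, one_mul]⟩) ?_
      · have h2 : y₂.1.1 = y₁.1.1 := hF.2.2.1
        have h3 := hl.isPath_lpow (m + 1)
        change S.IsPath y₁.1.1 _ y₂.1.1
        rw [h2]
        exact h3
      · rw [h1, zpow_natCast, conj_pow]
        group)
    obtain ⟨Q', hQ'⟩ := hQ.exists_coded
    refine ⟨(⟨D, ⟨y₀, y₁, y₂⟩, P₁, P₂⟩, l, Q'), hF,
      ⟨(hφ g).1.append hP.2.1, hP.2.1.append (isLPath_flat hl.1), ?_⟩, hl, hQ'⟩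
    rw [lv_append, lv_append, (hφ g).2, h1, lv_flat]
    group

end Correctness

variable [Primcodable V] [Primcodable E] [Finite V] [Finite E]

theorem exists_translates (hS : S.IsFaithful) (v₀ : V) {n : ℕ} (s : Fin n → G) :
    ∃ φ : GroupWord n → List (Letter V E N), Computable φ ∧ S.Translates v₀ s φ := by
  choose u l h1 h2 using fun p : Fin n × Bool =>
    exists_path_word hS v₀ v₀ (if p.2 then s p.1 else (s p.1)⁻¹)
  let f : Fin n × Bool → List (Letter V E N) := fun p => S.arcLetters v₀ (u p, l p)
  refine ⟨fun w => w.flatMap f, Primrec.to_comp (Primrec.list_flatMap Primrec.id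
    (Primrec.to₂ ((Primrec.dom_finite f).comp Primrec.snd))), fun w => ?_⟩
  induction w with
  | nil => exact ⟨rfl, rfl⟩
  | cons p w ih =>
    refine ⟨(isLPath_cons_flat (h1 p)).append ih.1, ?_⟩
    dsimp only at ih ⊢
    rw [List.flatMap_cons, lv_append, ih.2, GroupWord.eval_cons, ← h2 p, ← lv_flat]
    rfl

section Computability

variable {α : Type*} [Primcodable α]

theorem computable_arcLetters {f : α → V} {P : α → CodedArc E N} (hf : Computable f)
    (hP : Computable P) : Computable fun a => S.arcLetters (f a) (P a) := by
  unfold arcLetters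
  fun_prop

attribute [fun_prop] computable_arcLetters

namespace Effective

theorem re_readsArc (hE : S.Effective) : REPred fun q : GraphCode V E N × CodedState V N ×
    CodedArc E N × CodedState V N => S.ReadsArc q.1 q.2.1 q.2.2.1 q.2.2.2 :=
  ((re_isPath (S := S)).comp (f := fun q : GraphCode V E N × CodedState V N × CodedArc E N ×
    CodedState V N => (q.2.1.1.1, q.2.2.1.2, q.2.2.2.1.1)) (by fun_prop)).and
  (hE.re_rd.comp (f := fun q : GraphCode V E N × CodedState V N × CodedArc E N ×
    CodedState V N => (q.1, (q.2.1.1, q.2.1.2 ++ q.2.2.1.1), q.2.2.1.2, q.2.2.2)) (by fun_prop))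

variable {n : ℕ} {φ : GroupWord n → List (Letter V E N)}

theorem re_isFrameCode (hE : S.Effective) (hS : S.IsFaithful) (hφ : Computable φ) (v₀ : V) :
    REPred fun q : (GroupWord n × List (GroupWord n)) × FrameCode V E N =>
      S.IsFrameCode v₀ φ q.1 q.2 := by
  have h1 : REPred fun q : ((GroupWord n × List (GroupWord n)) × FrameCode V E N) × GroupWord n =>
      ∃ P : CodedArc E N, S.ReadsArc q.1.2.1 q.1.2.2.1.1 P q.1.2.2.1.1 ∧
        S.Parallel v₀ (φ q.2) (S.arcLetters v₀ P) v₀ :=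
    REPred.ex (p := fun (q : ((GroupWord n × List (GroupWord n)) × FrameCode V E N) × GroupWord n)
      (P : CodedArc E N) => S.ReadsArc q.1.2.1 q.1.2.2.1.1 P q.1.2.2.1.1 ∧
        S.Parallel v₀ (φ q.2) (S.arcLetters v₀ P) v₀)
      ((hE.re_readsArc.comp (f := fun q : (((GroupWord n × List (GroupWord n)) × FrameCode V E N) ×
        GroupWord n) × CodedArc E N => (q.1.1.2.1, q.1.1.2.2.1.1, q.2, q.1.1.2.2.1.1))
        (by fun_prop)).and ((hE.re_parallel hS).comp (f := fun q : (((GroupWord n ×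
        List (GroupWord n)) × FrameCode V E N) × GroupWord n) × CodedArc E N =>
        (v₀, φ q.1.2, S.arcLetters v₀ q.2, v₀)) (by fun_prop)))
  unfold IsFrameCode
  exact (hE.re_folded.comp (by fun_prop)).and ((REPred.eq (by fun_prop) (by fun_prop)).and
    ((REPred.eq (by fun_prop) (by fun_prop)).and
    ((hE.re_readsArc.comp (f := fun q : (GroupWord n × List (GroupWord n)) × FrameCode V E N =>
      (q.2.1, q.2.2.1.1, q.2.2.2.1, q.2.2.1.2.1)) (by fun_prop)).and
    ((hE.re_readsArc.comp (f := fun q : (GroupWord n × List (GroupWord n)) × FrameCode V E N =>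
      (q.2.1, q.2.2.1.1, q.2.2.2.2, q.2.2.1.2.2)) (by fun_prop)).and
    ((REPred.forall_mem (p := fun (q : (GroupWord n × List (GroupWord n)) × FrameCode V E N) w =>
      ∃ P : CodedArc E N, S.ReadsArc q.2.1 q.2.2.1.1 P q.2.2.1.1 ∧
        S.Parallel v₀ (φ w) (S.arcLetters v₀ P) v₀) h1 (l := fun q => q.1.2) (by fun_prop)).and
    ((hE.re_parallel hS).comp (f := fun q : (GroupWord n × List (GroupWord n)) × FrameCode V E N =>
      (v₀, φ q.1.1 ++ S.arcLetters v₀ q.2.2.2.1, S.arcLetters v₀ q.2.2.2.2, q.2.2.1.2.1.1.1))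
      (by fun_prop)))))))

theorem re_hyperbolic (hE : S.Effective) (hS : S.IsFaithful) (hφ : Computable φ) (v₀ : V) :
    REPred fun i : GroupWord n × GroupWord n × List (GroupWord n) =>
      ∃ c, S.HyperbolicCertificate v₀ φ i c := by
  refine REPred.ex (p := fun i c => S.HyperbolicCertificate v₀ φ i c) ?_
  unfold HyperbolicCertificate
  exact ((hE.re_isFrameCode hS hφ v₀).comp (f := fun q : (GroupWord n × GroupWord n ×
      List (GroupWord n)) × FrameCode V E N × CodedPath E N × List (CodedState V N) =>
      ((q.1.1, q.1.2.2), q.2.1)) (by fun_prop)).and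
    (((hE.re_parallel hS).comp (f := fun q : (GroupWord n × GroupWord n ×
      List (GroupWord n)) × FrameCode V E N × CodedPath E N × List (CodedState V N) =>
      (v₀, φ q.1.2.1 ++ S.arcLetters v₀ q.2.1.2.2.2,
        S.arcLetters v₀ q.2.1.2.2.2 ++ S.flat q.2.2.1, q.2.1.2.1.2.1.1.1)) (by fun_prop)).and
    ((hE.re_cycRed.comp (f := fun q : (GroupWord n × GroupWord n ×
      List (GroupWord n)) × FrameCode V E N × CodedPath E N × List (CodedState V N) =>
      (q.2.1.2.1.2.1.1.1, q.2.2.1)) (by fun_prop)).and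
    (hE.re_trap.comp (f := fun q : (GroupWord n × GroupWord n ×
      List (GroupWord n)) × FrameCode V E N × CodedPath E N × List (CodedState V N) =>
      (q.2.1.1, q.2.1.2.1.2.1, q.2.1.2.1.2.2, q.2.2.1, q.2.2.2)) (by fun_prop))))

theorem re_elliptic (hE : S.Effective) (hS : S.IsFaithful) (hφ : Computable φ) (v₀ : V) :
    REPred fun i : GroupWord n × GroupWord n × List (GroupWord n) =>
      ∃ c, S.EllipticCertificate v₀ φ i c := by
  refine REPred.ex (p := fun i c => S.EllipticCertificate v₀ φ i c) ?_
  unfold EllipticCertificate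
  exact ((hE.re_isFrameCode hS hφ v₀).comp (f := fun q : (GroupWord n × GroupWord n ×
      List (GroupWord n)) × FrameCode V E N × GroupWord N => ((q.1.1, q.1.2.2), q.2.1))
      (by fun_prop)).and
    (((hE.re_parallel hS).comp (f := fun q : (GroupWord n × GroupWord n ×
      List (GroupWord n)) × FrameCode V E N × GroupWord N =>
      (v₀, φ q.1.2.1 ++ S.arcLetters v₀ q.2.1.2.2.2,
        S.arcLetters v₀ q.2.1.2.2.2 ++ [Sum.inl (q.2.1.2.1.2.1.1.1, q.2.2)],
        q.2.1.2.1.2.1.1.1)) (by fun_prop)).and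
    (hE.re_not_power_same.comp (f := fun q : (GroupWord n × GroupWord n ×
      List (GroupWord n)) × FrameCode V E N × GroupWord N =>
      (q.2.1.1, q.2.1.2.1.2.1, q.2.1.2.1.2.2, q.2.2)) (by fun_prop)))

/-- The power coset membership problem is decidable in a group with an effective splitting with
Noetherian edge groups over which all folded graphs are tame. -/
theorem computablePred_powerCoset [Countable G] (hE : S.Effective) (hS : S.IsFaithful)
    (hnoeth : ∀ e, ∀ K ≤ S.edge e, K.FG)
    (htame : ∀ D : GraphCode V E N, S.Folded D → D.2.Nodup → S.Tame D) (v₀ : V) (s : Fin n → G) :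
    ComputablePred fun i : GroupWord n × GroupWord n × List (GroupWord n) =>
      ∃ m : ℤ, m ≠ 0 ∧ ∃ h ∈ GroupWord.span s i.2.2,
        GroupWord.eval s i.2.1 ^ m = GroupWord.eval s i.1 * h := by
  obtain ⟨φ, hφ, hφ'⟩ := exists_translates (S := S) hS v₀ s
  refine ComputablePred.computable_iff_re_compl_re'.2 ⟨?_, ?_⟩
  · refine GroupWord.re_powerCoset (((hE.re_parallel hS).comp
      (f := fun q : GroupWord n × GroupWord n => (v₀, φ q.1, φ q.2, v₀)) (by fun_prop)).of_eq
      fun q => ?_)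
    dsimp only [Parallel]
    rw [(hφ' q.1).2, (hφ' q.2).2]
    simp only [(hφ' q.1).1, (hφ' q.2).1, true_and]
  · have h1 := hE.re_hyperbolic hS hφ v₀
    have h0 := hE.re_elliptic hS hφ v₀
    refine ((h0.or (h0.comp (f := fun q : GroupWord n × GroupWord n × List (GroupWord n) =>
      (q.1, q.2.1.inv, q.2.2)) (by fun_prop))).or (h1.and (h1.comp (f := fun q : GroupWord n ×
      GroupWord n × List (GroupWord n) => (q.1, q.2.1.inv, q.2.2)) (by fun_prop)))).of_eq
      fun ⟨x, g, X⟩ => ?_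
    constructor
    · rintro ((⟨c, hc⟩ | ⟨c, hc⟩) | ⟨⟨c, hc⟩, ⟨c', hc'⟩⟩) ⟨m, hm, h, hh, heq⟩
      · exact hc.ne hS hφ' hm hh heq
      · exact hc.ne hS hφ' (neg_ne_zero.2 hm) hh (by simpa using heq)
      · obtain ⟨k, rfl | rfl⟩ := m.eq_nat_or_neg
        · exact hc.ne hS hφ' (m := k) (by simpa using hm) hh (by simpa using heq)
        · exact hc'.ne hS hφ' (m := k) (by simpa using hm) hh (by simpa using heq)
    · intro hno
      have h2 : ∀ m : ℤ, m ≠ 0 → ∀ h ∈ GroupWord.span s X,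
          GroupWord.eval s g ^ m ≠ GroupWord.eval s x * h :=
        fun m hm h hh heq => hno ⟨m, hm, h, hh, heq⟩
      have h3 : ∀ m : ℤ, m ≠ 0 → ∀ h ∈ GroupWord.span s X,
          GroupWord.eval s g.inv ^ m ≠ GroupWord.eval s x * h := by
        intro m hm h hh heq
        exact h2 (-m) (neg_ne_zero.2 hm) h hh (by simpa using heq)
      rcases exists_certificate hS hnoeth htame hφ' h2 with h | h
      · exact Or.inl (Or.inl h)
      rcases exists_certificate hS hnoeth htame hφ' h3 with h' | h'
      · exact Or.inl (Or.inr h')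
      · exact Or.inr ⟨h, h'⟩

end Effective

end Computability

end Splitting

/-! ### The algorithms of a benign graph of groups -/

theorem ComputablePred.comp {α β : Type*} [Primcodable α] [Primcodable β] {p : β → Prop}
    (hp : ComputablePred p) {f : α → β} (hf : Computable f) : ComputablePred fun a => p (f a) := by
  obtain ⟨g, hg, rfl⟩ := ComputablePred.computable_iff.1 hp
  exact ComputablePred.computable_iff.2 ⟨fun a => g (f a), hg.comp hf, rfl⟩

theorem Generates.exists_word {G : Type*} [Group G] {n : ℕ} {s : Fin n → G} (hs : Generates s)
    (g : G) : ∃ w, GroupWord.eval s w = g :=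
  (GroupWord.exists_eval_iff s g).2 (hs ▸ Subgroup.mem_top g)

theorem exists_generates (G : Type*) [Group G] [h : Group.FG G] :
    ∃ (n : ℕ) (s : Fin n → G), Generates s := by
  obtain ⟨X, hX, hfin⟩ := Group.fg_iff.1 h
  obtain ⟨n, s, -, rfl⟩ := hfin.fin_param
  exact ⟨n, s, hX⟩

theorem Generates.exists_extend {G : Type*} [Group G] {n N : ℕ} {s : Fin n → G} (hs : Generates s)
    (h : n ≤ N) : ∃ s' : Fin N → G, Generates s' := by
  refine ⟨fun i => if h : i.1 < n then s ⟨i, h⟩ else 1, top_unique ?_⟩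
  rw [← hs]
  refine Subgroup.closure_mono ?_
  rintro _ ⟨i, rfl⟩
  exact ⟨Fin.castLE h i, by simp⟩

/-- Membership of `w` in `⟨X⟩` is power coset membership of the trivial element in `w ⟨X⟩`. -/
theorem DecidablePowerCosetMembership.membership {G : Type*} [Group G]
    (h : DecidablePowerCosetMembership G) {n : ℕ} {s : Fin n → G} (hs : Generates s) :
    ComputablePred fun i : GroupWord n × List (GroupWord n) =>
      GroupWord.eval s i.1 ∈ GroupWord.span s i.2 := by
  refine ((h.2 n s hs).comp (f := fun i : GroupWord n × List (GroupWord n) => (i.1, [], i.2))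
    (by fun_prop)).of_eq fun i => ?_
  constructor
  · rintro ⟨m, -, h, hh, h1⟩
    rw [GroupWord.eval_nil, one_zpow] at h1
    rw [eq_inv_of_mul_eq_one_left h1.symm]
    exact inv_mem hh
  · intro hi
    exact ⟨1, one_ne_zero, _, inv_mem hi, by simp⟩

/-- The images of words under a homomorphism that is given on the generators can be computed. -/
theorem GroupWord.exists_computable_map {G H : Type*} [Group G] [Group H] {k n : ℕ} (r : Fin k → G)
    {s : Fin n → H} (hs : Generates s) (f : G →* H) : ∃ F : GroupWord k → GroupWord n,
      Computable F ∧ ∀ w, GroupWord.eval s (F w) = f (GroupWord.eval r w) := by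
  choose b hb using fun p : Fin k × Bool =>
    hs.exists_word (if p.2 then f (r p.1) else (f (r p.1))⁻¹)
  refine ⟨fun w => w.flatMap b, Primrec.to_comp (Primrec.list_flatMap Primrec.id
    (Primrec.to₂ ((Primrec.dom_finite b).comp Primrec.snd))), fun w => ?_⟩
  induction w with
  | nil => simp
  | cons p w ih =>
    dsimp only at ih ⊢
    rw [List.flatMap_cons, GroupWord.eval_append, ih, hb, GroupWord.eval_cons, map_mul]
    cases p.2 <;> simp

namespace GraphOfGroups

variable {V : Type u} [Quiver.{v} V] [Quiver.HasInvolutiveReverse V]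
  {A : GraphOfGroups.{u, v, w, x} V} {v₀ : V} {N : ℕ} (t : ∀ a, A.Path v₀ a)
  (s : ∀ a, Fin N → A.VG a) (hs : ∀ a, Generates (s a))

theorem span_splitting (a : V) (X : List (GroupWord N)) :
    GroupWord.span ((splitting t s hs).gen a) X = (GroupWord.span (s a) X).map (ι t a) :=
  GroupWord.span_comp (s a) (ι t a) X

theorem ι_mem_span_splitting {a : V} {X : List (GroupWord N)} {g : A.VG a} :
    ι t a g ∈ GroupWord.span ((splitting t s hs).gen a) X ↔ g ∈ GroupWord.span (s a) X := by
  rw [span_splitting]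
  exact Subgroup.mem_map_iff_mem (ι_injective t a)

/-- The words for elements of the edge groups are found by searching through the words in
generators of the edge groups. -/
theorem re_transport_splitting (hA : A.IsBenign)
    (hvert : ∀ a : V, DecidablePowerCosetMembership (A.VG a)) (e : Σ a b : V, (a ⟶ b)) :
    REPred fun i : GroupWord N × GroupWord N =>
      (splitting t s hs).ev ((splitting t s hs).src e) i.1 ∈ (splitting t s hs).edge e ∧
      ((splitting t s hs).τ e)⁻¹ * (splitting t s hs).ev ((splitting t s hs).src e) i.1 *
        (splitting t s hs).τ e = (splitting t s hs).ev ((splitting t s hs).tgt e) i.2 := by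
  obtain ⟨a, b, e⟩ := e
  have := hA.edge_fg e
  obtain ⟨k, r, hr⟩ := exists_generates (A.EG e)
  obtain ⟨Fα, hα, hα'⟩ := GroupWord.exists_computable_map r (hs a) (A.α e)
  obtain ⟨Fω, hω, hω'⟩ := GroupWord.exists_computable_map r (hs b) (A.ω e)
  have heq : ∀ a, REPred fun q : GroupWord N × GroupWord N =>
      GroupWord.eval (s a) q.1 = GroupWord.eval (s a) q.2 := by
    intro a
    refine (((hvert a).membership (hs a)).to_re.comp (f := fun q : GroupWord N × GroupWord N =>
      (q.1 ++ q.2.inv, [])) (by fun_prop)).of_eq fun q => ?_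
    simp [GroupWord.mem_span_nil, mul_inv_eq_one]
  refine (REPred.ex (p := fun (i : GroupWord N × GroupWord N) (u : GroupWord k) =>
    GroupWord.eval (s a) i.1 = GroupWord.eval (s a) (Fα u) ∧
    GroupWord.eval (s b) i.2 = GroupWord.eval (s b) (Fω u))
    (((heq a).comp (f := fun q : (GroupWord N × GroupWord N) × GroupWord k => (q.1.1, Fα q.2))
      (by fun_prop)).and ((heq b).comp (f := fun q : (GroupWord N × GroupWord N) × GroupWord k =>
      (q.1.2, Fω q.2)) (by fun_prop)))).of_eq fun i => ?_
  simp only [ev_splitting, mem_edge_splitting]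
  change _ ↔ (∃ z, ι t a (A.α e z) = ι t a (GroupWord.eval (s a) i.1)) ∧
    (edgeVal t e)⁻¹ * ι t a (GroupWord.eval (s a) i.1) * edgeVal t e =
      ι t b (GroupWord.eval (s b) i.2)
  constructor
  · rintro ⟨u, h1, h2⟩
    rw [hα'] at h1
    rw [hω'] at h2
    rw [h1, h2]
    exact ⟨⟨_, rfl⟩, conj_edgeVal t e _⟩
  · rintro ⟨⟨z, hz⟩, h⟩
    obtain ⟨u, rfl⟩ := hr.exists_word z
    refine ⟨u, ?_, ?_⟩
    · rw [hα']
      exact (ι_injective t a hz).symm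
    · rw [hω']
      refine ι_injective t b ?_
      rw [← h, ← hz, conj_edgeVal]

theorem effective_splitting (hA : A.IsBenign)
    (hvert : ∀ a : V, DecidablePowerCosetMembership (A.VG a)) : (splitting t s hs).Effective where
  membership a := by
    refine ((hvert a).membership (hs a)).of_eq fun i => ?_
    rw [ev_splitting]
    exact (ι_mem_span_splitting t s hs).symm
  powerCoset a := by
    refine ((hvert a).2 N (s a) (hs a)).of_eq fun i => exists_congr fun m =>
      and_congr_right fun _ => ?_
    simp only [ev_splitting]
    constructor
    · rintro ⟨h, hh, h1⟩
      exact ⟨_, (ι_mem_span_splitting t s hs).2 hh, by rw [← map_zpow, h1, map_mul]⟩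
    · rintro ⟨h, hh, h1⟩
      rw [span_splitting] at hh
      obtain ⟨h, hh, rfl⟩ := hh
      exact ⟨h, hh, ι_injective t a (by rw [map_zpow, h1, map_mul])⟩
  meets := by
    rintro ⟨a, b, e⟩
    obtain ⟨F, hF, h⟩ := hA.coset_intersection e N (s a) (hs a)
    have h1 : ComputablePred fun i : GroupWord N × List (GroupWord N) =>
        (F (i.2, i.1)).isSome = true :=
      ComputablePred.computable_iff.2 ⟨_, Primrec.option_isSome.to_comp.comp (hF.comp
        (Computable.snd.pair Computable.fst)), rfl⟩
    refine h1.of_eq fun i => ?_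
    have h2 := (h i.2 i.1).1
    rw [Option.isSome_iff_ne_none, ne_eq, h2]
    push Not
    have h3 : ∀ c, ι t a (GroupWord.eval (s a) i.1) * ι t a (A.α e c) ∈
        GroupWord.span ((splitting t s hs).gen a) i.2 ↔
        GroupWord.eval (s a) i.1 * A.α e c ∈ GroupWord.span (s a) i.2 := by
      intro c
      rw [← map_mul, ι_mem_span_splitting]
    simp only [ev_splitting, mem_edge_splitting]
    constructor
    · rintro ⟨c, hc⟩
      exact ⟨_, ⟨c, rfl⟩, (h3 c).2 hc⟩
    · rintro ⟨_, ⟨c, rfl⟩, hc⟩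
      exact ⟨c, (h3 c).1 hc⟩
  inter := by
    rintro ⟨a, b, e⟩
    obtain ⟨F, hF, h⟩ := hA.intersection_generators e N (s a) (hs a)
    refine ⟨F, hF, fun X => ?_⟩
    change GroupWord.span ((splitting t s hs).gen a) (F X) =
      GroupWord.span ((splitting t s hs).gen a) X ⊓ (A.α e).range.map (ι t a)
    rw [span_splitting, span_splitting, h, Subgroup.map_inf _ _ _ (ι_injective t a)]
  transport := re_transport_splitting t s hs hA hvert

theorem exists_path (hA : A.IsBenign) (a b : V) : Nonempty (A.Path a b) := by
  obtain ⟨p⟩ := hA.connected a b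
  induction p with
  | nil => exact ⟨Path.nil 1⟩
  | cons _ e ih => exact ih.map fun q => q.comp (Path.cons 1 e (Path.nil 1))

theorem exists_generating_tuples (hA : A.IsBenign) :
    ∃ (N : ℕ) (s : ∀ a, Fin N → A.VG a), ∀ a, Generates (s a) := by
  have := hA.finite_vertices
  have := hA.vertex_fg
  choose n s hs using fun a => exists_generates (A.VG a)
  obtain ⟨N, hN⟩ := (Set.finite_range n).bddAbove
  choose s' hs' using fun a => (hs a).exists_extend (hN ⟨a, rfl⟩)
  exact ⟨N, s', hs'⟩

end GraphOfGroups

/-- A group with a splitting over a finite graph is generated by the vertex groups and the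
edges. -/
theorem Splitting.IsFaithful.group_fg {V E G : Type*} [Group G] {N : ℕ} [Finite V] [Finite E]
    {S : Splitting V E G N} (hS : S.IsFaithful) (v₀ : V) : Group.FG G := by
  let X : Set G := Set.range (fun q : V × Fin N => S.gen q.1 q.2) ∪ Set.range S.τ
  have hX : ∀ v, S.vert v ≤ Subgroup.closure X := by
    intro v
    rw [← S.closure_gen]
    refine Subgroup.closure_mono ?_
    rintro _ ⟨i, rfl⟩
    exact Or.inl ⟨(v, i), rfl⟩
  refine Group.fg_iff.2 ⟨X, top_unique fun g _ => ?_,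
    (Set.finite_range _).union (Set.finite_range _)⟩
  obtain ⟨g₀, hg₀, l, hl, rfl⟩ := hS.exists_path v₀ v₀ g
  refine mul_mem (hX _ hg₀) ?_
  clear hg₀
  suffices h : ∀ a, S.IsPath a l v₀ → S.lval l ∈ Subgroup.closure X from h v₀ hl
  clear hl
  intro a hl
  induction l generalizing a with
  | nil => exact one_mem _
  | cons p l ih =>
    rw [S.lval_cons]
    exact mul_mem (mul_mem (Subgroup.subset_closure (Or.inr ⟨p.1, rfl⟩)) (hX _ hl.2.1))
      (ih (Subgroup.mem_top _) _ hl.2.2)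

theorem mainTheorem6 {V : Type u} [Quiver.{v} V] [Quiver.HasInvolutiveReverse V]
    (A : GraphOfGroups.{u, v, w, x} V) (v₀ : V) (hA : A.IsBenign)
    (hvert : ∀ a : V, DecidablePowerCosetMembership (A.VG a))
    (hread : ∀ 𝔹 : A.AGraph, 𝔹.IsFinitelyDescribed → 𝔹.IsFolded → 𝔹.PowerReadingConditions) :
    DecidablePowerCosetMembership (A.FundamentalGroup v₀) := by
  have := hA.finite_vertices
  have := hA.finite_edges
  obtain ⟨N, s, hs⟩ := GraphOfGroups.exists_generating_tuples hA
  let t : ∀ a, A.Path v₀ a := fun a => (GraphOfGroups.exists_path hA v₀ a).some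
  have hS := GraphOfGroups.isFaithful_splitting t s hs
  have hfg : Group.FG (A.FundamentalGroup v₀) := hS.group_fg v₀
  obtain ⟨_, r, hr⟩ := exists_generates (A.FundamentalGroup v₀)
  have : Countable (A.FundamentalGroup v₀) :=
    Function.Surjective.countable (f := GroupWord.eval r) hr.exists_word
  let _ : Primcodable V := Primcodable.ofEquiv _ (Finite.equivFin V)
  let _ : Primcodable (Σ a b : V, (a ⟶ b)) := Primcodable.ofEquiv _ (Finite.equivFin _)
  refine ⟨hfg, fun n r _ => ?_⟩
  exact (GraphOfGroups.effective_splitting t s hs hA hvert).computablePred_powerCoset hS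
    (fun e K hK => GraphOfGroups.fg_of_le_edge t s hs hA hK)
    (fun D hD hN => GraphOfGroups.tame_of_powerReadingConditions hread hD hN) v₀ r
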